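/- Let $\mathbb R_+=[0,\infty)$ and let $W:\mathbb R_+^2\to[0,1]$ be a measurable symmetric function such that $(0,0,W)$ is a graphex; that is, with $\mu_W(x)=\int_{\mathbb R_+}W(x,y)\,dy$: $\mu_W<\infty$ almost everywhere, $\{\mu_W>1\}$ has finite Lebesgue measure, $\int_{\mathbb R_+^2} W(x,y)\,1[\mu_W(x)\le 1]\,1[\mu_W(y)\le 1]\,dx\,dy<\infty$, and $\int_{\mathbb R_+}W(x,x)\,dx<\infty$. Let $G$ be the Kallenberg exchangeable graph with graphex $(0,0,W)$: given a unit rate Poisson process $\{(\theta_i,\vartheta_i)\}$ on $\mathbb R_+^2$ and independent i.i.d. uniform $[0,1]$ variables $\zeta_{\{i,j\}}$ (including $i=j$), the edges of $G$ are the pairs $\{\theta_i,\theta_j\}$ with $W(\vartheta_i,\vartheta_j)>\zeta_{\{i,j\}}$. For $\nu\ge 0$ let $G_\nu$ consist of the edges with both endpoints in $[0,\nu]$, with vertices those labels that participate in at least one such edge, and let $e_\nu$, $v_\nu$ be its numbers of edges and vertices. (1) Suppose that $W$ is not almost everywhere zero and that $W$ is compactly supported, or, more generally, that $W$ vanishes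 almost everywhere outside $S\times S$ for some measurable $S\subseteq\mathbb R_+$ of finite Lebesgue measure. Then $G$ is dense with probability 1: almost surely all $G_\nu$ are finite, $v_\nu\to\infty$, and there is a constant $c>0$ with $e_\nu\ge c\,v_\nu^2$ for all sufficiently large $\nu$. (2) Suppose that $W$ is integrable and does not have essentially finite-measure support, i.e. there is no measurable $S\subseteq\mathbb R_+$ of finite Lebesgue measure such that $W$ vanishes almost everywhere outside $S\times S$. Then $G$ is sparse with probability 1: almost surely all $G_\nu$ are finite, $v_\nu\to\infty$, and $\sqrt{e_\nu}/v_\nu\to 0$ as $\nu\to\infty$, i.e. $e_\nu=o(v_\nu^2)$. -/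

import Mathlib

open MeasureTheory ProbabilityTheory Filter Topology
open scoped ENNReal NNReal

namespace KEG

noncomputable section

/-- Lebesgue measure on the half line `ℝ₊ = [0, ∞)`, as a measure on `ℝ`. -/
def halfLine : Measure ℝ := volume.restrict (Set.Ici 0)

/-- Lebesgue measure on the quadrant `ℝ₊²`, as a measure on `ℝ × ℝ`. -/
def quadrant : Measure (ℝ × ℝ) := halfLine.prod halfLine

/-! ### Graphexes -/

/-- The graphex marginal `μ_W(x) = ∫_{ℝ₊} W(x, y) dy`, with values in `[0, ∞]`. -/
def marginal (W : ℝ → ℝ → ℝ) (x : ℝ) : ℝ≥0∞ :=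
  ∫⁻ y, ENNReal.ofReal (W x y) ∂halfLine

/-- `(0, 0, W)` is a graphex: `W : ℝ₊² → [0, 1]` is measurable and symmetric and satisfies the
conditions for local finiteness. (`W` is written as a function on `ℝ × ℝ`; only its values on
`ℝ₊²` are constrained or used, and a function on `ℝ₊²` can be extended by zero.) -/
structure IsGraphex (W : ℝ → ℝ → ℝ) : Prop where
  measurable : Measurable (Function.uncurry W)
  symm : ∀ x y, 0 ≤ x → 0 ≤ y → W x y = W y x
  nonneg : ∀ x y, 0 ≤ x → 0 ≤ y → 0 ≤ W x y
  le_one : ∀ x y, 0 ≤ x → 0 ≤ y → W x y ≤ 1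
  marginal_lt_top : ∀ᵐ x ∂halfLine, marginal W x < ∞
  marginal_gt_one : halfLine {x | 1 < marginal W x} < ∞
  marginal_le_one :
    ∫⁻ z in {z : ℝ × ℝ | marginal W z.1 ≤ 1 ∧ marginal W z.2 ≤ 1},
      ENNReal.ofReal (W z.1 z.2) ∂quadrant < ∞
  diagonal : ∫⁻ x, ENNReal.ofReal (W x x) ∂halfLine < ∞

/-- `W` vanishes almost everywhere on `ℝ₊²`. -/
def IsAEZero (W : ℝ → ℝ → ℝ) : Prop := ∀ᵐ z ∂quadrant, W z.1 z.2 = 0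

/-- `W` is integrable over `ℝ₊²`. -/
def IsIntegrable (W : ℝ → ℝ → ℝ) : Prop := Integrable (Function.uncurry W) quadrant

/-- `W` is compactly supported: it vanishes on `ℝ₊²` outside some square `[0, c]²`. -/
def IsCompactlySupported (W : ℝ → ℝ → ℝ) : Prop :=
  ∃ c : ℝ, ∀ x y, 0 ≤ x → 0 ≤ y → W x y ≠ 0 → x ≤ c ∧ y ≤ c

/-- `W` has finite-measure support: it vanishes almost everywhere on `ℝ₊²` outside `S × S` for
some measurable set `S` of finite Lebesgue measure. This is compactness of the support up to null
sets and up to measure-preserving changes of the latent coordinate. -/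
def HasFiniteMeasureSupport (W : ℝ → ℝ → ℝ) : Prop :=
  ∃ S : Set ℝ, MeasurableSet S ∧ halfLine S < ∞ ∧
    ∀ᵐ z ∂quadrant, z ∉ S ×ˢ S → W z.1 z.2 = 0

/-! ### Poisson processes and the random graph -/

/-- The number of points of the sequence `p` that lie in `A`. -/
def count {Ω X : Type*} (p : ℕ → Ω → X) (A : Set X) (ω : Ω) : ℕ∞ :=
  {i | p i ω ∈ A}.encard

/-- The random points `p 0, p 1, …` enumerate (in any random order) a Poisson process with
intensity measure `m`: counts of sets of finite intensity are Poisson distributed, and counts of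
disjoint sets are independent. -/
structure IsPoissonProcess {Ω X : Type*} [MeasurableSpace Ω] [MeasurableSpace X]
    (P : Measure Ω) (m : Measure X) (p : ℕ → Ω → X) : Prop where
  measurable : ∀ i, Measurable (p i)
  count_law : ∀ A : Set X, MeasurableSet A → m A < ∞ → ∀ k : ℕ,
    P {ω | count p A ω = k} = poissonMeasure (m A).toNNReal {k}
  indep : ∀ (n : ℕ) (A : Fin n → Set X), (∀ j, MeasurableSet (A j)) →
    Pairwise (fun i j => Disjoint (A i) (A j)) → iIndepFun (fun j => count p (A j)) P

/-- The randomness that drives a Kallenberg exchangeable graph: the points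
`p i = (θᵢ, ϑᵢ)` (label, latent value) enumerate a unit rate Poisson process on `ℝ₊²`, and
`ζ s(i, j)` are i.i.d. uniform on `[0, 1]`, indexed by unordered pairs (with `i = j` allowed),
independent of the points. -/
structure IsKEGSource {Ω : Type*} [MeasurableSpace Ω] (P : Measure Ω)
    (p : ℕ → Ω → ℝ × ℝ) (ζ : Sym2 ℕ → Ω → ℝ) : Prop where
  poisson : IsPoissonProcess P quadrant p
  measurable : ∀ e, Measurable (ζ e)
  uniform : ∀ e, P.map (ζ e) = volume.restrict (Set.Icc 0 1)
  iid : iIndepFun ζ P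
  indep : IndepFun (fun ω i => p i ω) (fun ω e => ζ e ω) P

/-- The edge set of the Kallenberg exchangeable graph with graphex `(0, 0, W)`: the unordered
pairs `{θᵢ, θⱼ}` (a self edge if `i = j`) with `W(ϑᵢ, ϑⱼ) > ζ_{i,j}`. -/
def edgeSet {Ω : Type*} (W : ℝ → ℝ → ℝ) (p : ℕ → Ω → ℝ × ℝ) (ζ : Sym2 ℕ → Ω → ℝ) (ω : Ω) :
    Set (Sym2 ℝ) :=
  {e | ∃ i j : ℕ, ζ s(i, j) ω < W (p i ω).2 (p j ω).2 ∧ e = s((p i ω).1, (p j ω).1)}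

/-! ### Truncations, sparsity and density

A graph without isolated vertices, with vertices labelled by real numbers and self edges allowed,
is represented by its edge set `E`. -/

/-- The edge set of the truncation `G_ν`: the edges with both labels in `[0, ν]`. -/
def truncation (E : Set (Sym2 ℝ)) (ν : ℝ) : Set (Sym2 ℝ) :=
  {e ∈ E | ∀ x ∈ e, x ∈ Set.Icc 0 ν}

/-- The vertex set: the labels that participate in at least one edge. -/
def vertexSet (E : Set (Sym2 ℝ)) : Set ℝ := {x | ∃ e ∈ E, x ∈ e}

/-- The number of edges `e_ν` of the truncation `G_ν`. -/
def numEdges (E : Set (Sym2 ℝ)) (ν : ℝ) : ℕ := (truncation E ν).ncard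

/-- The number of vertices `v_ν` of the truncation `G_ν`. -/
def numVertices (E : Set (Sym2 ℝ)) (ν : ℝ) : ℕ := (vertexSet (truncation E ν)).ncard

/-- All truncations are finite graphs and the number of vertices diverges. -/
def HasGrowingTruncations (E : Set (Sym2 ℝ)) : Prop :=
  (∀ ν, (truncation E ν).Finite) ∧ Tendsto (numVertices E) atTop atTop

/-- The family of truncations is sparse: `√e_ν / v_ν → 0`, i.e. `e_ν = o(v_ν²)`. -/
def IsSparse (E : Set (Sym2 ℝ)) : Prop :=
  HasGrowingTruncations E ∧
    Tendsto (fun ν => √(numEdges E ν : ℝ) / (numVertices E ν : ℝ)) atTop (𝓝 0)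

/-- The family of truncations is dense: `e_ν = Ω(v_ν²)`. -/
def IsDense (E : Set (Sym2 ℝ)) : Prop :=
  HasGrowingTruncations E ∧
    ∃ c : ℝ, 0 < c ∧ ∀ᶠ ν in atTop, c * (numVertices E ν : ℝ) ^ 2 ≤ (numEdges E ν : ℝ)

end

end KEG

set_option linter.unusedSectionVars false

namespace KEG

/-! ### Sums over tuples -/

/-! Finite-measure support forces `W` to be integrable, because `W ≤ 1`, so both claims concern
integrable `W`. For such `W` the number of edges in the window `[0, ν]` is of exact order `ν²`
unless `W` vanishes almost everywhere, and self edges contribute only `O(ν)`. Density or sparsity is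
therefore decided by whether the number of vertices is linear or superlinear in `ν`.

If `W` lives on `S × S`, every vertex without a self edge has its latent value in `S`, and the
window contains about `ν |S|` such points, so `v_ν = O(ν)` (`IsKEGSource.ae_isDense`). If there is
no such `S`, the marginal is positive on a set of infinite measure, hence lies between two positive
constants on sets `A` of finite but arbitrarily large measure. About `ν |A|` points of the window
have latent value in `A`, and by a Chebyshev estimate only `o(ν)` of them are isolated, so `v_ν / ν
→ ∞` (`IsKEGSource.ae_nonisolated_superlinear`).

The almost sure bounds come from first and second moments along `ν = 2 ^ k`, a Borel–Cantelli
argument (`ae_eventually_close`), and monotonicity in `ν` between powers of two. The moments follow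
from the multivariate Mecke formula (`IsPoissonProcess.mecke`), proved here from the counting
definition of a Poisson process, after the uniform marks have been integrated out. The variance of
the edge count involves `∫ μ²`, which may be infinite. The kernel is therefore truncated to
marginals at most `2 ^ k` in the window `[0, 2 ^ k]`: integrability of `μ` makes the truncated
variances summable after normalisation, and makes the window eventually free of discarded points. -/

theorem tsum_fin_succ {k : ℕ} (f : (Fin (k + 1) → ℕ) → ℝ≥0∞) :
    ∑' t, f t = ∑' i, ∑' t : Fin k → ℕ, f (Fin.cons i t) := by
  rw [← ENNReal.tsum_prod, ← (Fin.consEquiv (fun _ : Fin (k + 1) => ℕ)).tsum_eq]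
  rfl

theorem tsum_fin_zero (f : (Fin 0 → ℕ) → ℝ≥0∞) : ∑' t, f t = f Fin.elim0 := by
  rw [tsum_eq_single Fin.elim0]
  intro b hb
  exact absurd (Subsingleton.elim _ _) hb

theorem prod_tsum {k : ℕ} (f : Fin k → ℕ → ℝ≥0∞) :
    ∏ a, ∑' i, f a i = ∑' t : Fin k → ℕ, ∏ a, f a (t a) := by
  induction k with
  | zero => simp
  | succ k ih =>
    rw [tsum_fin_succ, Fin.prod_univ_succ, ih, ← ENNReal.tsum_mul_right]
    refine tsum_congr fun i => ?_
    rw [← ENNReal.tsum_mul_left]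
    refine tsum_congr fun t => ?_
    rw [Fin.prod_univ_succ]
    simp

/-! ### The base measures -/

instance : SigmaFinite halfLine := by unfold halfLine; infer_instance
instance : NullSingletonClass halfLine := by unfold halfLine; infer_instance
instance : SigmaFinite quadrant := by unfold quadrant; infer_instance

theorem quadrant_prod (A B : Set ℝ) : quadrant (A ×ˢ B) = halfLine A * halfLine B :=
  Measure.prod_prod _ _

theorem quadrant_label_null (c : ℝ) : quadrant {x | x.1 = c} = 0 := by
  have : {x : ℝ × ℝ | x.1 = c} = {c} ×ˢ Set.univ := by ext; simp
  rw [this, quadrant_prod]; simp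

theorem halfLine_le_volume : halfLine ≤ volume := Measure.restrict_le_self

theorem halfLine_Icc {ν : ℝ} : halfLine (Set.Icc 0 ν) = ENNReal.ofReal ν := by
  rw [halfLine, Measure.restrict_eq_self _ (fun x hx => hx.1)]
  simp

/-! ### First properties of Poisson processes -/

section Poisson

variable {Ω X : Type*} [MeasurableSpace Ω] [MeasurableSpace X]

theorem count_eq_tsum (p : ℕ → Ω → X) (A : Set X) (ω : Ω) :
    ((count p A ω : ℕ∞) : ℝ≥0∞) = ∑' i, A.indicator 1 (p i ω) := by
  rw [count, ← ENNReal.tsum_set_one, tsum_subtype {i | p i ω ∈ A} (fun _ => (1 : ℝ≥0∞))]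
  refine tsum_congr fun i => ?_
  by_cases h : p i ω ∈ A <;> simp [h]

theorem measurable_toENNReal_count {p : ℕ → Ω → X} (hp : ∀ i, Measurable (p i)) {A : Set X}
    (hA : MeasurableSet A) : Measurable fun ω => ((count p A ω : ℕ∞) : ℝ≥0∞) := by
  simp_rw [count_eq_tsum]
  exact Measurable.tsum fun i => (measurable_one.indicator hA).comp (hp i)

theorem measurable_count {p : ℕ → Ω → X} (hp : ∀ i, Measurable (p i)) {A : Set X}
    (hA : MeasurableSet A) : Measurable (count p A) := by
  refine measurable_to_countable' fun n => ?_
  have : count p A ⁻¹' {n} = (fun ω => ((count p A ω : ℕ∞) : ℝ≥0∞)) ⁻¹' {(n : ℝ≥0∞)} := by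
    ext ω; simp
  rw [this]
  exact measurable_toENNReal_count hp hA (measurableSet_singleton _)

theorem tsum_poissonMeasure (r : ℝ≥0) : ∑' n : ℕ, poissonMeasure r {n} = 1 := by
  have h := measure_iUnion (μ := poissonMeasure r) (f := fun n : ℕ => ({n} : Set ℕ))
    (fun a b hab => by simpa using hab) (fun n => measurableSet_singleton n)
  rw [← h, Set.iUnion_of_singleton, measure_univ]

theorem tsum_poissonMeasure_mul (r : ℝ≥0) :
    ∑' n : ℕ, (n : ℝ≥0∞) * poissonMeasure r {n} = r := by
  rw [tsum_eq_zero_add' ENNReal.summable]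
  simp only [Nat.cast_zero, zero_mul, zero_add, poissonMeasure_singleton]
  -- Size biasing a Poisson law shifts it by one and produces the factor `r`.
  have : ∀ n : ℕ, ((n + 1 : ℕ) : ℝ≥0∞) *
      ENNReal.ofReal (Real.exp (-r) * r ^ (n + 1) / (n + 1).factorial) =
      r * poissonMeasure r {n} := by
    intro n
    rw [poissonMeasure_singleton, ← ENNReal.ofReal_natCast, ← ENNReal.ofReal_coe_nnreal,
      ← ENNReal.ofReal_mul (by positivity), ← ENNReal.ofReal_mul (by positivity)]
    congr 1
    rw [Nat.factorial_succ]
    push_cast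
    field_simp
    ring
  rw [tsum_congr this, ENNReal.tsum_mul_left]
  rw [tsum_poissonMeasure, mul_one]

variable {P : Measure Ω} [IsProbabilityMeasure P] {m : Measure X} {p : ℕ → Ω → X}

/-- `count_law` only speaks of finite values; since these already carry total mass one, nothing is
left for `⊤`. -/
theorem IsPoissonProcess.ae_count_ne_top (h : IsPoissonProcess P m p) {A : Set X}
    (hA : MeasurableSet A) (hm : m A < ∞) : ∀ᵐ ω ∂P, count p A ω ≠ ⊤ := by
  have hmeas : MeasurableSet {ω | count p A ω = ⊤} :=
    measurable_count h.measurable hA (measurableSet_singleton _)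
  have h1 : P (⋃ n : ℕ, {ω | count p A ω = n}) = 1 := by
    rw [measure_iUnion]
    · simp_rw [h.count_law A hA hm]
      exact tsum_poissonMeasure _
    · intro a b hab
      refine Set.disjoint_left.2 fun ω h1 h2 => hab ?_
      have := h1.symm.trans h2
      exact_mod_cast this
    · intro n
      exact measurable_count h.measurable hA (measurableSet_singleton _)
  have h2 : {ω | count p A ω = ⊤} = (⋃ n : ℕ, {ω | count p A ω = n})ᶜ := by
    ext ω
    simp only [Set.mem_ofPred_eq, Set.mem_compl_iff, Set.mem_iUnion, not_exists]
    constructor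
    · intro h n; rw [h]; simp
    · intro h; by_contra h'
      obtain ⟨n, hn⟩ := ENat.ne_top_iff_exists.1 h'
      exact h n hn.symm
  have h3 : P {ω | count p A ω = ⊤} = 0 := by
    rw [h2, prob_compl_eq_zero_iff, h1]
    rw [← compl_compl (⋃ n : ℕ, {ω | count p A ω = n}), ← h2]; exact hmeas.compl
  exact measure_eq_zero_iff_ae_notMem.1 h3

theorem IsPoissonProcess.lintegral_count_of_lt_top (h : IsPoissonProcess P m p) {A : Set X}
    (hA : MeasurableSet A) (hm : m A < ∞) : ∫⁻ ω, (count p A ω : ℝ≥0∞) ∂P = m A := by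
  have h1 : ∀ᵐ ω ∂P, ((count p A ω : ℕ∞) : ℝ≥0∞) =
      ∑' n : ℕ, Set.indicator {ω | count p A ω = n} (fun _ => (n : ℝ≥0∞)) ω := by
    filter_upwards [h.ae_count_ne_top hA hm] with ω hω
    obtain ⟨n, hn⟩ := ENat.ne_top_iff_exists.1 hω
    rw [tsum_eq_single n]
    · simp [← hn]
    · intro b hb
      rw [Set.indicator_of_notMem]
      intro h'
      rw [Set.mem_ofPred_eq, ← hn] at h'
      exact hb (by exact_mod_cast h'.symm)
  have hs : ∀ n : ℕ, MeasurableSet {ω | count p A ω = n} := fun n =>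
    measurable_count h.measurable hA (measurableSet_singleton _)
  rw [lintegral_congr_ae h1, lintegral_tsum fun n => (measurable_const.indicator (hs n)).aemeasurable]
  simp_rw [fun n => lintegral_indicator_const (μ := P) (hs n) (n : ℝ≥0∞), h.count_law A hA hm]
  rw [tsum_poissonMeasure_mul, ENNReal.coe_toNNReal hm.ne]

/-- The intensity measure is the sum of the laws of the points. -/
theorem IsPoissonProcess.sum_map [SigmaFinite m] (h : IsPoissonProcess P m p) :
    Measure.sum (fun i => P.map (p i)) = m := by
  have key : ∀ A, MeasurableSet A → m A < ∞ → Measure.sum (fun i => P.map (p i)) A = m A := by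
    intro A hA hm
    rw [← h.lintegral_count_of_lt_top hA hm, Measure.sum_apply _ hA]
    simp_rw [count_eq_tsum]
    rw [MeasureTheory.lintegral_tsum (f := fun i ω => A.indicator (1 : X → ℝ≥0∞) (p i ω)) fun i =>
      ((measurable_one.indicator hA).comp (h.measurable i)).aemeasurable]
    refine tsum_congr fun i => ?_
    rw [Measure.map_apply (h.measurable i) hA]
    have : (fun ω => A.indicator (1 : X → ℝ≥0∞) (p i ω)) = (p i ⁻¹' A).indicator 1 := by
      rfl
    rw [this, lintegral_indicator_one (h.measurable i hA)]
  ext A hA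
  -- `count_law` covers only sets of finite intensity; an exhaustion handles the others.
  have hU : A = ⋃ n, A ∩ spanningSets m n := by
    rw [← Set.inter_iUnion, iUnion_spanningSets, Set.inter_univ]
  have hmono : Monotone fun n => A ∩ spanningSets m n := fun a b hab =>
    Set.inter_subset_inter_right _ (monotone_spanningSets m hab)
  rw [hU, hmono.measure_iUnion, hmono.measure_iUnion]
  refine iSup_congr fun n => key _ (hA.inter (measurableSet_spanningSets m n)) ?_
  exact (measure_mono Set.inter_subset_right).trans_lt (measure_spanningSets_lt_top m n)

/-- Campbell's formula. -/
theorem IsPoissonProcess.lintegral_tsum [SigmaFinite m] (h : IsPoissonProcess P m p)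
    {f : X → ℝ≥0∞} (hf : Measurable f) :
    ∫⁻ ω, ∑' i, f (p i ω) ∂P = ∫⁻ x, f x ∂m := by
  rw [MeasureTheory.lintegral_tsum (f := fun i ω => f (p i ω)) fun i =>
    (hf.comp (h.measurable i)).aemeasurable, ← h.sum_map, lintegral_sum_measure]
  exact tsum_congr fun i => (lintegral_map hf (h.measurable i)).symm

theorem IsPoissonProcess.lintegral_count [SigmaFinite m] (h : IsPoissonProcess P m p) {A : Set X}
    (hA : MeasurableSet A) : ∫⁻ ω, (count p A ω : ℝ≥0∞) ∂P = m A := by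
  simp_rw [count_eq_tsum]
  rw [h.lintegral_tsum (measurable_one.indicator hA), lintegral_indicator_one hA]

theorem IsPoissonProcess.ae_forall_of_ae [SigmaFinite m] (h : IsPoissonProcess P m p)
    {q : X → Prop} (hq : ∀ᵐ x ∂m, q x) : ∀ᵐ ω ∂P, ∀ i, q (p i ω) := by
  rw [ae_all_iff]
  intro i
  rw [← h.sum_map] at hq
  exact ae_of_ae_map (h.measurable i).aemeasurable (Measure.ae_sum_iff.1 hq i)

theorem IsPoissonProcess.lintegral_prod_count [SigmaFinite m] (h : IsPoissonProcess P m p) {k : ℕ}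
    (A : Fin k → Set X) (hA : ∀ j, MeasurableSet (A j))
    (hd : Pairwise fun i j => Disjoint (A i) (A j)) :
    ∫⁻ ω, ∏ j, (count p (A j) ω : ℝ≥0∞) ∂P = ∏ j, m (A j) := by
  rw [lintegral_prod_eq_prod_lintegral_of_indepFun Finset.univ
    (fun j ω => ((count p (A j) ω : ℕ∞) : ℝ≥0∞))]
  · exact Finset.prod_congr rfl fun j _ => h.lintegral_count (hA j)
  · exact (h.indep k A hA hd).comp (fun _ n => ((n : ℕ∞) : ℝ≥0∞)) fun _ => measurable_of_countable _
  · exact fun j => measurable_toENNReal_count h.measurable (hA j)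

/-- With `r` the intensity, `1 - e⁻ʳ(1 + r) ≤ 1 - (1 - r)(1 + r) = r²`. The quadratic order is what
makes a union bound over many small cells vanish. -/
theorem IsPoissonProcess.prob_two_le (h : IsPoissonProcess P m p) {A : Set X}
    (hA : MeasurableSet A) (hm : m A < ∞) : P {ω | 2 ≤ count p A ω} ≤ m A ^ 2 := by
  set r := (m A).toNNReal with hr
  have hmA : m A = ENNReal.ofReal r := by
    rw [ENNReal.ofReal_coe_nnreal, hr, ENNReal.coe_toNNReal hm.ne]
  have hs : ∀ n : ℕ, MeasurableSet {ω | count p A ω = n} := fun n =>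
    measurable_count h.measurable hA (measurableSet_singleton _)
  have h2 : {ω | 2 ≤ count p A ω} = ({ω | count p A ω = (0 : ℕ)} ∪ {ω | count p A ω = (1 : ℕ)})ᶜ := by
    ext ω
    simp only [Set.mem_ofPred_eq, Set.mem_compl_iff, Set.mem_union]
    generalize count p A ω = c
    cases c with
    | top => simp
    | coe n => norm_cast; omega
  have hd : Disjoint {ω | count p A ω = (0 : ℕ)} {ω | count p A ω = (1 : ℕ)} := by
    refine Set.disjoint_left.2 fun ω h1 h2 => ?_
    have := h1.symm.trans h2
    simp at this
  rw [h2, prob_compl_eq_one_sub ((hs 0).union (hs 1)), measure_union hd (hs 1),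
    h.count_law A hA hm, h.count_law A hA hm, poissonMeasure_singleton, poissonMeasure_singleton,
    ← ENNReal.ofReal_add (by positivity) (by positivity), hmA, ← ENNReal.ofReal_pow (by positivity),
    ← ENNReal.ofReal_one, ← ENNReal.ofReal_sub _ (by positivity)]
  apply ENNReal.ofReal_le_ofReal
  have h3 : 1 - (r : ℝ) ≤ Real.exp (-r) := Real.one_sub_le_exp_neg r
  have h4 : 0 ≤ (r : ℝ) := r.2
  simp only [pow_zero, pow_one, Nat.factorial_zero, Nat.factorial_one, Nat.cast_one, div_one, mul_one]
  rw [ENNReal.ofReal_coe_nnreal, ENNReal.toNNReal_coe]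
  nlinarith

end Poisson

/-! ### Labels are distinct -/

section Labels

variable {Ω : Type*} [MeasurableSpace Ω] {P : Measure Ω} [IsProbabilityMeasure P]
  {p : ℕ → Ω → ℝ × ℝ}

theorem ae_quadrant_nonneg : ∀ᵐ x ∂quadrant, 0 ≤ x.1 ∧ 0 ≤ x.2 := by
  have : quadrant = volume.restrict (Set.Ici (0 : ℝ) ×ˢ Set.Ici (0 : ℝ)) := by
    rw [quadrant, halfLine, Measure.prod_restrict]; rfl
  rw [this]
  exact ae_restrict_of_forall_mem (measurableSet_Ici.prod measurableSet_Ici) fun x hx => hx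

theorem IsPoissonProcess.ae_nonneg (h : IsPoissonProcess P quadrant p) :
    ∀ᵐ ω ∂P, ∀ i, 0 ≤ (p i ω).1 ∧ 0 ≤ (p i ω).2 :=
  h.ae_forall_of_ae ae_quadrant_nonneg

/-- Two points with a common label fall into one of `K (n + 1)` label strips of intensity at most `K
/ (n + 1)`. The union bound is `K³ / (n + 1)`, and `n` is arbitrary. -/
theorem IsPoissonProcess.prob_label_coincidence (h : IsPoissonProcess P quadrant p) (K : ℕ) :
    P {ω | ∃ i j, i ≠ j ∧ (p i ω).1 = (p j ω).1 ∧ (p i ω).1 ∈ Set.Ico (0 : ℝ) K ∧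
      (p i ω).2 ∈ Set.Ico (0 : ℝ) K ∧ (p j ω).2 ∈ Set.Ico (0 : ℝ) K} = 0 := by
  set E := {ω | ∃ i j, i ≠ j ∧ (p i ω).1 = (p j ω).1 ∧ (p i ω).1 ∈ Set.Ico (0 : ℝ) K ∧
      (p i ω).2 ∈ Set.Ico (0 : ℝ) K ∧ (p j ω).2 ∈ Set.Ico (0 : ℝ) K}
  have key : ∀ n : ℕ, P E ≤ ENNReal.ofReal ((K : ℝ) ^ 3 / (n + 1)) := by
    intro n
    have hn : (0 : ℝ) < n + 1 := by positivity
    set B : ℕ → Set (ℝ × ℝ) := fun c =>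
      Set.Ico ((c : ℝ) / (n + 1)) ((c + 1 : ℝ) / (n + 1)) ×ˢ Set.Ico (0 : ℝ) K with hB
    have hBm : ∀ c, MeasurableSet (B c) := fun c => measurableSet_Ico.prod measurableSet_Ico
    have hBle : ∀ c, quadrant (B c) ≤ ENNReal.ofReal (K / (n + 1)) := by
      intro c
      rw [hB, quadrant_prod]
      calc _ ≤ volume (Set.Ico ((c : ℝ) / (n + 1)) ((c + 1 : ℝ) / (n + 1))) *
            volume (Set.Ico (0 : ℝ) K) :=
            mul_le_mul' (halfLine_le_volume _) (halfLine_le_volume _)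
        _ = _ := by
          rw [Real.volume_Ico, Real.volume_Ico, sub_zero, ← ENNReal.ofReal_mul' (by positivity)]
          congr 1; field_simp; ring
    have hsub : E ⊆ ⋃ c ∈ Finset.range (K * (n + 1)), {ω | 2 ≤ count p (B c) ω} := by
      rintro ω ⟨i, j, hij, heq, hi, hi2, hj2⟩
      obtain ⟨h0, hK⟩ := hi
      have hfl : ⌊(p i ω).1 * (n + 1)⌋₊ < K * (n + 1) := by
        rw [Nat.floor_lt (mul_nonneg h0 hn.le)]
        push_cast
        exact mul_lt_mul_of_pos_right hK hn
      have hm : (p i ω).1 ∈ Set.Ico ((⌊(p i ω).1 * (n + 1)⌋₊ : ℝ) / (n + 1))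
          ((⌊(p i ω).1 * (n + 1)⌋₊ + 1 : ℝ) / (n + 1)) := by
        constructor
        · rw [div_le_iff₀ hn]; exact Nat.floor_le (mul_nonneg h0 hn.le)
        · rw [lt_div_iff₀ hn]; exact Nat.lt_floor_add_one _
      simp only [Set.mem_iUnion, Finset.mem_range]
      refine ⟨_, hfl, ?_⟩
      show 2 ≤ Set.encard _
      rw [← Set.encard_pair hij]
      apply Set.encard_le_encard
      rintro l (rfl | rfl)
      · exact ⟨hm, hi2⟩
      · exact ⟨heq ▸ hm, hj2⟩
    calc P E ≤ P (⋃ c ∈ Finset.range (K * (n + 1)), {ω | 2 ≤ count p (B c) ω}) :=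
          measure_mono hsub
      _ ≤ ∑ c ∈ Finset.range (K * (n + 1)), P {ω | 2 ≤ count p (B c) ω} :=
          measure_biUnion_finset_le _ _
      _ ≤ ∑ c ∈ Finset.range (K * (n + 1)), ENNReal.ofReal (K / (n + 1)) ^ 2 := by
          refine Finset.sum_le_sum fun c _ => ?_
          refine (h.prob_two_le (hBm c) ((hBle c).trans_lt ENNReal.ofReal_lt_top)).trans ?_
          gcongr; exact hBle c
      _ = ENNReal.ofReal ((K : ℝ) ^ 3 / (n + 1)) := by
          rw [Finset.sum_const, Finset.card_range, nsmul_eq_mul,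
            ← ENNReal.ofReal_pow (by positivity), ← ENNReal.ofReal_natCast,
            ← ENNReal.ofReal_mul (by positivity)]
          congr 1; push_cast; field_simp
  have hlim : Tendsto (fun n : ℕ => ENNReal.ofReal ((K : ℝ) ^ 3 / (n + 1))) atTop (𝓝 0) := by
    rw [← ENNReal.ofReal_zero]
    refine ENNReal.tendsto_ofReal ?_
    exact tendsto_const_nhds.div_atTop
      (tendsto_atTop_add_const_right _ _ tendsto_natCast_atTop_atTop)
  exact le_antisymm (ge_of_tendsto' hlim key) zero_le

/-- This lets labelled edges and vertices be counted by indices, and keeps the factorial measures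
away from the label diagonals. -/
theorem IsPoissonProcess.ae_label_injective (h : IsPoissonProcess P quadrant p) :
    ∀ᵐ ω ∂P, Function.Injective fun i => (p i ω).1 := by
  have h1 := ae_all_iff.2 fun K => measure_eq_zero_iff_ae_notMem.1 (h.prob_label_coincidence K)
  filter_upwards [h1, h.ae_nonneg] with ω h1 h2 i j hij
  by_contra hne
  obtain ⟨K, hK⟩ := exists_nat_gt (max (p i ω).1 (max (p i ω).2 (p j ω).2))
  simp only [max_lt_iff] at hK
  exact h1 K ⟨i, j, hne, hij, ⟨(h2 i).1, hK.1⟩, ⟨(h2 i).2, hK.2.1⟩, ⟨(h2 j).2, hK.2.2⟩⟩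

end Labels

end KEG

namespace KEG

/-! ### The multivariate Mecke formula -/

section Mecke

variable {Ω X : Type*} [MeasurableSpace Ω] [MeasurableSpace X] {P : Measure Ω}
  [IsProbabilityMeasure P] {m : Measure X} [SigmaFinite m]

/-- The factorial moment measure of order `k` of the random points `p`. -/
noncomputable def factorialMeasure (P : Measure Ω) (p : ℕ → Ω → X) (k : ℕ) :
    Measure (Fin k → X) :=
  Measure.sum fun t : {t : Fin k → ℕ // Function.Injective t} => P.map fun ω a => p (t.1 a) ω

theorem lintegral_factorialMeasure {p : ℕ → Ω → X} (hp : ∀ i, Measurable (p i)) {k : ℕ}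
    {f : (Fin k → X) → ℝ≥0∞} (hf : Measurable f) :
    ∫⁻ x, f x ∂factorialMeasure P p k =
      ∫⁻ ω, ∑' t : {t : Fin k → ℕ // Function.Injective t}, f (fun a => p (t.1 a) ω) ∂P := by
  have h : ∀ t : {t : Fin k → ℕ // Function.Injective t},
      Measurable fun ω a => p (t.1 a) ω := fun t => measurable_pi_lambda _ fun a => hp _
  rw [factorialMeasure, lintegral_sum_measure,
    MeasureTheory.lintegral_tsum
      (f := fun (t : {t : Fin k → ℕ // Function.Injective t}) ω => f fun a => p (t.1 a) ω)
      fun t => (hf.comp (h t)).aemeasurable]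
  exact tsum_congr fun t => lintegral_map hf (h t)

/-- When the sides are disjoint, a tuple of indices whose points hit them is automatically
injective, so the sum over injective tuples is the full product of the counts, whose mean factors by
independence. -/
theorem IsPoissonProcess.factorialMeasure_pi {p : ℕ → Ω → X} (h : IsPoissonProcess P m p) {k : ℕ}
    (A : Fin k → Set X) (hA : ∀ j, MeasurableSet (A j))
    (hd : Pairwise fun i j => Disjoint (A i) (A j)) :
    factorialMeasure P p k (Set.univ.pi A) = ∏ j, m (A j) := by
  rw [← h.lintegral_prod_count A hA hd, ← lintegral_indicator_one (MeasurableSet.univ_pi hA),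
    lintegral_factorialMeasure h.measurable
      (measurable_one.indicator (MeasurableSet.univ_pi hA))]
  refine lintegral_congr fun ω => ?_
  simp_rw [count_eq_tsum]
  rw [prod_tsum]
  refine (tsum_subtype {t : Fin k → ℕ | Function.Injective t}
    (fun t => (Set.univ.pi A).indicator (1 : (Fin k → X) → ℝ≥0∞) fun a => p (t a) ω)).trans ?_
  refine tsum_congr fun t => ?_
  by_cases hin : ∀ a, p (t a) ω ∈ A a
  · have ht : Function.Injective t := by
      intro a b hab
      by_contra hne
      exact Set.disjoint_left.1 (hd hne) (hin a) (hab ▸ hin b)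
    rw [Set.indicator_of_mem (show t ∈ {t : Fin k → ℕ | Function.Injective t} from ht),
      Set.indicator_of_mem (by simpa using hin)]
    simp [hin]
  · obtain ⟨a, ha⟩ := not_forall.1 hin
    rw [Finset.prod_eq_zero (Finset.mem_univ a) (by simp [ha])]
    rw [Set.indicator_apply_eq_zero]
    intro _
    exact Set.indicator_of_notMem (fun h' => ha (Set.mem_univ_pi.1 h' a)) _

theorem IsPoissonProcess.factorialMeasure_restrict {p : ℕ → Ω → X} (h : IsPoissonProcess P m p)
    {k : ℕ} (B : Fin k → Set X) (hB : ∀ j, MeasurableSet (B j))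
    (hd : Pairwise fun i j => Disjoint (B i) (B j)) :
    (factorialMeasure P p k).restrict (Set.univ.pi B) =
      (Measure.pi fun _ => m).restrict (Set.univ.pi B) := by
  rw [Measure.restrict_pi_pi]
  refine (Measure.pi_eq fun s hs => ?_).symm
  rw [Measure.restrict_apply (MeasurableSet.univ_pi hs), ← Set.pi_inter_distrib,
    h.factorialMeasure_pi _ (fun j => (hs j).inter (hB j)) fun i j hij =>
      (hd hij).mono Set.inter_subset_right Set.inter_subset_right]
  exact Finset.prod_congr rfl fun j _ => (Measure.restrict_apply (hs j)).symm

theorem lintegral_pi_succ {k : ℕ} {f : (Fin (k + 1) → X) → ℝ≥0∞} (hf : Measurable f) :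
    ∫⁻ x, f x ∂(Measure.pi fun _ => m) =
      ∫⁻ x, ∫⁻ y : Fin k → X, f (Fin.cons x y) ∂(Measure.pi fun _ => m) ∂m := by
  have h := (measurePreserving_piFinSuccAbove (fun _ : Fin (k + 1) => m) 0).symm
  rw [← h.lintegral_comp hf, lintegral_prod]
  · simp [MeasurableEquiv.piFinSuccAbove_symm_apply, Fin.insertNthEquiv]
  · exact (hf.comp h.measurable).aemeasurable

theorem lintegral_pi_zero (f : (Fin 0 → X) → ℝ≥0∞) :
    ∫⁻ x, f x ∂(Measure.pi fun _ => m) = f Fin.elim0 := by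
  rw [Measure.pi_of_empty _ Fin.elim0, lintegral_dirac]

end Mecke

/-- The label interval with index `c` at resolution `1 / n`, as a strip of the plane. -/
def labelStrip (n : ℕ) (c : ℤ) : Set (ℝ × ℝ) := {x | ⌊(n : ℝ) * x.1⌋ = c}

theorem measurableSet_labelStrip (n : ℕ) (c : ℤ) : MeasurableSet (labelStrip n c) :=
  (Int.measurable_floor.comp (measurable_fst.const_mul _)) (measurableSet_singleton c)

/-- Finitely many distinct labels are separated by a grid of mesh `1 / n` once `n` times each gap is
at least one. Thus countably many boxes with disjoint sides cover the tuples with distinct labels.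
-/
theorem iUnion_pi_labelStrip (k : ℕ) :
    (⋃ q : ℕ × {c : Fin k → ℤ // Function.Injective c},
      Set.univ.pi fun a => labelStrip q.1 (q.2.1 a)) =
    {x : Fin k → ℝ × ℝ | Function.Injective fun a => (x a).1} := by
  ext x
  simp only [Set.mem_iUnion, Set.mem_pi, Set.mem_univ, true_implies, Set.mem_ofPred_eq]
  constructor
  · rintro ⟨⟨n, c, hc⟩, h⟩ a b hab
    apply hc
    have ha := h a
    have hb := h b
    simp only [labelStrip, Set.mem_ofPred_eq] at ha hb hab
    rw [← ha, ← hb, hab]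
  · intro hx
    have h1 : ∀ᶠ n : ℕ in atTop, ∀ q : Fin k × Fin k, q.1 ≠ q.2 →
        ⌊(n : ℝ) * (x q.1).1⌋ ≠ ⌊(n : ℝ) * (x q.2).1⌋ := by
      refine eventually_all.2 fun q => ?_
      by_cases hq : q.1 = q.2
      · simp [hq]
      have hpos : 0 < |(x q.1).1 - (x q.2).1| := abs_pos.2 (sub_ne_zero.2 fun h => hq (hx h))
      filter_upwards [(tendsto_natCast_atTop_atTop.atTop_mul_const hpos).eventually_ge_atTop 1]
        with n hn _ heq
      have h3 := Int.abs_sub_lt_one_of_floor_eq_floor heq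
      rw [← mul_sub, abs_mul, Nat.abs_cast] at h3
      linarith
    obtain ⟨n, hn⟩ := h1.exists
    refine ⟨⟨n, fun a => ⌊(n : ℝ) * (x a).1⌋, fun a b hab => ?_⟩, fun a => rfl⟩
    by_contra hne
    exact hn (a, b) hne hab

/-- By Fubini: with the other coordinates fixed, a coincidence confines one point to a line of
constant label, which is null. -/
theorem ae_pi_label_injective (k : ℕ) :
    ∀ᵐ x ∂(Measure.pi fun _ : Fin k => quadrant), Function.Injective fun a => (x a).1 := by
  have key : ∀ q : Fin k × Fin k, q.1 ≠ q.2 →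
      ∀ᵐ x ∂(Measure.pi fun _ : Fin k => quadrant), (x q.1).1 ≠ (x q.2).1 := by
    rintro ⟨a, b⟩ hab
    simp only at hab ⊢
    cases k with
    | zero => exact a.elim0
    | succ k =>
      have h := measurePreserving_piFinSuccAbove (fun _ : Fin (k + 1) => quadrant) a
      obtain ⟨c, rfl⟩ := Fin.exists_succAbove_eq (Ne.symm hab)
      have h2 : ∀ᵐ z ∂(quadrant.prod (Measure.pi fun _ : Fin k => quadrant)),
          z.1.1 ≠ (z.2 c).1 := by
        have hm : MeasurableSet {z : (ℝ × ℝ) × (Fin k → ℝ × ℝ) | z.1.1 ≠ (z.2 c).1} :=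
          (measurableSet_eq_fun (by fun_prop) (by fun_prop)).compl
        rw [ae_iff, ← Set.compl_ofPred, Measure.prod_apply_symm hm.compl, lintegral_eq_zero_iff]
        · refine Eventually.of_forall fun y => ?_
          refine measure_mono_null (fun x hx => ?_) (quadrant_label_null (y c).1)
          simpa using hx
        · exact measurable_measure_prodMk_right hm.compl
      exact h.quasiMeasurePreserving.ae h2
  have h1 := ae_all_iff.2 fun q => ae_all_iff.2 fun hq => key q hq
  filter_upwards [h1] with x hx a b hab
  by_contra hne
  exact hx (a, b) hne hab

variable {Ω : Type*} [MeasurableSpace Ω] {P : Measure Ω}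
  [IsProbabilityMeasure P] {p : ℕ → Ω → ℝ × ℝ}

/-- Both measures are carried by tuples with distinct labels, and they agree on each of the
countably many boxes covering that set. The boxes need not be disjoint from one another. -/
theorem IsPoissonProcess.factorialMeasure_eq (h : IsPoissonProcess P quadrant p) (k : ℕ) :
    factorialMeasure P p k = Measure.pi fun _ => quadrant := by
  have h1 : ∀ᵐ x ∂factorialMeasure P p k, Function.Injective fun a => (x a).1 := by
    rw [factorialMeasure, Measure.ae_sum_iff]
    intro t
    have hm : Measurable fun ω a => p (t.1 a) ω := measurable_pi_lambda _ fun a => h.measurable _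
    have hS : MeasurableSet {x : Fin k → ℝ × ℝ | Function.Injective fun a => (x a).1} := by
      rw [← iUnion_pi_labelStrip]
      exact MeasurableSet.iUnion fun q =>
        MeasurableSet.univ_pi fun a => measurableSet_labelStrip _ _
    rw [ae_map_iff hm.aemeasurable hS]
    filter_upwards [h.ae_label_injective] with ω hω a b hab
    exact t.2 (hω hab)
  rw [← Measure.restrict_eq_self_of_ae_mem h1,
    ← Measure.restrict_eq_self_of_ae_mem (ae_pi_label_injective k)]
  show Measure.restrict _ {x : Fin k → ℝ × ℝ | Function.Injective fun a => (x a).1} =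
    Measure.restrict _ {x : Fin k → ℝ × ℝ | Function.Injective fun a => (x a).1}
  rw [← iUnion_pi_labelStrip, Measure.restrict_iUnion_congr]
  rintro ⟨n, c, hc⟩
  refine h.factorialMeasure_restrict _ (fun j => measurableSet_labelStrip _ _) fun i j hij => ?_
  refine Set.disjoint_left.2 fun x h1 h2 => hij (hc ?_)
  exact h1.symm.trans h2

/-- The multivariate Mecke formula for the Poisson process on the quadrant. -/
theorem IsPoissonProcess.mecke (h : IsPoissonProcess P quadrant p) {k : ℕ}
    {f : (Fin k → ℝ × ℝ) → ℝ≥0∞} (hf : Measurable f) :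
    ∑' t : {t : Fin k → ℕ // Function.Injective t}, ∫⁻ ω, f (fun a => p (t.1 a) ω) ∂P =
      ∫⁻ x, f x ∂(Measure.pi fun _ => quadrant) := by
  rw [← h.factorialMeasure_eq, lintegral_factorialMeasure h.measurable hf,
    MeasureTheory.lintegral_tsum
      (f := fun (t : {t : Fin k → ℕ // Function.Injective t}) ω => f fun a => p (t.1 a) ω)
      fun t => (hf.comp (measurable_pi_lambda _ fun a => h.measurable _)).aemeasurable]

end KEG

namespace KEG

variable {Ω : Type*} [MeasurableSpace Ω] {P : Measure Ω}
  [IsProbabilityMeasure P] {p : ℕ → Ω → ℝ × ℝ} {ζ : Sym2 ℕ → Ω → ℝ}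

/-! ### Iterated forms of the Mecke formula -/

theorem injective_pair_iff {i j : ℕ} :
    Function.Injective (Fin.cons i (Fin.cons j Fin.elim0) : Fin 2 → ℕ) ↔ i ≠ j := by
  rw [Fin.cons_injective_iff, Fin.cons_injective_iff]
  simp [Function.Injective]

theorem injective_triple_iff {i j k : ℕ} :
    Function.Injective (Fin.cons i (Fin.cons j (Fin.cons k Fin.elim0)) : Fin 3 → ℕ) ↔
      i ≠ j ∧ i ≠ k ∧ j ≠ k := by
  rw [Fin.cons_injective_iff, injective_pair_iff]
  simp
  tauto

theorem injective_quadruple_iff {i j k l : ℕ} :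
    Function.Injective
        (Fin.cons i (Fin.cons j (Fin.cons k (Fin.cons l Fin.elim0))) : Fin 4 → ℕ) ↔
      (i ≠ j ∧ i ≠ k ∧ i ≠ l) ∧ j ≠ k ∧ j ≠ l ∧ k ≠ l := by
  rw [Fin.cons_injective_iff, injective_triple_iff]
  simp

theorem tsum_injective {k : ℕ} (F : (Fin k → ℕ) → ℝ≥0∞) :
    ∑' t : {t : Fin k → ℕ // Function.Injective t}, F t.1 =
      ∑' t, {t : Fin k → ℕ | Function.Injective t}.indicator F t :=
  tsum_subtype {t : Fin k → ℕ | Function.Injective t} F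

theorem IsPoissonProcess.mecke_two (h : IsPoissonProcess P quadrant p)
    {f : ℝ × ℝ → ℝ × ℝ → ℝ≥0∞} (hf : Measurable fun x : (ℝ × ℝ) × (ℝ × ℝ) => f x.1 x.2) :
    ∑' i, ∑' j, (if i ≠ j then ∫⁻ ω, f (p i ω) (p j ω) ∂P else 0) =
      ∫⁻ x, ∫⁻ y, f x y ∂quadrant ∂quadrant := by
  have hF : Measurable fun x : Fin 2 → ℝ × ℝ => f (x 0) (x 1) :=
    hf.comp (f := fun x : Fin 2 → ℝ × ℝ => (x 0, x 1)) (by fun_prop)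
  have h1 := h.mecke hF
  rw [tsum_injective fun t => ∫⁻ ω, f (p (t 0) ω) (p (t 1) ω) ∂P] at h1
  simp only [tsum_fin_succ, tsum_fin_zero] at h1
  rw [lintegral_pi_succ hF] at h1
  calc _ = _ := by
        refine tsum_congr fun i => tsum_congr fun j => ?_
        classical
        rw [Set.indicator_apply]
        exact (if_congr injective_pair_iff rfl rfl).symm
    _ = _ := h1
    _ = _ := by
        refine lintegral_congr fun x => ?_
        have hG : Measurable fun y : Fin 1 → ℝ × ℝ => f x (y 0) :=
          hf.comp (f := fun y : Fin 1 → ℝ × ℝ => (x, y 0)) (by fun_prop)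
        refine (lintegral_pi_succ hG).trans (lintegral_congr fun y => ?_)
        exact lintegral_pi_zero _

theorem IsPoissonProcess.mecke_three (h : IsPoissonProcess P quadrant p)
    {f : ℝ × ℝ → ℝ × ℝ → ℝ × ℝ → ℝ≥0∞}
    (hf : Measurable fun x : (ℝ × ℝ) × (ℝ × ℝ) × (ℝ × ℝ) => f x.1 x.2.1 x.2.2) :
    ∑' i, ∑' j, ∑' k, (if i ≠ j ∧ i ≠ k ∧ j ≠ k then
        ∫⁻ ω, f (p i ω) (p j ω) (p k ω) ∂P else 0) =
      ∫⁻ x, ∫⁻ y, ∫⁻ z, f x y z ∂quadrant ∂quadrant ∂quadrant := by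
  have hF : Measurable fun x : Fin 3 → ℝ × ℝ => f (x 0) (x 1) (x 2) :=
    hf.comp (f := fun x : Fin 3 → ℝ × ℝ => (x 0, x 1, x 2)) (by fun_prop)
  have h1 := h.mecke hF
  rw [tsum_injective fun t => ∫⁻ ω, f (p (t 0) ω) (p (t 1) ω) (p (t 2) ω) ∂P] at h1
  simp only [tsum_fin_succ, tsum_fin_zero] at h1
  rw [lintegral_pi_succ hF] at h1
  calc _ = _ := by
        refine tsum_congr fun i => tsum_congr fun j => tsum_congr fun k => ?_
        classical
        rw [Set.indicator_apply]
        exact (if_congr injective_triple_iff rfl rfl).symm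
    _ = _ := h1
    _ = _ := by
        refine lintegral_congr fun x => ?_
        have hG : Measurable fun y : Fin 2 → ℝ × ℝ => f x (y 0) (y 1) :=
          hf.comp (f := fun y : Fin 2 → ℝ × ℝ => (x, y 0, y 1)) (by fun_prop)
        refine (lintegral_pi_succ hG).trans (lintegral_congr fun y => ?_)
        have hH : Measurable fun z : Fin 1 → ℝ × ℝ => f x y (z 0) :=
          hf.comp (f := fun z : Fin 1 → ℝ × ℝ => (x, y, z 0)) (by fun_prop)
        refine (lintegral_pi_succ hH).trans (lintegral_congr fun z => ?_)
        exact lintegral_pi_zero _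

theorem IsPoissonProcess.mecke_four (h : IsPoissonProcess P quadrant p)
    {f : ℝ × ℝ → ℝ × ℝ → ℝ × ℝ → ℝ × ℝ → ℝ≥0∞}
    (hf : Measurable fun x : (ℝ × ℝ) × (ℝ × ℝ) × (ℝ × ℝ) × (ℝ × ℝ) =>
      f x.1 x.2.1 x.2.2.1 x.2.2.2) :
    ∑' i, ∑' j, ∑' k, ∑' l, (if (i ≠ j ∧ i ≠ k ∧ i ≠ l) ∧ j ≠ k ∧ j ≠ l ∧ k ≠ l then
        ∫⁻ ω, f (p i ω) (p j ω) (p k ω) (p l ω) ∂P else 0) =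
      ∫⁻ x, ∫⁻ y, ∫⁻ z, ∫⁻ w, f x y z w ∂quadrant ∂quadrant ∂quadrant ∂quadrant := by
  have hF : Measurable fun x : Fin 4 → ℝ × ℝ => f (x 0) (x 1) (x 2) (x 3) :=
    hf.comp (f := fun x : Fin 4 → ℝ × ℝ => (x 0, x 1, x 2, x 3)) (by fun_prop)
  have h1 := h.mecke hF
  rw [tsum_injective fun t => ∫⁻ ω, f (p (t 0) ω) (p (t 1) ω) (p (t 2) ω) (p (t 3) ω) ∂P] at h1
  simp only [tsum_fin_succ, tsum_fin_zero] at h1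
  rw [lintegral_pi_succ hF] at h1
  calc _ = _ := by
        refine tsum_congr fun i => tsum_congr fun j => tsum_congr fun k => tsum_congr fun l => ?_
        classical
        rw [Set.indicator_apply]
        exact (if_congr injective_quadruple_iff rfl rfl).symm
    _ = _ := h1
    _ = _ := by
        refine lintegral_congr fun x => ?_
        have hG : Measurable fun y : Fin 3 → ℝ × ℝ => f x (y 0) (y 1) (y 2) :=
          hf.comp (f := fun y : Fin 3 → ℝ × ℝ => (x, y 0, y 1, y 2)) (by fun_prop)
        refine (lintegral_pi_succ hG).trans (lintegral_congr fun y => ?_)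
        have hH : Measurable fun z : Fin 2 → ℝ × ℝ => f x y (z 0) (z 1) :=
          hf.comp (f := fun z : Fin 2 → ℝ × ℝ => (x, y, z 0, z 1)) (by fun_prop)
        refine (lintegral_pi_succ hH).trans (lintegral_congr fun z => ?_)
        have hJ : Measurable fun w : Fin 1 → ℝ × ℝ => f x y z (w 0) :=
          hf.comp (f := fun w : Fin 1 → ℝ × ℝ => (x, y, z, w 0)) (by fun_prop)
        refine (lintegral_pi_succ hJ).trans (lintegral_congr fun w => ?_)
        exact lintegral_pi_zero _

/-! ### Integrating out the uniform marks -/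

theorem volume_Icc_inter_Iio {u : ℝ} (h1 : u ≤ 1) :
    ∫⁻ a, (if a < u then 1 else 0) ∂(volume.restrict (Set.Icc (0 : ℝ) 1)) = ENNReal.ofReal u := by
  have : (fun a : ℝ => if a < u then (1 : ℝ≥0∞) else 0) = (Set.Iio u).indicator 1 := by
    ext a; simp [Set.indicator]
  rw [this, lintegral_indicator_one measurableSet_Iio, Measure.restrict_apply measurableSet_Iio]
  have : Set.Iio u ∩ Set.Icc 0 1 = Set.Ico 0 u := by
    ext a; simp only [Set.mem_inter_iff, Set.mem_Iio, Set.mem_Icc, Set.mem_Ico]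
    constructor
    · rintro ⟨h, h', _⟩; exact ⟨h', h⟩
    · rintro ⟨h, h'⟩; exact ⟨h', h, by linarith⟩
  rw [this]; simp

/-- Given the whole point configuration the mark is still uniform, so a threshold `u ≤ 1` exceeds it
with probability `ENNReal.ofReal u`, which is zero for negative thresholds. -/
theorem IsKEGSource.lintegral_mark (h : IsKEGSource P p ζ) (e : Sym2 ℕ)
    {G : (ℕ → ℝ × ℝ) → ℝ≥0∞} (hG : Measurable G) {u : (ℕ → ℝ × ℝ) → ℝ} (hu : Measurable u)
    (h1 : ∀ x, u x ≤ 1) :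
    ∫⁻ ω, G (fun i => p i ω) * (if ζ e ω < u (fun i => p i ω) then 1 else 0) ∂P =
      ∫⁻ ω, G (fun i => p i ω) * ENNReal.ofReal (u fun i => p i ω) ∂P := by
  have hp : Measurable fun ω i => p i ω := measurable_pi_lambda _ h.poisson.measurable
  have hind : IndepFun (fun ω i => p i ω) (ζ e) P :=
    h.indep.comp measurable_id (measurable_pi_apply e)
  have hlaw := (indepFun_iff_map_prod_eq_prod_map_map hp.aemeasurable
    (h.measurable e).aemeasurable).1 hind
  rw [h.uniform] at hlaw
  have : IsProbabilityMeasure (P.map fun ω i => p i ω) :=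
    Measure.isProbabilityMeasure_map hp.aemeasurable
  set F : (ℕ → ℝ × ℝ) × ℝ → ℝ≥0∞ := fun z => G z.1 * (if z.2 < u z.1 then 1 else 0) with hFdef
  have hF : Measurable F :=
    (hG.comp measurable_fst).mul (Measurable.ite
      (measurableSet_lt measurable_snd (hu.comp measurable_fst)) measurable_const measurable_const)
  calc _ = ∫⁻ ω, F ((fun i => p i ω), ζ e ω) ∂P := rfl
    _ = ∫⁻ z, F z ∂(P.map fun ω => ((fun i => p i ω), ζ e ω)) :=
        (lintegral_map hF (hp.prodMk (h.measurable e))).symm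
    _ = ∫⁻ x, G x * ENNReal.ofReal (u x) ∂(P.map fun ω i => p i ω) := by
        rw [hlaw, lintegral_prod _ hF.aemeasurable]
        refine lintegral_congr fun x => ?_
        simp only [hFdef]
        rw [lintegral_const_mul _ (Measurable.ite measurableSet_Iio measurable_const
          measurable_const), volume_Icc_inter_Iio (h1 x)]
    _ = _ := lintegral_map (hG.mul hu.ennreal_ofReal) hp

theorem IsKEGSource.lintegral_mark_mark (h : IsKEGSource P p ζ) {e e' : Sym2 ℕ} (hne : e ≠ e')
    {G : (ℕ → ℝ × ℝ) → ℝ≥0∞} (hG : Measurable G) {u v : (ℕ → ℝ × ℝ) → ℝ} (hu : Measurable u)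
    (hv : Measurable v) (hu1 : ∀ x, u x ≤ 1) (hv1 : ∀ x, v x ≤ 1) :
    ∫⁻ ω, G (fun i => p i ω) * ((if ζ e ω < u (fun i => p i ω) then 1 else 0) *
        (if ζ e' ω < v (fun i => p i ω) then 1 else 0)) ∂P =
      ∫⁻ ω, G (fun i => p i ω) * (ENNReal.ofReal (u fun i => p i ω) *
        ENNReal.ofReal (v fun i => p i ω)) ∂P := by
  have hp : Measurable fun ω i => p i ω := measurable_pi_lambda _ h.poisson.measurable
  have hind : IndepFun (fun ω i => p i ω) (fun ω => (ζ e ω, ζ e' ω)) P :=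
    h.indep.comp measurable_id ((measurable_pi_apply e).prodMk (measurable_pi_apply e'))
  have hm2 : Measurable fun ω => (ζ e ω, ζ e' ω) := (h.measurable e).prodMk (h.measurable e')
  have hlaw := (indepFun_iff_map_prod_eq_prod_map_map hp.aemeasurable hm2.aemeasurable).1 hind
  rw [(indepFun_iff_map_prod_eq_prod_map_map (h.measurable e).aemeasurable
    (h.measurable e').aemeasurable).1 (h.iid.indepFun hne), h.uniform, h.uniform] at hlaw
  have : IsProbabilityMeasure (P.map fun ω i => p i ω) :=
    Measure.isProbabilityMeasure_map hp.aemeasurable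
  set F : (ℕ → ℝ × ℝ) × ℝ × ℝ → ℝ≥0∞ := fun z => G z.1 * ((if z.2.1 < u z.1 then 1 else 0) *
    (if z.2.2 < v z.1 then 1 else 0)) with hFdef
  have hF : Measurable F := by
    refine (hG.comp measurable_fst).mul (Measurable.mul (Measurable.ite ?_ measurable_const
      measurable_const) (Measurable.ite ?_ measurable_const measurable_const))
    · exact measurableSet_lt (by fun_prop) (hu.comp measurable_fst)
    · exact measurableSet_lt (by fun_prop) (hv.comp measurable_fst)
  have hite : ∀ c : ℝ, Measurable fun a : ℝ => if a < c then (1 : ℝ≥0∞) else 0 := fun c =>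
    Measurable.ite measurableSet_Iio measurable_const measurable_const
  calc _ = ∫⁻ ω, F ((fun i => p i ω), ζ e ω, ζ e' ω) ∂P := rfl
    _ = ∫⁻ z, F z ∂(P.map fun ω => ((fun i => p i ω), ζ e ω, ζ e' ω)) :=
        (lintegral_map hF (hp.prodMk hm2)).symm
    _ = ∫⁻ x, G x * (ENNReal.ofReal (u x) * ENNReal.ofReal (v x)) ∂(P.map fun ω i => p i ω) := by
        rw [hlaw, lintegral_prod _ hF.aemeasurable]
        refine lintegral_congr fun x => ?_
        simp only [hFdef]
        rw [lintegral_const_mul, lintegral_prod_mul (hite _).aemeasurable (hite _).aemeasurable,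
          volume_Icc_inter_Iio (hu1 x), volume_Icc_inter_Iio (hv1 x)]
        exact ((hite _).comp measurable_fst).mul ((hite _).comp measurable_snd)
    _ = _ := lintegral_map (hG.mul (hu.ennreal_ofReal.mul hv.ennreal_ofReal)) hp

/-- The strict upper bound makes a connection probability of one certain; the lower bound makes a
probability of zero impossible. -/
theorem IsKEGSource.ae_mark_mem (h : IsKEGSource P p ζ) :
    ∀ᵐ ω ∂P, ∀ e, 0 ≤ ζ e ω ∧ ζ e ω < 1 := by
  rw [ae_all_iff]
  intro e
  have h1 : ∀ᵐ a ∂(volume.restrict (Set.Icc (0 : ℝ) 1)), 0 ≤ a ∧ a < 1 := by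
    have h2 : ∀ᵐ a ∂(volume.restrict (Set.Icc (0 : ℝ) 1)), a ∈ Set.Icc (0 : ℝ) 1 :=
      ae_restrict_mem measurableSet_Icc
    have h3 : ∀ᵐ a ∂(volume.restrict (Set.Icc (0 : ℝ) 1)), a ≠ 1 :=
      ae_restrict_of_ae (Measure.ae_ne volume 1)
    filter_upwards [h2, h3] with a ha hb
    exact ⟨ha.1, lt_of_le_of_ne ha.2 hb⟩
  rw [← h.uniform e] at h1
  exact ae_of_ae_map (h.measurable e).aemeasurable h1

end KEG

/-! ### Connection kernels, degrees and ordered edge counts -/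

namespace KEG

/-- A symmetric measurable connection kernel with values at most `1`. -/
structure IsKernel (K : ℝ × ℝ → ℝ × ℝ → ℝ) : Prop where
  measurable : Measurable fun x : (ℝ × ℝ) × (ℝ × ℝ) => K x.1 x.2
  symm : ∀ x y, K x y = K y x
  le_one : ∀ x y, K x y ≤ 1

noncomputable section

variable {Ω : Type*}

/-- The indicator that the distinct points `i` and `j` are joined, for the kernel `K`. -/
def adj (K : ℝ × ℝ → ℝ × ℝ → ℝ) (p : ℕ → Ω → ℝ × ℝ) (ζ : Sym2 ℕ → Ω → ℝ) (ω : Ω) (i j : ℕ) :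
    ℝ≥0∞ := if i ≠ j ∧ ζ s(i, j) ω < K (p i ω) (p j ω) then 1 else 0

/-- The number of neighbours of the point `i`, not counting a self edge. -/
def deg (K : ℝ × ℝ → ℝ × ℝ → ℝ) (p : ℕ → Ω → ℝ × ℝ) (ζ : Sym2 ℕ → Ω → ℝ) (ω : Ω) (i : ℕ) :
    ℝ≥0∞ := ∑' j, adj K p ζ ω i j

/-- The number of ordered pairs of distinct joined points. -/
def pairSum (K : ℝ × ℝ → ℝ × ℝ → ℝ) (p : ℕ → Ω → ℝ × ℝ) (ζ : Sym2 ℕ → Ω → ℝ) (ω : Ω) :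
    ℝ≥0∞ := ∑' i, deg K p ζ ω i

/-- The number of points marked by their self mark with probability `h`. -/
def loopSum (h : ℝ × ℝ → ℝ) (p : ℕ → Ω → ℝ × ℝ) (ζ : Sym2 ℕ → Ω → ℝ) (ω : Ω) :
    ℝ≥0∞ := ∑' i, if ζ s(i, i) ω < h (p i ω) then 1 else 0

/-- The expected number of neighbours of a point at `x`. -/
def kernelDegree (K : ℝ × ℝ → ℝ × ℝ → ℝ) (x : ℝ × ℝ) : ℝ≥0∞ :=
  ∫⁻ y, ENNReal.ofReal (K x y) ∂quadrant

end

variable {Ω : Type*} [MeasurableSpace Ω] {P : Measure Ω}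
  [IsProbabilityMeasure P] {p : ℕ → Ω → ℝ × ℝ} {ζ : Sym2 ℕ → Ω → ℝ}
  {K : ℝ × ℝ → ℝ × ℝ → ℝ}

theorem IsKernel.measurable_ofReal (hK : IsKernel K) :
    Measurable fun x : (ℝ × ℝ) × (ℝ × ℝ) => ENNReal.ofReal (K x.1 x.2) :=
  hK.measurable.ennreal_ofReal

theorem IsKernel.measurable_kernelDegree (hK : IsKernel K) : Measurable (kernelDegree K) :=
  hK.measurable_ofReal.lintegral_prod_right'

theorem adj_comm (hK : IsKernel K) (ω : Ω) (i j : ℕ) : adj K p ζ ω i j = adj K p ζ ω j i := by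
  unfold adj
  rw [Sym2.eq_swap, hK.symm]
  exact if_congr (and_congr_left fun _ => ne_comm) rfl rfl

theorem adj_self (ω : Ω) (i : ℕ) : adj K p ζ ω i i = 0 := by simp [adj]

theorem adj_mul_self (ω : Ω) (i j : ℕ) :
    adj K p ζ ω i j * adj K p ζ ω i j = adj K p ζ ω i j := by
  unfold adj; split_ifs <;> simp

theorem adj_of_ne {i j : ℕ} (hij : i ≠ j) (ω : Ω) :
    adj K p ζ ω i j = if ζ s(i, j) ω < K (p i ω) (p j ω) then 1 else 0 := by
  simp [adj, hij]

theorem IsKEGSource.measurable_adj (h : IsKEGSource P p ζ) (hK : IsKernel K) (i j : ℕ) :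
    Measurable fun ω => adj K p ζ ω i j := by
  unfold adj
  refine Measurable.ite ?_ measurable_const measurable_const
  by_cases hij : i = j
  · simp [hij]
  · simp only [ne_eq, hij, not_false_eq_true, true_and]
    exact measurableSet_lt (h.measurable _)
      (hK.measurable.comp ((h.poisson.measurable i).prodMk (h.poisson.measurable j)))

theorem IsKEGSource.measurable_deg (h : IsKEGSource P p ζ) (hK : IsKernel K) (i : ℕ) :
    Measurable fun ω => deg K p ζ ω i :=
  Measurable.tsum fun j => h.measurable_adj hK i j

theorem IsKEGSource.measurable_pairSum (h : IsKEGSource P p ζ) (hK : IsKernel K) :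
    Measurable fun ω => pairSum K p ζ ω :=
  Measurable.tsum fun i => h.measurable_deg hK i

theorem measurable_two_coord (hK : IsKernel K) (i j : ℕ) :
    Measurable fun x : ℕ → ℝ × ℝ => K (x i) (x j) :=
  hK.measurable.comp (f := fun x : ℕ → ℝ × ℝ => (x i, x j)) (by fun_prop)

theorem lintegral_tsum_tsum {F : ℕ → ℕ → Ω → ℝ≥0∞} (hF : ∀ i j, Measurable (F i j)) :
    ∫⁻ ω, ∑' i, ∑' j, F i j ω ∂P = ∑' i, ∑' j, ∫⁻ ω, F i j ω ∂P := by
  rw [lintegral_tsum fun i => (Measurable.tsum (hF i)).aemeasurable]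
  exact tsum_congr fun i => lintegral_tsum fun j => (hF i j).aemeasurable

theorem lintegral_tsum_tsum_tsum {F : ℕ → ℕ → ℕ → Ω → ℝ≥0∞}
    (hF : ∀ i j k, Measurable (F i j k)) :
    ∫⁻ ω, ∑' i, ∑' j, ∑' k, F i j k ω ∂P = ∑' i, ∑' j, ∑' k, ∫⁻ ω, F i j k ω ∂P := by
  rw [lintegral_tsum fun i =>
    (Measurable.tsum fun j => Measurable.tsum (hF i j)).aemeasurable]
  exact tsum_congr fun i => lintegral_tsum_tsum (hF i)

theorem lintegral_tsum_tsum_tsum_tsum {F : ℕ → ℕ → ℕ → ℕ → Ω → ℝ≥0∞}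
    (hF : ∀ i j k l, Measurable (F i j k l)) :
    ∫⁻ ω, ∑' i, ∑' j, ∑' k, ∑' l, F i j k l ω ∂P =
      ∑' i, ∑' j, ∑' k, ∑' l, ∫⁻ ω, F i j k l ω ∂P := by
  rw [lintegral_tsum fun i => (Measurable.tsum fun j =>
    Measurable.tsum fun k => Measurable.tsum (hF i j k)).aemeasurable]
  exact tsum_congr fun i => lintegral_tsum_tsum_tsum (hF i)

/-! ### First and second moments of edge counts -/

theorem IsKEGSource.lintegral_weighted_deg (h : IsKEGSource P p ζ) (hK : IsKernel K)
    {g : ℝ × ℝ → ℝ≥0∞} (hg : Measurable g) :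
    ∫⁻ ω, ∑' i, g (p i ω) * deg K p ζ ω i ∂P = ∫⁻ x, g x * kernelDegree K x ∂quadrant := by
  have hgp : ∀ i, Measurable fun ω => g (p i ω) := fun i => hg.comp (h.poisson.measurable i)
  simp only [deg, ← ENNReal.tsum_mul_left]
  rw [lintegral_tsum_tsum (F := fun i j ω => g (p i ω) * adj K p ζ ω i j)
    fun i j => (hgp i).mul (h.measurable_adj hK i j)]
  calc _ = ∑' i, ∑' j, (if i ≠ j then
        ∫⁻ ω, g (p i ω) * ENNReal.ofReal (K (p i ω) (p j ω)) ∂P else 0) := by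
        refine tsum_congr fun i => tsum_congr fun j => ?_
        split_ifs with hij
        · simp_rw [adj_of_ne hij]
          exact h.lintegral_mark s(i, j) (G := fun x => g (x i))
            (hg.comp (measurable_pi_apply i)) (measurable_two_coord hK i j)
            (fun x => hK.le_one _ _)
        · simp [not_not.1 hij, adj_self]
    _ = ∫⁻ x, ∫⁻ y, g x * ENNReal.ofReal (K x y) ∂quadrant ∂quadrant :=
        h.poisson.mecke_two (f := fun x y => g x * ENNReal.ofReal (K x y))
          ((hg.comp measurable_fst).mul hK.measurable_ofReal)
    _ = _ := by
        refine lintegral_congr fun x => ?_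
        exact lintegral_const_mul _ (hK.measurable_ofReal.comp measurable_prodMk_left)

theorem IsKEGSource.lintegral_pairSum (h : IsKEGSource P p ζ) (hK : IsKernel K) :
    ∫⁻ ω, pairSum K p ζ ω ∂P = ∫⁻ x, kernelDegree K x ∂quadrant := by
  simpa only [pairSum, one_mul] using h.lintegral_weighted_deg hK (g := fun _ => 1) measurable_const

/-- The square counts ordered pairs of neighbours; the pairs with `j = k` contribute the degree
itself because `adj` is idempotent. -/
theorem deg_sq_le (ω : Ω) (i : ℕ) : deg K p ζ ω i ^ 2 ≤
    (∑' j, ∑' k, (if i ≠ j ∧ i ≠ k ∧ j ≠ k then adj K p ζ ω i j * adj K p ζ ω i k else 0)) +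
      deg K p ζ ω i := by
  rw [sq]
  nth_rewrite 1 [deg]
  nth_rewrite 2 [deg]
  rw [← ENNReal.tsum_mul_right, deg, ← ENNReal.tsum_add]
  refine ENNReal.tsum_le_tsum fun j => ?_
  rw [← ENNReal.tsum_mul_left]
  calc _ ≤ ∑' k, ((if i ≠ j ∧ i ≠ k ∧ j ≠ k then adj K p ζ ω i j * adj K p ζ ω i k else 0) +
        (if k = j then adj K p ζ ω i j else 0)) := by
        refine ENNReal.tsum_le_tsum fun k => ?_
        by_cases hij : i = j
        · subst hij; simp [adj_self]
        by_cases hik : i = k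
        · subst hik; simp [adj_self]
        by_cases hjk : j = k
        · subst hjk; simp [adj_mul_self]
        · simp [hij, hik, hjk]
    _ = _ := by
        rw [ENNReal.tsum_add, tsum_ite_eq]

/-- For three distinct points the two edges at `i` carry different marks, so they are conditionally
independent and the Mecke formula gives the squared kernel degree. -/
theorem IsKEGSource.lintegral_weighted_deg_sq_le (h : IsKEGSource P p ζ) (hK : IsKernel K)
    {g : ℝ × ℝ → ℝ≥0∞} (hg : Measurable g) :
    ∫⁻ ω, ∑' i, g (p i ω) * deg K p ζ ω i ^ 2 ∂P ≤
      ∫⁻ x, g x * kernelDegree K x ^ 2 ∂quadrant + ∫⁻ x, g x * kernelDegree K x ∂quadrant := by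
  have hgp : ∀ i, Measurable fun ω => g (p i ω) := fun i => hg.comp (h.poisson.measurable i)
  have hmeas : ∀ i j k, Measurable fun ω => if i ≠ j ∧ i ≠ k ∧ j ≠ k then
      g (p i ω) * (adj K p ζ ω i j * adj K p ζ ω i k) else 0 := by
    intro i j k
    split_ifs
    · exact (hgp i).mul ((h.measurable_adj hK i j).mul (h.measurable_adj hK i k))
    · exact measurable_const
  have h3 : ∫⁻ ω, ∑' i, ∑' j, ∑' k, (if i ≠ j ∧ i ≠ k ∧ j ≠ k then
      g (p i ω) * (adj K p ζ ω i j * adj K p ζ ω i k) else 0) ∂P =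
      ∫⁻ x, g x * kernelDegree K x ^ 2 ∂quadrant := by
    rw [lintegral_tsum_tsum_tsum hmeas]
    calc _ = ∑' i, ∑' j, ∑' k, (if i ≠ j ∧ i ≠ k ∧ j ≠ k then ∫⁻ ω, g (p i ω) *
          (ENNReal.ofReal (K (p i ω) (p j ω)) * ENNReal.ofReal (K (p i ω) (p k ω))) ∂P
          else 0) := by
          refine tsum_congr fun i => tsum_congr fun j => tsum_congr fun k => ?_
          split_ifs with hd
          · simp_rw [adj_of_ne hd.1, adj_of_ne hd.2.1]
            exact h.lintegral_mark_mark (e := s(i, j)) (e' := s(i, k))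
              (fun he => by
                rw [Sym2.eq_iff] at he
                rcases he with ⟨_, he⟩ | ⟨he, _⟩
                · exact hd.2.2 he
                · exact hd.2.1 he) (G := fun x => g (x i))
              (hg.comp (measurable_pi_apply i)) (measurable_two_coord hK i j)
              (measurable_two_coord hK i k) (fun x => hK.le_one _ _) (fun x => hK.le_one _ _)
          · simp
      _ = ∫⁻ x, ∫⁻ y, ∫⁻ z, g x * (ENNReal.ofReal (K x y) * ENNReal.ofReal (K x z))
            ∂quadrant ∂quadrant ∂quadrant :=
          h.poisson.mecke_three
            (f := fun x y z => g x * (ENNReal.ofReal (K x y) * ENNReal.ofReal (K x z)))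
            ((hg.comp measurable_fst).mul
              ((hK.measurable_ofReal.comp (f := fun x : (ℝ × ℝ) × (ℝ × ℝ) × (ℝ × ℝ) =>
                (x.1, x.2.1)) (by fun_prop)).mul
              (hK.measurable_ofReal.comp (f := fun x : (ℝ × ℝ) × (ℝ × ℝ) × (ℝ × ℝ) =>
                (x.1, x.2.2)) (by fun_prop))))
      _ = _ := by
          refine lintegral_congr fun x => ?_
          have hx : Measurable fun y => ENNReal.ofReal (K x y) :=
            hK.measurable_ofReal.comp measurable_prodMk_left
          simp_rw [← mul_assoc, fun y => lintegral_const_mul (μ := quadrant)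
            (g x * ENNReal.ofReal (K x y)) hx]
          rw [lintegral_mul_const _ (hx.const_mul _), lintegral_const_mul _ hx, sq, ← mul_assoc]
          rfl
  rw [← h3, ← h.lintegral_weighted_deg hK hg, ← lintegral_add_left
    (Measurable.tsum fun i => Measurable.tsum fun j => Measurable.tsum (hmeas i j))]
  refine lintegral_mono fun ω => ?_
  simp only
  rw [← ENNReal.tsum_add]
  refine ENNReal.tsum_le_tsum fun i => ?_
  refine (mul_le_mul_right (deg_sq_le ω i) _).trans (le_of_eq ?_)
  rw [mul_add, ← ENNReal.tsum_mul_left]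
  simp only [← ENNReal.tsum_mul_left, mul_ite, mul_zero]

/-- The square is a sum over quadruples. If the four indices are not all distinct, either a factor
vanishes on the diagonal or one of `k`, `l` equals one of `i`, `j`; each of these four coincidences
sums to `∑ deg²`. -/
theorem pairSum_sq_le (hK : IsKernel K) (ω : Ω) : pairSum K p ζ ω ^ 2 ≤
    (∑' i, ∑' j, ∑' k, ∑' l, (if (i ≠ j ∧ i ≠ k ∧ i ≠ l) ∧ j ≠ k ∧ j ≠ l ∧ k ≠ l then
      adj K p ζ ω i j * adj K p ζ ω k l else 0)) + 4 * ∑' i, deg K p ζ ω i ^ 2 := by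
  have e1 : pairSum K p ζ ω ^ 2 =
      ∑' i, ∑' j, ∑' k, ∑' l, adj K p ζ ω i j * adj K p ζ ω k l := by
    rw [sq, pairSum, ← ENNReal.tsum_mul_right]
    refine tsum_congr fun i => ?_
    nth_rewrite 1 [deg]
    rw [← ENNReal.tsum_mul_right]
    refine tsum_congr fun j => ?_
    rw [← ENNReal.tsum_mul_left]
    refine tsum_congr fun k => ?_
    rw [deg, ENNReal.tsum_mul_left]
  have hsq : ∀ i, deg K p ζ ω i ^ 2 = ∑' j, ∑' l, adj K p ζ ω i j * adj K p ζ ω i l := by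
    intro i
    rw [sq]
    nth_rewrite 1 [deg]
    rw [← ENNReal.tsum_mul_right]
    refine tsum_congr fun j => ?_
    rw [deg, ENNReal.tsum_mul_left]
  have s1 : ∑' i, ∑' j, ∑' k, ∑' l, (if k = i then adj K p ζ ω i j * adj K p ζ ω i l else 0) =
      ∑' i, deg K p ζ ω i ^ 2 := by
    refine tsum_congr fun i => ?_
    rw [hsq]
    refine tsum_congr fun j => ?_
    rw [ENNReal.tsum_comm]
    exact tsum_congr fun l => tsum_ite_eq _ _
  have s2 : ∑' i, ∑' j, ∑' k, ∑' l, (if l = i then adj K p ζ ω i j * adj K p ζ ω i k else 0) =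
      ∑' i, deg K p ζ ω i ^ 2 := by
    refine tsum_congr fun i => ?_
    rw [hsq]
    refine tsum_congr fun j => tsum_congr fun l => tsum_ite_eq _ _
  have s3 : ∑' i, ∑' j, ∑' k, ∑' l, (if k = j then adj K p ζ ω j i * adj K p ζ ω j l else 0) =
      ∑' i, deg K p ζ ω i ^ 2 := by
    rw [ENNReal.tsum_comm, s1]
  have s4 : ∑' i, ∑' j, ∑' k, ∑' l, (if l = j then adj K p ζ ω j i * adj K p ζ ω j k else 0) =
      ∑' i, deg K p ζ ω i ^ 2 := by
    rw [ENNReal.tsum_comm, s2]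
  have e4 : 4 * ∑' i, deg K p ζ ω i ^ 2 = ∑' i, ∑' j, ∑' k, ∑' l,
      ((if k = i then adj K p ζ ω i j * adj K p ζ ω i l else 0) +
      ((if l = i then adj K p ζ ω i j * adj K p ζ ω i k else 0) +
      ((if k = j then adj K p ζ ω j i * adj K p ζ ω j l else 0) +
      (if l = j then adj K p ζ ω j i * adj K p ζ ω j k else 0)))) := by
    simp_rw [ENNReal.tsum_add]
    rw [s1, s2, s3, s4]
    ring
  rw [e1, e4]
  simp_rw [← ENNReal.tsum_add]
  refine ENNReal.tsum_le_tsum fun i => ENNReal.tsum_le_tsum fun j =>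
    ENNReal.tsum_le_tsum fun k => ENNReal.tsum_le_tsum fun l => ?_
  by_cases hij : i = j
  · subst hij; simp [adj_self]
  by_cases hkl : k = l
  · subst hkl; simp [adj_self]
  by_cases hik : k = i
  · subst hik; simp
  by_cases hil : l = i
  · subst hil; rw [adj_comm hK ω k l]; simp [hik]
  by_cases hjk : k = j
  · subst hjk; rw [adj_comm hK ω i k]; simp [hik, hil]
  by_cases hjl : l = j
  · subst hjl; rw [adj_comm hK ω i l, adj_comm hK ω k l]; simp [hik, hil, hjk]
  · simp [hij, hkl, Ne.symm hik, Ne.symm hil, Ne.symm hjk, Ne.symm hjl]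

/-- Edges on disjoint pairs of points contribute exactly the squared mean, so the second summand
bounds the variance. -/
theorem IsKEGSource.lintegral_pairSum_sq_le (h : IsKEGSource P p ζ) (hK : IsKernel K) :
    ∫⁻ ω, pairSum K p ζ ω ^ 2 ∂P ≤ (∫⁻ x, kernelDegree K x ∂quadrant) ^ 2 +
      4 * (∫⁻ x, kernelDegree K x ^ 2 ∂quadrant + ∫⁻ x, kernelDegree K x ∂quadrant) := by
  have hmeas : ∀ i j k l, Measurable fun ω =>
      if (i ≠ j ∧ i ≠ k ∧ i ≠ l) ∧ j ≠ k ∧ j ≠ l ∧ k ≠ l then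
      adj K p ζ ω i j * adj K p ζ ω k l else 0 := by
    intro i j k l
    split_ifs
    · exact (h.measurable_adj hK i j).mul (h.measurable_adj hK k l)
    · exact measurable_const
  have h4 : ∫⁻ ω, ∑' i, ∑' j, ∑' k, ∑' l,
      (if (i ≠ j ∧ i ≠ k ∧ i ≠ l) ∧ j ≠ k ∧ j ≠ l ∧ k ≠ l then
      adj K p ζ ω i j * adj K p ζ ω k l else 0) ∂P = (∫⁻ x, kernelDegree K x ∂quadrant) ^ 2 := by
    rw [lintegral_tsum_tsum_tsum_tsum hmeas]
    calc _ = ∑' i, ∑' j, ∑' k, ∑' l, (if (i ≠ j ∧ i ≠ k ∧ i ≠ l) ∧ j ≠ k ∧ j ≠ l ∧ k ≠ l then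
          ∫⁻ ω, ENNReal.ofReal (K (p i ω) (p j ω)) * ENNReal.ofReal (K (p k ω) (p l ω)) ∂P
          else 0) := by
          refine tsum_congr fun i => tsum_congr fun j => tsum_congr fun k =>
            tsum_congr fun l => ?_
          split_ifs with hd
          · simp_rw [adj_of_ne hd.1.1, adj_of_ne hd.2.2.2]
            have := h.lintegral_mark_mark (e := s(i, j)) (e' := s(k, l))
              (fun he => by
                rw [Sym2.eq_iff] at he
                rcases he with ⟨he, _⟩ | ⟨he, _⟩
                · exact hd.1.2.1 he
                · exact hd.1.2.2 he) (G := fun x => 1)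
              measurable_const (measurable_two_coord hK i j)
              (measurable_two_coord hK k l) (fun x => hK.le_one _ _) (fun x => hK.le_one _ _)
            simpa using this
          · simp
      _ = ∫⁻ x, ∫⁻ y, ∫⁻ z, ∫⁻ w, ENNReal.ofReal (K x y) * ENNReal.ofReal (K z w)
            ∂quadrant ∂quadrant ∂quadrant ∂quadrant :=
          h.poisson.mecke_four
            (f := fun x y z w => ENNReal.ofReal (K x y) * ENNReal.ofReal (K z w))
              ((hK.measurable_ofReal.comp (f := fun x : (ℝ × ℝ) × (ℝ × ℝ) × (ℝ × ℝ) × (ℝ × ℝ) =>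
                (x.1, x.2.1)) (by fun_prop)).mul
              (hK.measurable_ofReal.comp (f := fun x : (ℝ × ℝ) × (ℝ × ℝ) × (ℝ × ℝ) × (ℝ × ℝ) =>
                (x.2.2.1, x.2.2.2)) (by fun_prop)))
      _ = _ := by
          have hx : ∀ x, Measurable fun y => ENNReal.ofReal (K x y) := fun x =>
            hK.measurable_ofReal.comp measurable_prodMk_left
          have e : ∀ x y, ∫⁻ z, ∫⁻ w, ENNReal.ofReal (K x y) * ENNReal.ofReal (K z w)
              ∂quadrant ∂quadrant =
              ENNReal.ofReal (K x y) * ∫⁻ z, kernelDegree K z ∂quadrant := by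
            intro x y
            rw [← lintegral_const_mul _ hK.measurable_kernelDegree]
            exact lintegral_congr fun z => lintegral_const_mul _ (hx z)
          simp_rw [e]
          rw [sq, ← lintegral_mul_const _ hK.measurable_kernelDegree]
          exact lintegral_congr fun x => lintegral_mul_const _ (hx x)
  calc _ ≤ ∫⁻ ω, ((∑' i, ∑' j, ∑' k, ∑' l,
        (if (i ≠ j ∧ i ≠ k ∧ i ≠ l) ∧ j ≠ k ∧ j ≠ l ∧ k ≠ l then
        adj K p ζ ω i j * adj K p ζ ω k l else 0)) + 4 * ∑' i, deg K p ζ ω i ^ 2) ∂P :=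
        lintegral_mono fun ω => pairSum_sq_le hK ω
    _ = (∫⁻ x, kernelDegree K x ∂quadrant) ^ 2 + 4 * ∫⁻ ω, ∑' i, deg K p ζ ω i ^ 2 ∂P := by
        rw [lintegral_add_left (Measurable.tsum fun i => Measurable.tsum fun j =>
          Measurable.tsum fun k => Measurable.tsum (hmeas i j k)), h4, lintegral_const_mul]
        exact Measurable.tsum fun i => (h.measurable_deg hK i).pow_const _
    _ ≤ _ := by
        gcongr
        simpa using h.lintegral_weighted_deg_sq_le hK (g := fun _ => 1) measurable_const

end KEG

namespace KEG

/-! ### Concentration from second moments, in extended nonnegative reals -/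

/-- One of the truncated differences is zero, so this is the expansion of `|a - b|²`, written
additively because subtraction in `ℝ≥0∞` truncates. -/
theorem tsub_sq_add_le (a b : ℝ≥0∞) :
    (a - b) ^ 2 + (b - a) ^ 2 + 2 * b * a ≤ a ^ 2 + b ^ 2 := by
  rcases le_total a b with hab | hab
  · obtain ⟨c, rfl⟩ := exists_add_of_le hab
    rw [tsub_eq_zero_of_le hab]
    have : a + c - a ≤ c := add_tsub_le_left
    calc _ ≤ 0 ^ 2 + c ^ 2 + 2 * (a + c) * a := by gcongr
      _ = _ := by ring
  · obtain ⟨c, rfl⟩ := exists_add_of_le hab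
    rw [tsub_eq_zero_of_le hab]
    have : b + c - b ≤ c := add_tsub_le_left
    calc _ ≤ c ^ 2 + 0 ^ 2 + 2 * b * (b + c) := by gcongr
      _ = _ := by ring

section Concentration

variable {Ω : Type*} [MeasurableSpace Ω] {P : Measure Ω} [IsProbabilityMeasure P]

theorem lintegral_tsub_sq_le {X : Ω → ℝ≥0∞} (hX : Measurable X) {M V : ℝ≥0∞} (hM : M ≠ ∞)
    (h1 : ∫⁻ ω, X ω ∂P = M) (h2 : ∫⁻ ω, X ω ^ 2 ∂P ≤ M ^ 2 + V) :
    ∫⁻ ω, ((X ω - M) ^ 2 + (M - X ω) ^ 2) ∂P ≤ V := by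
  have hfin : 2 * M * M ≠ ∞ := ENNReal.mul_ne_top (ENNReal.mul_ne_top (by simp) hM) hM
  -- The cross term has mean `2 M²`; it is added to both sides and cancelled, which needs `M`
  -- finite.
  refine (ENNReal.add_le_add_iff_right hfin).1 ?_
  calc _ = ∫⁻ ω, ((X ω - M) ^ 2 + (M - X ω) ^ 2 + 2 * M * X ω) ∂P := by
        rw [lintegral_add_right _ (hX.const_mul _), lintegral_const_mul _ hX, h1]
    _ ≤ ∫⁻ ω, (X ω ^ 2 + M ^ 2) ∂P := lintegral_mono fun ω => tsub_sq_add_le _ _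
    _ = ∫⁻ ω, X ω ^ 2 ∂P + M ^ 2 := by
        rw [lintegral_add_right _ measurable_const]; simp
    _ ≤ M ^ 2 + V + M ^ 2 := by gcongr
    _ = _ := by ring

theorem ae_tendsto_zero_of_tsum_lintegral {X : ℕ → Ω → ℝ≥0∞} (hX : ∀ k, Measurable (X k))
    (h : ∑' k, ∫⁻ ω, X k ω ∂P ≠ ∞) : ∀ᵐ ω ∂P, Tendsto (fun k => X k ω) atTop (𝓝 0) := by
  rw [← lintegral_tsum fun k => (hX k).aemeasurable] at h
  filter_upwards [ae_lt_top' (Measurable.tsum hX).aemeasurable h] with ω hω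
  exact ENNReal.tendsto_atTop_zero_of_tsum_ne_top hω.ne

/-- If the second moments are close enough to the squared means along a sequence, then almost
surely the sequence stays close to its means. -/
theorem ae_eventually_close {X : ℕ → Ω → ℝ≥0∞} (hX : ∀ k, Measurable (X k))
    {M V c : ℕ → ℝ≥0∞} (hM : ∀ k, M k ≠ ∞) (h1 : ∀ k, ∫⁻ ω, X k ω ∂P = M k)
    (h2 : ∀ k, ∫⁻ ω, X k ω ^ 2 ∂P ≤ M k ^ 2 + V k) (hc0 : ∀ k, c k ≠ 0) (hc : ∀ k, c k ≠ ∞)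
    (hV : ∑' k, V k / c k ^ 2 ≠ ∞) :
    ∀ᵐ ω ∂P, ∀ ε : ℝ≥0∞, ε ≠ 0 → ∀ᶠ k in atTop,
      X k ω ≤ M k + ε * c k ∧ M k ≤ X k ω + ε * c k := by
  have hm : ∀ k, Measurable fun ω => ((X k ω - M k) ^ 2 + (M k - X k ω) ^ 2) := fun k =>
    (((hX k).sub_const _).pow_const _).add (((hX k).const_sub _).pow_const _)
  -- Chebyshev and Borel–Cantelli in one: the normalised squared deviations have summable means, so
  -- almost surely they tend to zero, which serves every `ε` at once.
  have h3 : ∑' k, ∫⁻ ω, ((X k ω - M k) ^ 2 + (M k - X k ω) ^ 2) / c k ^ 2 ∂P ≠ ∞ := by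
    refine ne_top_of_le_ne_top hV (ENNReal.tsum_le_tsum fun k => ?_)
    simp_rw [div_eq_mul_inv]
    rw [lintegral_mul_const _ (hm k)]
    gcongr
    exact lintegral_tsub_sq_le (hX k) (hM k) (h1 k) (h2 k)
  filter_upwards [ae_tendsto_zero_of_tsum_lintegral (fun k => (hm k).div_const _) h3]
    with ω hω ε hε
  filter_upwards [hω.eventually (gt_mem_nhds (show (0 : ℝ≥0∞) < ε ^ 2 by positivity))] with k hk
  have h4 : (X k ω - M k) ^ 2 + (M k - X k ω) ^ 2 ≤ (ε * c k) ^ 2 := by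
    rw [mul_pow]
    exact (ENNReal.div_le_iff (pow_ne_zero _ (hc0 k)) (ENNReal.pow_ne_top (hc k))).1 hk.le
  constructor
  · rw [← tsub_le_iff_left]
    exact (ENNReal.pow_right_strictMono two_ne_zero).le_iff_le.1 (le_self_add.trans h4)
  · rw [← tsub_le_iff_left]
    exact (ENNReal.pow_right_strictMono two_ne_zero).le_iff_le.1 (le_add_self.trans h4)

end Concentration

/-! ### Dyadic sums -/

theorem tsum_inv_two_pow : ∑' k : ℕ, ((2 : ℝ≥0∞)⁻¹) ^ k = 2 := by
  rw [ENNReal.tsum_geometric, ENNReal.one_sub_inv_two, inv_inv]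

/-- A geometric sum is at most twice its last term. Integrated at `x = μ(s)`, it gives `∑ 2ᵏ |{μ >
2ᵏ}| ≤ 2 ∫ μ`, which controls the points discarded by truncation. -/
theorem tsum_two_pow_lt (x : ℝ≥0∞) : ∑' k : ℕ, (if 2 ^ k < x then (2 : ℝ≥0∞) ^ k else 0) ≤ 2 * x := by
  have key : ∀ n : ℕ, ∑ k ∈ Finset.range n, (2 : ℝ≥0∞) ^ k ≤ 2 ^ n := by
    intro n
    induction n with
    | zero => simp
    | succ n ih => rw [Finset.sum_range_succ, pow_succ, mul_two]; gcongr
  refine ENNReal.tsum_le_of_sum_range_le fun N => ?_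
  induction N with
  | zero => simp
  | succ N ih =>
    by_cases hN : 2 ^ N < x
    · calc _ ≤ ∑ k ∈ Finset.range (N + 1), (2 : ℝ≥0∞) ^ k := by
            refine Finset.sum_le_sum fun k _ => ?_
            split_ifs
            · exact le_rfl
            · exact zero_le
        _ ≤ 2 ^ (N + 1) := key _
        _ = 2 * 2 ^ N := by rw [pow_succ, mul_comm]
        _ ≤ 2 * x := mul_le_mul_right hN.le _
    · rw [Finset.sum_range_succ, if_neg hN, add_zero]; exact ih

/-- At the first admissible `k₀` one has `x 2^{-k₀} ≤ 1`, and the later terms decay geometrically.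
Integrated at `x = μ(s)`, it makes the truncated second moments, divided by `2ᵏ`, summable. -/
theorem tsum_sq_div_two_pow (x : ℝ≥0∞) :
    ∑' k : ℕ, (if x ≤ 2 ^ k then x ^ 2 * (2⁻¹) ^ k else 0) ≤ 2 * x := by
  by_cases hx : ∃ k : ℕ, x ≤ 2 ^ k
  · obtain ⟨k₀, h0, hmin⟩ : ∃ k₀ : ℕ, x ≤ 2 ^ k₀ ∧ ∀ k < k₀, ¬ x ≤ 2 ^ k := by
      classical
      exact ⟨Nat.find hx, Nat.find_spec hx, fun k hk => Nat.find_min hx hk⟩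
    have h1 : x * (2⁻¹) ^ k₀ ≤ 1 := by
      rw [← ENNReal.inv_pow]
      exact (mul_le_mul_left h0 _).trans (ENNReal.mul_inv_le_one _)
    set F : ℕ → ℝ≥0∞ := fun k => if x ≤ 2 ^ k then x ^ 2 * (2⁻¹) ^ k else 0 with hF
    have h2 : ∑ k ∈ Finset.range k₀, F k = 0 :=
      Finset.sum_eq_zero fun k hk => if_neg (hmin k (Finset.mem_range.1 hk))
    have h3 : ∀ j, F (j + k₀) ≤ x * (2⁻¹) ^ j := by
      intro j
      simp only [hF]
      split_ifs
      · have e : x ^ 2 * (2⁻¹ : ℝ≥0∞) ^ (j + k₀) = x * (2⁻¹) ^ j * (x * (2⁻¹) ^ k₀) := by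
          rw [pow_add]; ring
        rw [e]
        exact (mul_le_mul_right h1 _).trans (mul_one _).le
      · exact zero_le
    have h4 := (ENNReal.summable (f := fun n => F (n + k₀))).sum_add_tsum_nat_add'
    rw [h2, zero_add] at h4
    rw [← h4]
    refine (ENNReal.tsum_le_tsum h3).trans ?_
    rw [ENNReal.tsum_mul_left, tsum_inv_two_pow, mul_comm x 2]
  · push Not at hx
    have : ∀ k : ℕ, (if x ≤ 2 ^ k then x ^ 2 * (2⁻¹) ^ k else 0) = 0 := fun k =>
      if_neg (not_le.2 (hx k))
    simp [this]

/-! ### Loops and isolated points -/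

section Counts

variable {Ω : Type*} [MeasurableSpace Ω] {P : Measure Ω}
  [IsProbabilityMeasure P] {p : ℕ → Ω → ℝ × ℝ} {ζ : Sym2 ℕ → Ω → ℝ}
  {K : ℝ × ℝ → ℝ × ℝ → ℝ} {q : ℝ × ℝ → ℝ}

theorem IsKEGSource.measurable_loop (h : IsKEGSource P p ζ) (hq : Measurable q) (i : ℕ) :
    Measurable fun ω => if ζ s(i, i) ω < q (p i ω) then (1 : ℝ≥0∞) else 0 :=
  Measurable.ite (measurableSet_lt (h.measurable _) (hq.comp (h.poisson.measurable i)))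
    measurable_const measurable_const

theorem IsKEGSource.measurable_loopSum (h : IsKEGSource P p ζ) (hq : Measurable q) :
    Measurable fun ω => loopSum q p ζ ω :=
  Measurable.tsum fun i => h.measurable_loop hq i

theorem IsKEGSource.lintegral_loopSum (h : IsKEGSource P p ζ) (hq : Measurable q)
    (h1 : ∀ x, q x ≤ 1) :
    ∫⁻ ω, loopSum q p ζ ω ∂P = ∫⁻ x, ENNReal.ofReal (q x) ∂quadrant := by
  unfold loopSum
  rw [lintegral_tsum fun i => (h.measurable_loop hq i).aemeasurable,
    ← h.poisson.lintegral_tsum hq.ennreal_ofReal,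
    lintegral_tsum (f := fun i ω => ENNReal.ofReal (q (p i ω))) fun i =>
      (hq.ennreal_ofReal.comp (h.poisson.measurable i)).aemeasurable]
  refine tsum_congr fun i => ?_
  simpa using h.lintegral_mark s(i, i) (G := fun _ => 1) measurable_const
    (hq.comp (measurable_pi_apply i)) fun x => h1 _

/-- Different points use different self marks, so only the diagonal terms exceed the squared mean,
and they sum to the mean. -/
theorem IsKEGSource.lintegral_loopSum_sq_le (h : IsKEGSource P p ζ) (hq : Measurable q)
    (h1 : ∀ x, q x ≤ 1) :
    ∫⁻ ω, loopSum q p ζ ω ^ 2 ∂P ≤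
      (∫⁻ x, ENNReal.ofReal (q x) ∂quadrant) ^ 2 + ∫⁻ x, ENNReal.ofReal (q x) ∂quadrant := by
  set l : ℕ → Ω → ℝ≥0∞ := fun i ω => if ζ s(i, i) ω < q (p i ω) then 1 else 0 with hl
  have hm : ∀ i, Measurable (l i) := h.measurable_loop hq
  have hm2 : ∀ i j, Measurable fun ω => if i ≠ j then l i ω * l j ω else 0 := by
    intro i j
    split_ifs
    · exact (hm i).mul (hm j)
    · exact measurable_const
  have hpt : ∀ ω, loopSum q p ζ ω ^ 2 ≤
      (∑' i, ∑' j, if i ≠ j then l i ω * l j ω else 0) + loopSum q p ζ ω := by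
    intro ω
    have e : loopSum q p ζ ω = ∑' i, l i ω := rfl
    rw [e, sq, ← ENNReal.tsum_mul_right, ← ENNReal.tsum_add]
    refine ENNReal.tsum_le_tsum fun i => ?_
    rw [← ENNReal.tsum_mul_left]
    calc _ ≤ ∑' j, ((if i ≠ j then l i ω * l j ω else 0) + (if j = i then l i ω else 0)) := by
          refine ENNReal.tsum_le_tsum fun j => ?_
          by_cases hij : i = j
          · subst hij
            simp only [hl]
            split_ifs <;> simp_all
          · simp [hij]
      _ = _ := by rw [ENNReal.tsum_add, tsum_ite_eq]
  have h2 : ∫⁻ ω, ∑' i, ∑' j, (if i ≠ j then l i ω * l j ω else 0) ∂P =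
      (∫⁻ x, ENNReal.ofReal (q x) ∂quadrant) ^ 2 := by
    rw [lintegral_tsum_tsum hm2]
    calc _ = ∑' i, ∑' j, (if i ≠ j then ∫⁻ ω, ENNReal.ofReal (q (p i ω)) *
          ENNReal.ofReal (q (p j ω)) ∂P else 0) := by
          refine tsum_congr fun i => tsum_congr fun j => ?_
          split_ifs with hij
          · have := h.lintegral_mark_mark (e := s(i, i)) (e' := s(j, j))
              (fun he => hij (by simpa using he)) (G := fun _ => 1) measurable_const
              (hq.comp (measurable_pi_apply i)) (hq.comp (measurable_pi_apply j))
              (fun x => h1 _) (fun x => h1 _)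
            simp only [one_mul] at this
            exact this
          · simp
      _ = ∫⁻ x, ∫⁻ y, ENNReal.ofReal (q x) * ENNReal.ofReal (q y) ∂quadrant ∂quadrant :=
          h.poisson.mecke_two (f := fun x y => ENNReal.ofReal (q x) * ENNReal.ofReal (q y))
            ((hq.ennreal_ofReal.comp measurable_fst).mul (hq.ennreal_ofReal.comp measurable_snd))
      _ = _ := by
          rw [sq, ← lintegral_mul_const _ hq.ennreal_ofReal]
          exact lintegral_congr fun x => lintegral_const_mul _ hq.ennreal_ofReal
  calc _ ≤ ∫⁻ ω, ((∑' i, ∑' j, if i ≠ j then l i ω * l j ω else 0) + loopSum q p ζ ω) ∂P :=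
        lintegral_mono hpt
    _ = _ := by
        rw [lintegral_add_right _ (h.measurable_loopSum hq), h2, h.lintegral_loopSum hq h1]

/-- A Chebyshev estimate summed over points: at an isolated point the squared deviation of the
degree from its kernel degree `D` is `D²`, while the expected sum of these deviations over `A` is at
most `∫_A D`. -/
theorem IsKEGSource.lintegral_isolated_le (h : IsKEGSource P p ζ) (hK : IsKernel K)
    {A : Set (ℝ × ℝ)} (hA : MeasurableSet A) (hfin : ∫⁻ x in A, kernelDegree K x ^ 2 ∂quadrant ≠ ∞) :
    ∫⁻ ω, ∑' i, A.indicator 1 (p i ω) * ((if deg K p ζ ω i = 0 then 1 else 0) *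
      kernelDegree K (p i ω) ^ 2) ∂P ≤ ∫⁻ x in A, kernelDegree K x ∂quadrant := by
  set g : ℝ × ℝ → ℝ≥0∞ := A.indicator 1 with hg
  have hgm : Measurable g := measurable_one.indicator hA
  have hκ := hK.measurable_kernelDegree
  have hi : ∀ f : ℝ × ℝ → ℝ≥0∞, ∫⁻ x, g x * f x ∂quadrant = ∫⁻ x in A, f x ∂quadrant := by
    intro f
    rw [← lintegral_indicator hA]
    refine lintegral_congr fun x => ?_
    by_cases hx : x ∈ A <;> simp [hg, hx]
  have hfin' : 2 * ∫⁻ x in A, kernelDegree K x ^ 2 ∂quadrant ≠ ∞ :=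
    ENNReal.mul_ne_top (by simp) hfin
  have hcross : ∫⁻ ω, ∑' i, (g (p i ω) * kernelDegree K (p i ω)) * deg K p ζ ω i ∂P =
      ∫⁻ x in A, kernelDegree K x ^ 2 ∂quadrant := by
    rw [h.lintegral_weighted_deg hK (g := fun x => g x * kernelDegree K x) (hgm.mul hκ), ← hi]
    refine lintegral_congr fun x => ?_
    ring
  have hsq : ∫⁻ ω, ∑' i, g (p i ω) * kernelDegree K (p i ω) ^ 2 ∂P =
      ∫⁻ x in A, kernelDegree K x ^ 2 ∂quadrant := by
    rw [h.poisson.lintegral_tsum (f := fun x => g x * kernelDegree K x ^ 2)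
      (hgm.mul (hκ.pow_const _)), hi]
  have hpm : ∀ i, Measurable fun ω => kernelDegree K (p i ω) := fun i =>
    hκ.comp (h.poisson.measurable i)
  have hgp : ∀ i, Measurable fun ω => g (p i ω) := fun i => hgm.comp (h.poisson.measurable i)
  -- Both sides receive the mean of the cross term `2 D deg`, finite by `hfin`.
  refine (ENNReal.add_le_add_iff_right hfin').1 ?_
  calc _ = ∫⁻ ω, (∑' i, g (p i ω) * ((if deg K p ζ ω i = 0 then 1 else 0) *
        kernelDegree K (p i ω) ^ 2) +
        2 * ∑' i, (g (p i ω) * kernelDegree K (p i ω)) * deg K p ζ ω i) ∂P := by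
        have hm : Measurable fun ω =>
            ∑' i, (g (p i ω) * kernelDegree K (p i ω)) * deg K p ζ ω i :=
          Measurable.tsum fun i => ((hgp i).mul (hpm i)).mul (h.measurable_deg hK i)
        rw [lintegral_add_right _ (hm.const_mul _), lintegral_const_mul _ hm, hcross]
    _ ≤ ∫⁻ ω, (∑' i, g (p i ω) * deg K p ζ ω i ^ 2 +
          ∑' i, g (p i ω) * kernelDegree K (p i ω) ^ 2) ∂P := by
        refine lintegral_mono fun ω => ?_
        simp only
        rw [← ENNReal.tsum_mul_left, ← ENNReal.tsum_add, ← ENNReal.tsum_add]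
        refine ENNReal.tsum_le_tsum fun i => ?_
        have key : (if deg K p ζ ω i = 0 then 1 else 0) * kernelDegree K (p i ω) ^ 2 +
            2 * kernelDegree K (p i ω) * deg K p ζ ω i ≤
            deg K p ζ ω i ^ 2 + kernelDegree K (p i ω) ^ 2 := by
          split_ifs with h0
          · simp [h0]
          · simpa using le_add_self.trans (tsub_sq_add_le (deg K p ζ ω i) (kernelDegree K (p i ω)))
        calc _ = g (p i ω) * ((if deg K p ζ ω i = 0 then 1 else 0) * kernelDegree K (p i ω) ^ 2 +
            2 * kernelDegree K (p i ω) * deg K p ζ ω i) := by ring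
          _ ≤ g (p i ω) * (deg K p ζ ω i ^ 2 + kernelDegree K (p i ω) ^ 2) := by gcongr
          _ = _ := mul_add _ _ _
    _ ≤ _ := by
        have hm : Measurable fun ω => ∑' i, g (p i ω) * kernelDegree K (p i ω) ^ 2 :=
          Measurable.tsum fun i => (hgp i).mul ((hpm i).pow_const _)
        rw [lintegral_add_right _ hm, hsq]
        have := h.lintegral_weighted_deg_sq_le hK hgm
        rw [hi, hi] at this
        calc _ ≤ _ := add_le_add_left this _
          _ = _ := by ring

end Counts

end KEG

namespace KEG

/-! ### Kernels on a label window -/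

/-- A symmetric measurable function of two latent coordinates with values in `[0, 1]`. -/
structure IsLatentKernel (w : ℝ → ℝ → ℝ) : Prop where
  measurable : Measurable (Function.uncurry w)
  symm : ∀ x y, w x y = w y x
  nonneg : ∀ x y, 0 ≤ w x y
  le_one : ∀ x y, w x y ≤ 1

noncomputable section

/-- The kernel on the plane that joins only points with labels in `[0, ν]`. -/
def box (ν : ℝ) (w : ℝ → ℝ → ℝ) (x y : ℝ × ℝ) : ℝ :=
  if x.1 ∈ Set.Icc 0 ν ∧ y.1 ∈ Set.Icc 0 ν then w x.2 y.2 else 0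

/-- The self-edge function on the plane that only sees labels in `[0, ν]`. -/
def boxLoop (ν : ℝ) (q : ℝ → ℝ) (x : ℝ × ℝ) : ℝ := if x.1 ∈ Set.Icc 0 ν then q x.2 else 0

open Classical in
/-- The restriction of a latent kernel to the coordinates of marginal at most `r`. -/
def trunc (w : ℝ → ℝ → ℝ) (r : ℝ≥0∞) (x y : ℝ) : ℝ :=
  if marginal w x ≤ r ∧ marginal w y ≤ r then w x y else 0

end

variable {w : ℝ → ℝ → ℝ}

theorem measurableSet_label_Icc (ν : ℝ) : MeasurableSet {x : ℝ × ℝ | x.1 ∈ Set.Icc 0 ν} :=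
  measurable_fst measurableSet_Icc

theorem IsLatentKernel.isKernel_box (hw : IsLatentKernel w) (ν : ℝ) : IsKernel (box ν w) where
  measurable := by
    unfold box
    refine Measurable.ite ?_ ?_ measurable_const
    · exact ((measurableSet_label_Icc ν).preimage measurable_fst).inter
        ((measurableSet_label_Icc ν).preimage measurable_snd)
    · exact hw.measurable.comp (f := fun x : (ℝ × ℝ) × (ℝ × ℝ) => (x.1.2, x.2.2)) (by fun_prop)
  symm x y := by
    unfold box
    rw [hw.symm]
    exact if_congr and_comm rfl rfl
  le_one x y := by
    unfold box
    split_ifs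
    · exact hw.le_one _ _
    · exact zero_le_one

theorem IsLatentKernel.measurable_ofReal (hw : IsLatentKernel w) :
    Measurable fun z : ℝ × ℝ => ENNReal.ofReal (w z.1 z.2) :=
  hw.measurable.ennreal_ofReal

theorem IsLatentKernel.measurable_marginal (hw : IsLatentKernel w) : Measurable (marginal w) :=
  hw.measurable_ofReal.lintegral_prod_right'

theorem IsLatentKernel.lintegral_marginal (hw : IsLatentKernel w) :
    ∫⁻ x, marginal w x ∂halfLine = ∫⁻ z, ENNReal.ofReal (w z.1 z.2) ∂quadrant :=
  (lintegral_prod _ hw.measurable_ofReal.aemeasurable).symm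

theorem lintegral_window (ν : ℝ) {f : ℝ → ℝ≥0∞} (hf : Measurable f) :
    ∫⁻ x, (if x.1 ∈ Set.Icc 0 ν then f x.2 else 0) ∂quadrant =
      ENNReal.ofReal ν * ∫⁻ s, f s ∂halfLine := by
  have e : ∀ x : ℝ × ℝ, (if x.1 ∈ Set.Icc 0 ν then f x.2 else 0) =
      (Set.Icc 0 ν).indicator 1 x.1 * f x.2 := by
    intro x
    by_cases hx : x.1 ∈ Set.Icc 0 ν
    · rw [if_pos hx, Set.indicator_of_mem hx]; simp
    · rw [if_neg hx, Set.indicator_of_notMem hx]; simp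
  simp_rw [e]
  rw [quadrant, lintegral_prod_mul (measurable_one.indicator measurableSet_Icc).aemeasurable
    hf.aemeasurable, lintegral_indicator_one measurableSet_Icc, halfLine_Icc]

theorem IsLatentKernel.kernelDegree_box (hw : IsLatentKernel w) (ν : ℝ) (x : ℝ × ℝ) :
    kernelDegree (box ν w) x =
      if x.1 ∈ Set.Icc 0 ν then ENNReal.ofReal ν * marginal w x.2 else 0 := by
  unfold kernelDegree
  split_ifs with hx
  · rw [marginal, ← lintegral_window ν (f := fun t => ENNReal.ofReal (w x.2 t))
      (hw.measurable_ofReal.comp measurable_prodMk_left)]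
    refine lintegral_congr fun y => ?_
    simp only [box, hx, true_and]
    split_ifs <;> simp
  · simp [box, hx]

theorem IsLatentKernel.lintegral_kernelDegree_box (hw : IsLatentKernel w) (ν : ℝ) :
    ∫⁻ x, kernelDegree (box ν w) x ∂quadrant =
      ENNReal.ofReal ν ^ 2 * ∫⁻ s, marginal w s ∂halfLine := by
  simp_rw [hw.kernelDegree_box]
  rw [lintegral_window ν (hw.measurable_marginal.const_mul _),
    lintegral_const_mul _ hw.measurable_marginal, sq, mul_assoc]

theorem IsLatentKernel.lintegral_kernelDegree_box_sq (hw : IsLatentKernel w) (ν : ℝ) :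
    ∫⁻ x, kernelDegree (box ν w) x ^ 2 ∂quadrant =
      ENNReal.ofReal ν ^ 3 * ∫⁻ s, marginal w s ^ 2 ∂halfLine := by
  simp_rw [hw.kernelDegree_box, ite_pow]
  rw [zero_pow two_ne_zero, lintegral_window ν ((hw.measurable_marginal.const_mul _).pow_const _)]
  simp_rw [mul_pow]
  rw [lintegral_const_mul _ (hw.measurable_marginal.pow_const _)]
  ring

theorem IsLatentKernel.trunc (hw : IsLatentKernel w) (r : ℝ≥0∞) : IsLatentKernel (trunc w r) where
  measurable := by
    have : MeasurableSet {x | marginal w x ≤ r} := hw.measurable_marginal measurableSet_Iic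
    exact Measurable.ite ((this.preimage measurable_fst).inter (this.preimage measurable_snd))
      hw.measurable measurable_const
  symm x y := by
    unfold KEG.trunc
    rw [hw.symm]
    exact if_congr and_comm rfl rfl
  nonneg x y := by unfold KEG.trunc; split_ifs; exacts [hw.nonneg _ _, le_rfl]
  le_one x y := by unfold KEG.trunc; split_ifs; exacts [hw.le_one _ _, zero_le_one]

theorem trunc_le (hw : IsLatentKernel w) (r : ℝ≥0∞) (x y : ℝ) : trunc w r x y ≤ w x y := by
  unfold trunc; split_ifs; exacts [le_rfl, hw.nonneg _ _]

theorem trunc_mono (hw : IsLatentKernel w) {r r' : ℝ≥0∞} (hr : r ≤ r') (x y : ℝ) :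
    trunc w r x y ≤ trunc w r' x y := by
  by_cases h : marginal w x ≤ r ∧ marginal w y ≤ r
  · rw [trunc, if_pos h, trunc, if_pos ⟨h.1.trans hr, h.2.trans hr⟩]
  · rw [trunc, if_neg h]; exact (hw.trunc r').nonneg _ _

theorem marginal_mono {w w' : ℝ → ℝ → ℝ} (h : ∀ x y, w x y ≤ w' x y) (x : ℝ) :
    marginal w x ≤ marginal w' x :=
  lintegral_mono fun y => ENNReal.ofReal_le_ofReal (h x y)

open Classical in
theorem marginal_trunc_le (hw : IsLatentKernel w) (r : ℝ≥0∞) (x : ℝ) :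
    marginal (trunc w r) x ≤ if marginal w x ≤ r then marginal w x else 0 := by
  split_ifs with h
  · exact marginal_mono (trunc_le hw r) x
  · rw [marginal]
    simp [trunc, h]

/-- Truncations at large levels keep part of the mass. -/
theorem exists_trunc_ne_zero (hw : IsLatentKernel w)
    (hfin : ∫⁻ s, marginal w s ∂halfLine ≠ ∞) (h0 : ∫⁻ s, marginal w s ∂halfLine ≠ 0) :
    ∃ k : ℕ, ∫⁻ s, marginal (trunc w (2 ^ k)) s ∂halfLine ≠ 0 := by
  by_contra! hall
  apply h0
  rw [hw.lintegral_marginal, lintegral_eq_zero_iff hw.measurable_ofReal]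
  have h1 : ∀ᵐ s ∂halfLine, marginal w s < ∞ := ae_lt_top hw.measurable_marginal hfin
  have h2 : ∀ᵐ z ∂quadrant, ∀ k : ℕ, ENNReal.ofReal (trunc w (2 ^ k) z.1 z.2) = 0 := by
    rw [ae_all_iff]
    intro k
    have := hall k
    rw [(hw.trunc _).lintegral_marginal,
      lintegral_eq_zero_iff (hw.trunc _).measurable_ofReal] at this
    exact this
  have h3 : ∀ᵐ z ∂quadrant, marginal w z.1 < ∞ := Measure.quasiMeasurePreserving_fst.ae h1
  have h4 : ∀ᵐ z ∂quadrant, marginal w z.2 < ∞ := Measure.quasiMeasurePreserving_snd.ae h1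
  filter_upwards [h2, h3, h4] with z h2 h3 h4
  obtain ⟨n, hn⟩ := ENNReal.exists_nat_gt (max_lt h3 h4).ne
  have hn2 : max (marginal w z.1) (marginal w z.2) ≤ 2 ^ n :=
    hn.le.trans (by exact_mod_cast Nat.lt_two_pow_self.le)
  have := h2 n
  rwa [KEG.trunc, if_pos ⟨(le_max_left _ _).trans hn2, (le_max_right _ _).trans hn2⟩] at this

/-! ### Almost sure asymptotics along powers of two -/

theorem ofReal_two_pow (k : ℕ) : ENNReal.ofReal ((2 : ℝ) ^ k) = 2 ^ k := by
  rw [ENNReal.ofReal_pow zero_le_two]; simp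

theorem two_pow_ne_zero (k : ℕ) : (2 : ℝ≥0∞) ^ k ≠ 0 := pow_ne_zero _ two_ne_zero

theorem two_pow_ne_top (k : ℕ) : (2 : ℝ≥0∞) ^ k ≠ ∞ := ENNReal.pow_ne_top (by simp)

variable {Ω : Type*} [MeasurableSpace Ω] {P : Measure Ω}
  [IsProbabilityMeasure P] {p : ℕ → Ω → ℝ × ℝ} {ζ : Sym2 ℕ → Ω → ℝ}

theorem adj_mono {K K' : ℝ × ℝ → ℝ × ℝ → ℝ} {ω : Ω} {i j : ℕ}
    (h : K (p i ω) (p j ω) ≤ K' (p i ω) (p j ω)) : adj K p ζ ω i j ≤ adj K' p ζ ω i j := by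
  unfold adj
  by_cases h1 : i ≠ j ∧ ζ s(i, j) ω < K (p i ω) (p j ω)
  · rw [if_pos h1, if_pos ⟨h1.1, h1.2.trans_le h⟩]
  · rw [if_neg h1]; exact zero_le

theorem pairSum_mono {K K' : ℝ × ℝ → ℝ × ℝ → ℝ} {ω : Ω}
    (h : ∀ i j, K (p i ω) (p j ω) ≤ K' (p i ω) (p j ω)) : pairSum K p ζ ω ≤ pairSum K' p ζ ω :=
  ENNReal.tsum_le_tsum fun i => ENNReal.tsum_le_tsum fun j => adj_mono (h i j)

/-- The truncation level equals the window length: it keeps `∫ μ²` of the truncated kernel finite,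
and slow enough in growth for the variances over `16ᵏ` to be summable. -/
theorem IsKEGSource.ae_trunc_pairSum (h : IsKEGSource P p ζ) (hw : IsLatentKernel w)
    (hfin : ∫⁻ s, marginal w s ∂halfLine ≠ ∞) :
    ∀ᵐ ω ∂P, ∀ ε : ℝ≥0∞, ε ≠ 0 → ∀ᶠ k : ℕ in atTop,
      pairSum (box (2 ^ k) (trunc w (2 ^ k))) p ζ ω ≤
        4 ^ k * ∫⁻ s, marginal (trunc w (2 ^ k)) s ∂halfLine + ε * 4 ^ k ∧
      4 ^ k * ∫⁻ s, marginal (trunc w (2 ^ k)) s ∂halfLine ≤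
        pairSum (box (2 ^ k) (trunc w (2 ^ k))) p ζ ω + ε * 4 ^ k := by
  classical
  have h4 : ∀ k : ℕ, (4 : ℝ≥0∞) ^ k = (2 ^ k) ^ 2 := fun k => by
    rw [← pow_mul, mul_comm, pow_mul]; norm_num
  have hle : ∀ k : ℕ, ∫⁻ s, marginal (trunc w (2 ^ k)) s ∂halfLine ≤
      ∫⁻ s, marginal w s ∂halfLine := fun k =>
    lintegral_mono fun s => marginal_mono (trunc_le hw _) s
  set I := ∫⁻ s, marginal w s ∂halfLine with hI
  set J : ℕ → ℝ≥0∞ := fun k => ∫⁻ s, marginal (trunc w (2 ^ k)) s ^ 2 ∂halfLine with hJ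
  have hmom1 : ∀ k : ℕ, ∫⁻ x, kernelDegree (box (2 ^ k) (trunc w (2 ^ k))) x ∂quadrant =
      4 ^ k * ∫⁻ s, marginal (trunc w (2 ^ k)) s ∂halfLine := fun k => by
    rw [(hw.trunc _).lintegral_kernelDegree_box, ofReal_two_pow, h4]
  refine ae_eventually_close
    (X := fun k ω => pairSum (box (2 ^ k) (trunc w (2 ^ k))) p ζ ω)
    (M := fun k => 4 ^ k * ∫⁻ s, marginal (trunc w (2 ^ k)) s ∂halfLine)
    (V := fun k => 4 * ((2 ^ k) ^ 3 * J k + (2 ^ k) ^ 2 * I)) (c := fun k => 4 ^ k)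
    (fun k => h.measurable_pairSum ((hw.trunc _).isKernel_box _))
    (fun k => ENNReal.mul_ne_top (ENNReal.pow_ne_top (by simp)) (ne_top_of_le_ne_top hfin (hle k)))
    (fun k => ?_) (fun k => ?_) (fun k => pow_ne_zero _ (by simp))
    (fun k => ENNReal.pow_ne_top (by simp)) ?_
  · rw [h.lintegral_pairSum ((hw.trunc _).isKernel_box _), hmom1]
  · refine (h.lintegral_pairSum_sq_le ((hw.trunc _).isKernel_box _)).trans ?_
    rw [hmom1, (hw.trunc _).lintegral_kernelDegree_box_sq, ofReal_two_pow, h4]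
    gcongr
    exact hle k
  -- The cubic term leaves `J k / 2ᵏ`, whose sum is bounded by `2 ∫ μ` through
  -- `tsum_sq_div_two_pow`; the quadratic term is geometrically small.
  · have e : ∀ k : ℕ, 4 * ((2 ^ k) ^ 3 * J k + (2 ^ k) ^ 2 * I) / (4 ^ k) ^ 2 ≤
        4 * (J k * (2⁻¹) ^ k) + 4 * I * (2⁻¹) ^ k := by
      intro k
      have hk : (2 : ℝ≥0∞) ^ k * (2⁻¹) ^ k = 1 := by
        rw [← ENNReal.inv_pow]
        exact ENNReal.mul_inv_cancel (two_pow_ne_zero k) (two_pow_ne_top k)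
      have hk1 : ((2 : ℝ≥0∞)⁻¹) ^ k ≤ 1 := pow_le_one₀ zero_le (by simp)
      have hinv : ((((2 : ℝ≥0∞) ^ k) ^ 2) ^ 2)⁻¹ = ((2⁻¹) ^ k) ^ 4 := by
        rw [ENNReal.inv_pow, ENNReal.inv_pow, ENNReal.inv_pow, ← pow_mul]
      rw [div_eq_mul_inv, h4, hinv]
      set a := (2 : ℝ≥0∞) ^ k
      set b := ((2 : ℝ≥0∞)⁻¹) ^ k
      calc _ = 4 * (J k * b) * (a * b) ^ 3 + 4 * I * b * (a * b) ^ 2 * b := by ring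
        _ = 4 * (J k * b) + 4 * I * b * b := by rw [hk, one_pow, one_pow, mul_one, mul_one]
        _ ≤ 4 * (J k * b) + 4 * I * b * 1 := add_le_add_right (mul_le_mul_right hk1 _) _
        _ = _ := by rw [mul_one]
    refine ne_top_of_le_ne_top ?_ (ENNReal.tsum_le_tsum e)
    rw [ENNReal.tsum_add, ENNReal.tsum_mul_left, ENNReal.tsum_mul_left, tsum_inv_two_pow]
    refine ENNReal.add_ne_top.2 ⟨ENNReal.mul_ne_top (by simp) ?_,
      ENNReal.mul_ne_top (ENNReal.mul_ne_top (by simp) hfin) (by simp)⟩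
    have hmeas : ∀ k : ℕ, Measurable fun s =>
        if marginal w s ≤ 2 ^ k then marginal w s ^ 2 * (2⁻¹) ^ k else 0 := fun k =>
      Measurable.ite (hw.measurable_marginal measurableSet_Iic)
        ((hw.measurable_marginal.pow_const _).mul_const _) measurable_const
    have hJle : ∀ k, J k * (2⁻¹) ^ k ≤
        ∫⁻ s, (if marginal w s ≤ 2 ^ k then marginal w s ^ 2 * (2⁻¹) ^ k else 0) ∂halfLine := by
      intro k
      rw [hJ, ← lintegral_mul_const _ ((hw.trunc _).measurable_marginal.pow_const _)]
      refine lintegral_mono fun s => ?_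
      have := marginal_trunc_le hw (2 ^ k) s
      simp only
      split_ifs with hs
      · rw [if_pos hs] at this; gcongr
      · rw [if_neg hs] at this
        simp [nonpos_iff_eq_zero.1 this]
    refine ne_top_of_le_ne_top ?_ (ENNReal.tsum_le_tsum hJle)
    rw [← lintegral_tsum fun k => (hmeas k).aemeasurable]
    refine ne_top_of_le_ne_top (ENNReal.mul_ne_top (by simp : (2 : ℝ≥0∞) ≠ ∞) hfin) ?_
    rw [hI, ← lintegral_const_mul _ hw.measurable_marginal]
    exact lintegral_mono fun s => tsum_sq_div_two_pow _

/-- The expected number of offending points is `2ᵏ |{μ > 2ᵏ}|`, which is summable in `k`; counts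
that tend to zero are eventually zero. Hence truncation eventually changes no edge in the window. -/
theorem IsKEGSource.ae_eventually_marginal_le (h : IsKEGSource P p ζ) (hw : IsLatentKernel w)
    (hfin : ∫⁻ s, marginal w s ∂halfLine ≠ ∞) :
    ∀ᵐ ω ∂P, ∀ᶠ k : ℕ in atTop, ∀ i, (p i ω).1 ∈ Set.Icc (0 : ℝ) (2 ^ k) →
      marginal w (p i ω).2 ≤ 2 ^ k := by
  classical
  set f : ℕ → ℝ × ℝ → ℝ≥0∞ := fun k x => if x.1 ∈ Set.Icc (0 : ℝ) (2 ^ k) then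
    (if 2 ^ k < marginal w x.2 then 1 else 0) else 0 with hf
  have hg : ∀ k : ℕ, Measurable fun s => if 2 ^ k < marginal w s then (1 : ℝ≥0∞) else 0 :=
    fun k => Measurable.ite (hw.measurable_marginal measurableSet_Ioi) measurable_const
      measurable_const
  have hfm : ∀ k, Measurable (f k) := fun k =>
    Measurable.ite (measurableSet_label_Icc _) ((hg k).comp measurable_snd) measurable_const
  have hX : ∀ k, Measurable fun ω => ∑' i, f k (p i ω) := fun k =>
    Measurable.tsum fun i => (hfm k).comp (h.poisson.measurable i)
  have hsum : ∑' k, ∫⁻ ω, ∑' i, f k (p i ω) ∂P ≠ ∞ := by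
    have e : ∀ k, ∫⁻ ω, ∑' i, f k (p i ω) ∂P =
        ∫⁻ s, (if 2 ^ k < marginal w s then 2 ^ k else 0) ∂halfLine := by
      intro k
      rw [h.poisson.lintegral_tsum (hfm k), hf, lintegral_window _ (hg k), ofReal_two_pow,
        ← lintegral_const_mul _ (hg k)]
      refine lintegral_congr fun s => ?_
      split_ifs <;> simp
    simp_rw [e]
    rw [← lintegral_tsum (f := fun (k : ℕ) s => if 2 ^ k < marginal w s then (2 : ℝ≥0∞) ^ k else 0)
      fun k => (Measurable.ite (hw.measurable_marginal measurableSet_Ioi)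
      measurable_const measurable_const).aemeasurable]
    refine ne_top_of_le_ne_top (ENNReal.mul_ne_top (by simp : (2 : ℝ≥0∞) ≠ ∞) hfin) ?_
    rw [← lintegral_const_mul _ hw.measurable_marginal]
    exact lintegral_mono fun s => tsum_two_pow_lt _
  filter_upwards [ae_tendsto_zero_of_tsum_lintegral hX hsum] with ω hω
  filter_upwards [hω.eventually (gt_mem_nhds zero_lt_one)] with k hk i hi
  by_contra hlt
  have h1 : f k (p i ω) = 1 := by
    simp only [hf]
    rw [if_pos hi, if_pos (not_le.1 hlt)]
  exact absurd (h1 ▸ ENNReal.le_tsum i) (not_le.2 hk)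

/-- For an integrable kernel, the number of joined ordered pairs in the window `[0, ν]` is of
order `ν²` along powers of two. -/
theorem IsKEGSource.ae_pairSum_bounds (h : IsKEGSource P p ζ) (hw : IsLatentKernel w)
    (hfin : ∫⁻ s, marginal w s ∂halfLine ≠ ∞) :
    ∀ᵐ ω ∂P, (∀ᶠ k : ℕ in atTop, pairSum (box (2 ^ k) w) p ζ ω ≤
        (∫⁻ s, marginal w s ∂halfLine + 1) * 4 ^ k) ∧
      (∫⁻ s, marginal w s ∂halfLine ≠ 0 → ∃ c : ℝ≥0∞, c ≠ 0 ∧ ∀ᶠ k : ℕ in atTop,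
        c * 4 ^ k ≤ pairSum (box (2 ^ k) w) p ζ ω) := by
  filter_upwards [h.ae_trunc_pairSum hw hfin, h.ae_eventually_marginal_le hw hfin] with ω h1 h2
  have hmono : ∀ k : ℕ, ∫⁻ s, marginal (trunc w (2 ^ k)) s ∂halfLine ≤
      ∫⁻ s, marginal w s ∂halfLine := fun k =>
    lintegral_mono fun s => marginal_mono (trunc_le hw _) s
  constructor
  · filter_upwards [h1 1 one_ne_zero, h2] with k hk hk2
    calc pairSum (box (2 ^ k) w) p ζ ω ≤ pairSum (box (2 ^ k) (trunc w (2 ^ k))) p ζ ω := by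
          refine pairSum_mono fun i j => ?_
          unfold box
          split_ifs with hij
          · rw [trunc, if_pos ⟨hk2 i hij.1, hk2 j hij.2⟩]
          · exact le_rfl
      _ ≤ _ := hk.1
      _ ≤ 4 ^ k * ∫⁻ s, marginal w s ∂halfLine + 1 * 4 ^ k :=
          add_le_add_left (mul_le_mul_right (hmono k) _) _
      _ = _ := by ring
  · intro h0
    -- Truncated masses increase with the level, so beyond `k₀` they are at least `c`; taking `ε = c
    -- / 2` gives away half of it.
    obtain ⟨k₀, hk₀⟩ := exists_trunc_ne_zero hw hfin h0
    set c := ∫⁻ s, marginal (trunc w (2 ^ k₀)) s ∂halfLine with hc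
    have hcfin : c ≠ ∞ := ne_top_of_le_ne_top hfin (hmono k₀)
    refine ⟨c / 2, ENNReal.div_ne_zero.2 ⟨hk₀, by simp⟩, ?_⟩
    filter_upwards [h1 (c / 2) (ENNReal.div_ne_zero.2 ⟨hk₀, by simp⟩), eventually_ge_atTop k₀]
      with k hk hkk
    have hfin2 : c / 2 * 4 ^ k ≠ ∞ :=
      ENNReal.mul_ne_top (ENNReal.div_ne_top hcfin (by simp)) (ENNReal.pow_ne_top (by simp))
    refine (ENNReal.add_le_add_iff_right hfin2).1 ?_
    calc c / 2 * 4 ^ k + c / 2 * 4 ^ k = 4 ^ k * c := by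
          rw [← add_mul, ENNReal.add_halves, mul_comm]
      _ ≤ 4 ^ k * ∫⁻ s, marginal (trunc w (2 ^ k)) s ∂halfLine := by
          gcongr
          exact lintegral_mono fun s => marginal_mono
            (trunc_mono hw (pow_le_pow_right₀ one_le_two hkk)) s
      _ ≤ _ := hk.2
      _ ≤ _ := by
          gcongr
          refine pairSum_mono fun i j => ?_
          unfold box
          split_ifs with hij
          · exact trunc_le hw _ _ _
          · exact le_rfl

/-! ### Self edges and points in a window -/

theorem measurable_boxLoop {q : ℝ → ℝ} (hq : Measurable q) (ν : ℝ) : Measurable (boxLoop ν q) :=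
  Measurable.ite (measurableSet_label_Icc _) (hq.comp measurable_snd) measurable_const

theorem boxLoop_le_one {q : ℝ → ℝ} (h1 : ∀ s, q s ≤ 1) (ν : ℝ) (x : ℝ × ℝ) :
    boxLoop ν q x ≤ 1 := by
  unfold boxLoop; split_ifs; exacts [h1 _, zero_le_one]

theorem lintegral_boxLoop {q : ℝ → ℝ} (hq : Measurable q) (ν : ℝ) :
    ∫⁻ x, ENNReal.ofReal (boxLoop ν q x) ∂quadrant =
      ENNReal.ofReal ν * ∫⁻ s, ENNReal.ofReal (q s) ∂halfLine := by
  rw [← lintegral_window ν hq.ennreal_ofReal]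
  refine lintegral_congr fun x => ?_
  unfold boxLoop
  split_ifs <;> simp

/-- The number of marked points in the window `[0, ν]` is asymptotically linear in `ν`. -/
theorem IsKEGSource.ae_loopSum_bounds (h : IsKEGSource P p ζ) {q : ℝ → ℝ} (hq : Measurable q)
    (h1 : ∀ s, q s ≤ 1) (hfin : ∫⁻ s, ENNReal.ofReal (q s) ∂halfLine ≠ ∞) :
    ∀ᵐ ω ∂P, ∀ ε : ℝ≥0∞, ε ≠ 0 → ∀ᶠ k : ℕ in atTop,
      loopSum (boxLoop (2 ^ k) q) p ζ ω ≤
        2 ^ k * ∫⁻ s, ENNReal.ofReal (q s) ∂halfLine + ε * 2 ^ k ∧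
      2 ^ k * ∫⁻ s, ENNReal.ofReal (q s) ∂halfLine ≤
        loopSum (boxLoop (2 ^ k) q) p ζ ω + ε * 2 ^ k := by
  set H := ∫⁻ s, ENNReal.ofReal (q s) ∂halfLine with hH
  refine ae_eventually_close (X := fun k ω => loopSum (boxLoop (2 ^ k) q) p ζ ω)
    (M := fun k => 2 ^ k * H) (V := fun k => 2 ^ k * H) (c := fun k => 2 ^ k)
    (fun k => h.measurable_loopSum (measurable_boxLoop hq _))
    (fun k => ENNReal.mul_ne_top (two_pow_ne_top k) hfin) (fun k => ?_) (fun k => ?_)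
    two_pow_ne_zero two_pow_ne_top ?_
  · rw [h.lintegral_loopSum (measurable_boxLoop hq _) (boxLoop_le_one h1 _), lintegral_boxLoop hq,
      ofReal_two_pow]
  · refine (h.lintegral_loopSum_sq_le (measurable_boxLoop hq _) (boxLoop_le_one h1 _)).trans ?_
    rw [lintegral_boxLoop hq, ofReal_two_pow]
  · have e : ∀ k : ℕ, 2 ^ k * H / (2 ^ k) ^ 2 = H * (2⁻¹) ^ k := by
      intro k
      rw [div_eq_mul_inv, ENNReal.inv_pow, ENNReal.inv_pow]
      have hk : (2 : ℝ≥0∞) ^ k * (2⁻¹) ^ k = 1 := by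
        rw [← ENNReal.inv_pow]
        exact ENNReal.mul_inv_cancel (two_pow_ne_zero k) (two_pow_ne_top k)
      calc _ = H * (2⁻¹) ^ k * ((2 : ℝ≥0∞) ^ k * (2⁻¹) ^ k) := by ring
        _ = _ := by rw [hk, mul_one]
    simp_rw [e]
    rw [ENNReal.tsum_mul_left, tsum_inv_two_pow]
    exact ENNReal.mul_ne_top hfin (by simp)

open Classical in
/-- The number of points in the window `[0, ν]` with latent value in a set of finite measure. -/
theorem IsKEGSource.ae_window_count (h : IsKEGSource P p ζ) {A : Set ℝ} (hA : MeasurableSet A)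
    (hfin : halfLine A ≠ ∞) :
    ∀ᵐ ω ∂P, ∀ ε : ℝ≥0∞, ε ≠ 0 → ∀ᶠ k : ℕ in atTop,
      (∑' i, if (p i ω).1 ∈ Set.Icc (0 : ℝ) (2 ^ k) ∧ (p i ω).2 ∈ A then (1 : ℝ≥0∞) else 0) ≤
        2 ^ k * halfLine A + ε * 2 ^ k ∧
      2 ^ k * halfLine A ≤
        (∑' i, if (p i ω).1 ∈ Set.Icc (0 : ℝ) (2 ^ k) ∧ (p i ω).2 ∈ A then (1 : ℝ≥0∞) else 0) +
          ε * 2 ^ k := by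
  -- Counting points is the self-edge count with probabilities zero and one: a mark in `[0, 1)`
  -- always passes one and never passes zero.
  set q : ℝ → ℝ := A.indicator 1 with hq
  have hqm : Measurable q := measurable_one.indicator hA
  have hq1 : ∀ s, q s ≤ 1 := fun s => Set.indicator_le_self' (by simp) s
  have hint : ∫⁻ s, ENNReal.ofReal (q s) ∂halfLine = halfLine A := by
    rw [← lintegral_indicator_one hA]
    refine lintegral_congr fun s => ?_
    by_cases hs : s ∈ A <;> simp [hq, hs]
  have hb := h.ae_loopSum_bounds hqm hq1 (by rwa [hint])
  rw [hint] at hb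
  filter_upwards [hb, h.ae_mark_mem] with ω hω hζ
  have e : ∀ ν : ℝ, loopSum (boxLoop ν q) p ζ ω =
      ∑' i, if (p i ω).1 ∈ Set.Icc (0 : ℝ) ν ∧ (p i ω).2 ∈ A then (1 : ℝ≥0∞) else 0 := by
    intro ν
    refine tsum_congr fun i => ?_
    refine if_congr ?_ rfl rfl
    unfold boxLoop
    by_cases h1 : (p i ω).1 ∈ Set.Icc (0 : ℝ) ν
    · by_cases h2 : (p i ω).2 ∈ A
      · simp only [h1, h2, hq, if_true, Set.indicator_of_mem, and_self, iff_true]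
        exact (hζ _).2
      · simp only [h1, h2, hq, if_true, and_false, iff_false]
        rw [Set.indicator_of_notMem h2]
        exact not_lt.2 (hζ _).1
    · simp only [h1, if_false, false_and, iff_false]
      exact not_lt.2 (hζ _).1
  simpa only [e] using hω

end KEG

namespace KEG

variable {Ω : Type*} [MeasurableSpace Ω] {P : Measure Ω}
  [IsProbabilityMeasure P] {p : ℕ → Ω → ℝ × ℝ} {ζ : Sym2 ℕ → Ω → ℝ} {w : ℝ → ℝ → ℝ}

/-! ### Many points are not isolated -/

open Classical in
-- With `ν = 2ᵏ`, kernel degrees over `A` lie between `ν δ` and `ν R`, so the expected number `N` of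
-- isolated points satisfies `ν² δ² N ≤ ν R · ν |A|`. Thus `N` is bounded in `k`, and division by
-- `2ᵏ` makes it summable.
theorem IsKEGSource.ae_isolated_small (h : IsKEGSource P p ζ) (hw : IsLatentKernel w)
    {A : Set ℝ} (hA : MeasurableSet A) (hfin : halfLine A ≠ ∞) {δ R : ℝ≥0∞} (hδ : δ ≠ 0)
    (hR : R ≠ ∞) (hAδ : ∀ s ∈ A, δ ≤ marginal w s) (hAR : ∀ s ∈ A, marginal w s ≤ R) :
    ∀ᵐ ω ∂P, Tendsto (fun k : ℕ => (∑' i, if ((p i ω).1 ∈ Set.Icc (0 : ℝ) (2 ^ k) ∧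
      (p i ω).2 ∈ A) ∧ deg (box (2 ^ k) w) p ζ ω i = 0 then (1 : ℝ≥0∞) else 0) * (2⁻¹) ^ k)
      atTop (𝓝 0) := by
  have hm : ∀ (k : ℕ) (i : ℕ), Measurable fun ω => if ((p i ω).1 ∈ Set.Icc (0 : ℝ) (2 ^ k) ∧
      (p i ω).2 ∈ A) ∧ deg (box (2 ^ k) w) p ζ ω i = 0 then (1 : ℝ≥0∞) else 0 := by
    intro k i
    refine Measurable.ite ?_ measurable_const measurable_const
    exact (((measurableSet_label_Icc _).inter (measurable_snd hA)).preimage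
      (h.poisson.measurable i)).inter
      (h.measurable_deg (hw.isKernel_box _) i (measurableSet_singleton 0))
  refine ae_tendsto_zero_of_tsum_lintegral
    (fun k => (Measurable.tsum (hm k)).mul_const _) ?_
  have hbound : ∀ k : ℕ, δ ^ 2 * ∫⁻ ω, (∑' i, if ((p i ω).1 ∈ Set.Icc (0 : ℝ) (2 ^ k) ∧
      (p i ω).2 ∈ A) ∧ deg (box (2 ^ k) w) p ζ ω i = 0 then (1 : ℝ≥0∞) else 0) ∂P ≤
      R * halfLine A := by
    intro k
    set ν : ℝ := 2 ^ k with hν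
    set B : Set (ℝ × ℝ) := {x | x.1 ∈ Set.Icc (0 : ℝ) ν ∧ x.2 ∈ A} with hB
    have hBm : MeasurableSet B := (measurableSet_label_Icc _).inter (measurable_snd hA)
    have hν1 : ENNReal.ofReal ν = 2 ^ k := ofReal_two_pow k
    have hBq : quadrant B = 2 ^ k * halfLine A := by
      have : B = Set.Icc (0 : ℝ) ν ×ˢ A := rfl
      rw [this, quadrant_prod, halfLine_Icc, hν1]
    have hκ : ∀ x ∈ B, kernelDegree (box ν w) x = 2 ^ k * marginal w x.2 := by
      intro x hx
      rw [hw.kernelDegree_box, if_pos hx.1, hν1]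
    have hBint : ∀ n : ℕ, ∫⁻ x in B, kernelDegree (box ν w) x ^ n ∂quadrant ≤
        (2 ^ k * R) ^ n * (2 ^ k * halfLine A) := by
      intro n
      rw [← hBq, ← setLIntegral_const]
      refine setLIntegral_mono measurable_const fun x hx => ?_
      rw [hκ x hx]
      exact pow_le_pow_left₀ zero_le (mul_le_mul_right (hAR _ hx.2) _) _
    have h1 := h.lintegral_isolated_le (hw.isKernel_box ν) hBm (ne_top_of_le_ne_top
      (ENNReal.mul_ne_top (ENNReal.pow_ne_top (ENNReal.mul_ne_top (two_pow_ne_top k) hR))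
        (ENNReal.mul_ne_top (two_pow_ne_top k) hfin)) (hBint 2))
    have h2 := h1.trans (by simpa using hBint 1)
    have h3 : (2 ^ k) ^ 2 * (δ ^ 2 * ∫⁻ ω, (∑' i, if ((p i ω).1 ∈ Set.Icc (0 : ℝ) ν ∧
        (p i ω).2 ∈ A) ∧ deg (box ν w) p ζ ω i = 0 then (1 : ℝ≥0∞) else 0) ∂P) ≤
        (2 ^ k) ^ 2 * (R * halfLine A) := by
      calc _ = ∫⁻ ω, ∑' i, (2 ^ k) ^ 2 * δ ^ 2 * (if ((p i ω).1 ∈ Set.Icc (0 : ℝ) ν ∧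
            (p i ω).2 ∈ A) ∧ deg (box ν w) p ζ ω i = 0 then (1 : ℝ≥0∞) else 0) ∂P := by
            simp_rw [ENNReal.tsum_mul_left]
            rw [lintegral_const_mul _ (Measurable.tsum (hm k)), mul_assoc]
        _ ≤ _ := by
            refine lintegral_mono fun ω => ENNReal.tsum_le_tsum fun i => ?_
            by_cases hx : p i ω ∈ B
            · by_cases hd : deg (box ν w) p ζ ω i = 0
              · rw [if_pos ⟨hx, hd⟩, if_pos hd, Set.indicator_of_mem hx, hκ _ hx, mul_pow]
                simp only [Pi.one_apply, one_mul, mul_one]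
                exact mul_le_mul_right (pow_le_pow_left₀ zero_le (hAδ _ hx.2) _) _
              · rw [if_neg fun hh => hd hh.2, mul_zero]; exact zero_le
            · rw [if_neg fun hh => hx hh.1, mul_zero]; exact zero_le
        _ ≤ _ := h2
        _ = _ := by ring
    exact (ENNReal.mul_le_mul_iff_right (pow_ne_zero _ (two_pow_ne_zero k))
      (ENNReal.pow_ne_top (two_pow_ne_top k))).1 h3
  have hδ2 : δ ^ 2 ≠ 0 := pow_ne_zero _ hδ
  -- An infinite lower bound contradicts the finite upper bound `R` unless `A` is empty.
  by_cases hδt : δ = ∞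
  · have hA0 : A = ∅ := by
      refine Set.eq_empty_of_forall_notMem fun s hs => hR ?_
      exact top_le_iff.1 (hδt ▸ (hAδ s hs).trans (hAR s hs))
    simp [hA0]
  have hδ2t : δ ^ 2 ≠ ∞ := ENNReal.pow_ne_top hδt
  have hle : ∀ k : ℕ, ∫⁻ ω, (∑' i, if ((p i ω).1 ∈ Set.Icc (0 : ℝ) (2 ^ k) ∧
      (p i ω).2 ∈ A) ∧ deg (box (2 ^ k) w) p ζ ω i = 0 then (1 : ℝ≥0∞) else 0) * (2⁻¹) ^ k ∂P ≤
      R * halfLine A / δ ^ 2 * (2⁻¹) ^ k := by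
    intro k
    rw [lintegral_mul_const _ (Measurable.tsum (hm k))]
    refine mul_le_mul_left ?_ _
    rw [ENNReal.le_div_iff_mul_le (Or.inl hδ2) (Or.inl hδ2t), mul_comm]
    exact hbound k
  refine ne_top_of_le_ne_top ?_ (ENNReal.tsum_le_tsum hle)
  rw [ENNReal.tsum_mul_left, tsum_inv_two_pow]
  exact ENNReal.mul_ne_top (ENNReal.div_ne_top (ENNReal.mul_ne_top hR hfin) hδ2) (by simp)

open Classical in
-- Of the loss `2 * 2 ^ k`, one half covers the fluctuation of the point count and the other the
-- isolated points.
theorem IsKEGSource.ae_nonisolated_ge (h : IsKEGSource P p ζ) (hw : IsLatentKernel w)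
    {A : Set ℝ} (hA : MeasurableSet A) (hfin : halfLine A ≠ ∞) {δ R : ℝ≥0∞} (hδ : δ ≠ 0)
    (hR : R ≠ ∞) (hAδ : ∀ s ∈ A, δ ≤ marginal w s) (hAR : ∀ s ∈ A, marginal w s ≤ R) :
    ∀ᵐ ω ∂P, ∀ᶠ k : ℕ in atTop, 2 ^ k * halfLine A ≤
      (∑' i, if deg (box (2 ^ k) w) p ζ ω i ≠ 0 then (1 : ℝ≥0∞) else 0) + 2 * 2 ^ k := by
  filter_upwards [h.ae_window_count hA hfin, h.ae_isolated_small hw hA hfin hδ hR hAδ hAR]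
    with ω h1 h2
  filter_upwards [h1 1 one_ne_zero, h2.eventually (gt_mem_nhds zero_lt_one)] with k hk1 hk2
  have hk : ((2 : ℝ≥0∞)⁻¹) ^ k * 2 ^ k = 1 := by
    rw [← ENNReal.inv_pow]
    exact ENNReal.inv_mul_cancel (two_pow_ne_zero k) (two_pow_ne_top k)
  have hiso : (∑' i, if ((p i ω).1 ∈ Set.Icc (0 : ℝ) (2 ^ k) ∧
      (p i ω).2 ∈ A) ∧ deg (box (2 ^ k) w) p ζ ω i = 0 then (1 : ℝ≥0∞) else 0) ≤ 2 ^ k := by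
    have := mul_le_mul_left hk2.le (2 ^ k)
    rwa [mul_assoc, hk, mul_one, one_mul] at this
  refine hk1.2.trans ?_
  rw [one_mul, two_mul, ← add_assoc]
  refine add_le_add_left ?_ _
  refine le_trans ?_ (add_le_add_right hiso _)
  rw [← ENNReal.tsum_add]
  refine ENNReal.tsum_le_tsum fun i => ?_
  by_cases hd : deg (box (2 ^ k) w) p ζ ω i = 0
  · simp [hd]
  · simp only [hd, ne_eq, not_false_eq_true, if_true]
    refine le_add_right ?_
    split_ifs <;> simp

open Classical in
/-- If the marginal is integrable and positive on a set of infinite measure, then the number of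
non-isolated points grows faster than linearly. -/
theorem IsKEGSource.ae_nonisolated_superlinear (h : IsKEGSource P p ζ) (hw : IsLatentKernel w)
    (hfin : ∫⁻ s, marginal w s ∂halfLine ≠ ∞) (hinf : halfLine {s | marginal w s ≠ 0} = ∞) :
    ∀ᵐ ω ∂P, ∀ K : ℕ, ∀ᶠ k : ℕ in atTop, K * 2 ^ k ≤
      ∑' i, if deg (box (2 ^ k) w) p ζ ω i ≠ 0 then (1 : ℝ≥0∞) else 0 := by
  rw [ae_all_iff]
  intro K
  have hμ := hw.measurable_marginal
  -- These sets exhaust `{0 < μ < ∞}`, so their measures tend to infinity, while each is finite by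
  -- Markov's inequality.
  set A : ℕ → Set ℝ := fun n =>
    {s | ((n : ℝ≥0∞) + 1)⁻¹ ≤ marginal w s ∧ marginal w s ≤ n} with hAdef
  have hAm : ∀ n, MeasurableSet (A n) := fun n =>
    (hμ measurableSet_Ici).inter (hμ measurableSet_Iic)
  have hmono : Monotone A := by
    intro a b hab s hs
    have hab' : (a : ℝ≥0∞) ≤ b := by exact_mod_cast hab
    exact ⟨(ENNReal.inv_le_inv.2 (by gcongr)).trans hs.1, hs.2.trans hab'⟩
  have hU : halfLine (⋃ n, A n) = ∞ := by
    have hae : {s | marginal w s ≠ 0} ≤ᵐ[halfLine] ⋃ n, A n := by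
      filter_upwards [ae_lt_top hμ hfin] with s hs h0
      have h0' : marginal w s ≠ 0 := h0
      obtain ⟨a, ha⟩ := ENNReal.exists_nat_gt hs.ne
      obtain ⟨b, hb⟩ := ENNReal.exists_inv_nat_lt h0'
      refine Set.mem_iUnion.2 ⟨max a b, ?_, ?_⟩
      · refine le_trans (ENNReal.inv_le_inv.2 ?_) hb.le
        refine le_trans ?_ le_self_add
        exact_mod_cast le_max_right a b
      · refine ha.le.trans ?_
        exact_mod_cast le_max_left a b
    exact top_le_iff.1 (hinf ▸ measure_mono_ae hae)
  rw [hmono.measure_iUnion] at hU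
  -- The surplus `2` pays for the loss `2 * 2 ^ k` in `ae_nonisolated_ge`.
  obtain ⟨n, hn⟩ := lt_iSup_iff.1 (hU ▸ (ENNReal.natCast_lt_top (K + 2)) :
    ((K + 2 : ℕ) : ℝ≥0∞) < ⨆ n, halfLine (A n))
  have hδ : ((n : ℝ≥0∞) + 1)⁻¹ ≠ 0 := ENNReal.inv_ne_zero.2 (by simp)
  have hfinA : halfLine (A n) ≠ ∞ := by
    have h1 := mul_meas_ge_le_lintegral (μ := halfLine) hμ ((n : ℝ≥0∞) + 1)⁻¹
    have h2 : halfLine (A n) ≤ halfLine {s | ((n : ℝ≥0∞) + 1)⁻¹ ≤ marginal w s} :=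
      measure_mono fun s hs => hs.1
    intro htop
    rw [htop, top_le_iff] at h2
    rw [h2, ENNReal.mul_top hδ] at h1
    exact hfin (top_le_iff.1 h1)
  filter_upwards [h.ae_nonisolated_ge hw (hAm n) hfinA hδ (ENNReal.natCast_ne_top n)
    (fun s hs => hs.1) fun s hs => hs.2] with ω hω
  filter_upwards [hω] with k hk
  refine (ENNReal.add_le_add_iff_right
    (ENNReal.mul_ne_top (by simp : (2 : ℝ≥0∞) ≠ ∞) (two_pow_ne_top k))).1 (le_trans ?_ hk)
  rw [← add_mul, mul_comm]
  refine mul_le_mul_right ?_ _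
  exact_mod_cast hn.le

end KEG

namespace KEG

/-! ### The clipped kernel -/

open Classical in
/-- A function on the quadrant, extended by zero. -/
noncomputable def clip (W : ℝ → ℝ → ℝ) (x y : ℝ) : ℝ := if 0 ≤ x ∧ 0 ≤ y then W x y else 0

/-- `IsGraphex` constrains `W` only on the quadrant, whereas the kernel lemmas need symmetry and
bounds everywhere. -/
theorem IsGraphex.isLatentKernel_clip {W : ℝ → ℝ → ℝ} (hW : IsGraphex W) :
    IsLatentKernel (clip W) where
  measurable := Measurable.ite ((measurableSet_Ici.preimage measurable_fst).inter
    (measurableSet_Ici.preimage measurable_snd)) hW.measurable measurable_const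
  symm x y := by
    unfold clip
    by_cases h : 0 ≤ x ∧ 0 ≤ y
    · rw [if_pos h, if_pos h.symm, hW.symm _ _ h.1 h.2]
    · rw [if_neg h, if_neg fun h' => h h'.symm]
  nonneg x y := by
    unfold clip; split_ifs with h
    exacts [hW.nonneg _ _ h.1 h.2, le_rfl]
  le_one x y := by
    unfold clip; split_ifs with h
    exacts [hW.le_one _ _ h.1 h.2, zero_le_one]

theorem clip_of_nonneg {W : ℝ → ℝ → ℝ} {x y : ℝ} (hx : 0 ≤ x) (hy : 0 ≤ y) :
    clip W x y = W x y := if_pos ⟨hx, hy⟩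

theorem ae_clip_eq (W : ℝ → ℝ → ℝ) : ∀ᵐ z ∂quadrant, clip W z.1 z.2 = W z.1 z.2 := by
  filter_upwards [ae_quadrant_nonneg] with z hz
  exact clip_of_nonneg hz.1 hz.2

theorem IsGraphex.lintegral_marginal_clip {W : ℝ → ℝ → ℝ} (hW : IsGraphex W) :
    ∫⁻ s, marginal (clip W) s ∂halfLine = ∫⁻ z, ENNReal.ofReal (W z.1 z.2) ∂quadrant := by
  rw [hW.isLatentKernel_clip.lintegral_marginal]
  refine lintegral_congr_ae ?_
  filter_upwards [ae_clip_eq W] with z hz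
  rw [hz]

/-! ### Edge and vertex counts in terms of the indices of the points -/

theorem tsum_ite_one {α : Type*} (q : α → Prop) [DecidablePred q] :
    ∑' i, (if q i then (1 : ℝ≥0∞) else 0) = ({i | q i}.encard : ℝ≥0∞) := by
  rw [← ENNReal.tsum_set_one, tsum_subtype {i | q i} (fun _ => (1 : ℝ≥0∞))]
  refine tsum_congr fun i => ?_
  by_cases h : q i <;> simp [h]

section Graph

variable {Ω : Type*} {W : ℝ → ℝ → ℝ} {p : ℕ → Ω → ℝ × ℝ} {ζ : Sym2 ℕ → Ω → ℝ} {ω : Ω}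

/-- The index pairs of the edges of the truncation at `ν`. -/
def indexEdges (W : ℝ → ℝ → ℝ) (p : ℕ → Ω → ℝ × ℝ) (ζ : Sym2 ℕ → Ω → ℝ) (ω : Ω) (ν : ℝ) :
    Set (Sym2 ℕ) :=
  {e | ∃ i j, e = s(i, j) ∧ ((p i ω).1 ∈ Set.Icc 0 ν ∧ (p j ω).1 ∈ Set.Icc 0 ν) ∧
    ζ s(i, j) ω < W (p i ω).2 (p j ω).2}

/-- The indices of the vertices of the truncation at `ν`. -/
def indexVertices (W : ℝ → ℝ → ℝ) (p : ℕ → Ω → ℝ × ℝ) (ζ : Sym2 ℕ → Ω → ℝ) (ω : Ω) (ν : ℝ) :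
    Set ℕ := {i | ∃ e ∈ indexEdges W p ζ ω ν, i ∈ e}

theorem truncation_edgeSet (ν : ℝ) : truncation (edgeSet W p ζ ω) ν =
    Sym2.map (fun i => (p i ω).1) '' indexEdges W p ζ ω ν := by
  ext e
  constructor
  · rintro ⟨⟨i, j, hij, rfl⟩, hν⟩
    exact ⟨s(i, j), ⟨i, j, rfl, ⟨hν _ (Sym2.mem_mk_left _ _), hν _ (Sym2.mem_mk_right _ _)⟩, hij⟩,
      rfl⟩
  · rintro ⟨_, ⟨i, j, rfl, ⟨hi, hj⟩, hij⟩, rfl⟩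
    refine ⟨⟨i, j, hij, rfl⟩, fun x hx => ?_⟩
    rw [Sym2.map_mk, Sym2.mem_iff] at hx
    rcases hx with rfl | rfl
    exacts [hi, hj]

theorem vertexSet_truncation (ν : ℝ) : vertexSet (truncation (edgeSet W p ζ ω) ν) =
    (fun i => (p i ω).1) '' indexVertices W p ζ ω ν := by
  rw [truncation_edgeSet]
  ext x
  constructor
  · rintro ⟨_, ⟨e, he, rfl⟩, hx⟩
    obtain ⟨i, hi, rfl⟩ := Sym2.mem_map.1 hx
    exact ⟨i, ⟨e, he, hi⟩, rfl⟩
  · rintro ⟨i, ⟨e, he, hi⟩, rfl⟩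
    exact ⟨_, ⟨e, he, rfl⟩, Sym2.mem_map.2 ⟨i, hi, rfl⟩⟩

theorem indexEdges_mono {ν ν' : ℝ} (h : ν ≤ ν') :
    indexEdges W p ζ ω ν ⊆ indexEdges W p ζ ω ν' := by
  rintro _ ⟨i, j, rfl, ⟨hi, hj⟩, hij⟩
  exact ⟨i, j, rfl, ⟨⟨hi.1, hi.2.trans h⟩, ⟨hj.1, hj.2.trans h⟩⟩, hij⟩

theorem indexVertices_mono {ν ν' : ℝ} (h : ν ≤ ν') :
    indexVertices W p ζ ω ν ⊆ indexVertices W p ζ ω ν' := by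
  rintro i ⟨e, he, hi⟩
  exact ⟨e, indexEdges_mono h he, hi⟩

theorem indexVertices_finite {ν : ℝ} (h : (indexEdges W p ζ ω ν).Finite) :
    (indexVertices W p ζ ω ν).Finite := by
  have : indexVertices W p ζ ω ν = ⋃ e ∈ indexEdges W p ζ ω ν, {i | i ∈ e} := by
    ext i; simp [indexVertices]
  rw [this]
  refine h.biUnion fun e _ => ?_
  induction e with
  | _ a b =>
    refine (Set.toFinite {a, b}).subset fun i hi => ?_
    simpa using hi

theorem numEdges_eq (hinj : Function.Injective fun i => (p i ω).1) (ν : ℝ) :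
    numEdges (edgeSet W p ζ ω) ν = (indexEdges W p ζ ω ν).ncard := by
  rw [numEdges, truncation_edgeSet, Set.ncard_image_of_injective _ (Sym2.map.injective hinj)]

theorem numVertices_eq (hinj : Function.Injective fun i => (p i ω).1) (ν : ℝ) :
    numVertices (edgeSet W p ζ ω) ν = (indexVertices W p ζ ω ν).ncard := by
  rw [numVertices, vertexSet_truncation, Set.ncard_image_of_injective _ hinj]

/-- This crude bound turns growth of the edge count into growth of the vertex count in the dense
case. -/
theorem ncard_indexEdges_le {ν : ℝ} (h : (indexEdges W p ζ ω ν).Finite) :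
    (indexEdges W p ζ ω ν).ncard ≤ (indexVertices W p ζ ω ν).ncard ^ 2 := by
  have hv := indexVertices_finite h
  have hsub : indexEdges W p ζ ω ν ⊆ (fun q : ℕ × ℕ => s(q.1, q.2)) ''
      (indexVertices W p ζ ω ν ×ˢ indexVertices W p ζ ω ν) := by
    rintro _ ⟨i, j, rfl, hij⟩
    exact ⟨(i, j), ⟨⟨_, ⟨i, j, rfl, hij⟩, Sym2.mem_mk_left _ _⟩,
      ⟨_, ⟨i, j, rfl, hij⟩, Sym2.mem_mk_right _ _⟩⟩, rfl⟩
  calc _ ≤ _ := Set.ncard_le_ncard hsub ((hv.prod hv).image _)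
    _ ≤ _ := Set.ncard_image_le (hv.prod hv)
    _ = _ := by rw [Set.ncard_prod, sq]

/-- The ordered index pairs of the proper edges of the truncation at `ν`. -/
def indexPairs (W : ℝ → ℝ → ℝ) (p : ℕ → Ω → ℝ × ℝ) (ζ : Sym2 ℕ → Ω → ℝ) (ω : Ω) (ν : ℝ) :
    Set (ℕ × ℕ) :=
  {q | q.1 ≠ q.2 ∧ ((p q.1 ω).1 ∈ Set.Icc 0 ν ∧ (p q.2 ω).1 ∈ Set.Icc 0 ν) ∧
    ζ s(q.1, q.2) ω < W (p q.1 ω).2 (p q.2 ω).2}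

/-- The indices of the self edges of the truncation at `ν`. -/
def indexLoops (W : ℝ → ℝ → ℝ) (p : ℕ → Ω → ℝ × ℝ) (ζ : Sym2 ℕ → Ω → ℝ) (ω : Ω) (ν : ℝ) :
    Set ℕ :=
  {i | (p i ω).1 ∈ Set.Icc 0 ν ∧ ζ s(i, i) ω < W (p i ω).2 (p i ω).2}

theorem encard_indexEdges_le (ν : ℝ) : (indexEdges W p ζ ω ν).encard ≤
    (indexPairs W p ζ ω ν).encard + (indexLoops W p ζ ω ν).encard := by
  have hsub : indexEdges W p ζ ω ν ⊆ ((fun q : ℕ × ℕ => s(q.1, q.2)) '' indexPairs W p ζ ω ν) ∪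
      ((fun i => s(i, i)) '' indexLoops W p ζ ω ν) := by
    rintro _ ⟨i, j, rfl, hij⟩
    by_cases h : i = j
    · subst h
      exact Or.inr ⟨i, ⟨hij.1.1, hij.2⟩, rfl⟩
    · exact Or.inl ⟨(i, j), ⟨h, hij⟩, rfl⟩
  calc _ ≤ _ := Set.encard_le_encard hsub
    _ ≤ _ := Set.encard_union_le _ _
    _ ≤ _ := add_le_add (Set.encard_image_le _ _) (Set.encard_image_le _ _)

/-- Forgetting the order is injective on the increasing pairs and on the decreasing pairs. -/
theorem encard_indexPairs_le (ν : ℝ) : (indexPairs W p ζ ω ν).encard ≤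
    (indexEdges W p ζ ω ν).encard + (indexEdges W p ζ ω ν).encard := by
  set f : ℕ × ℕ → Sym2 ℕ := fun q => s(q.1, q.2) with hf
  have hmem : ∀ q ∈ indexPairs W p ζ ω ν, f q ∈ indexEdges W p ζ ω ν := fun q hq =>
    ⟨q.1, q.2, rfl, hq.2⟩
  have hsub : indexPairs W p ζ ω ν ⊆ {q ∈ indexPairs W p ζ ω ν | q.1 < q.2} ∪
      {q ∈ indexPairs W p ζ ω ν | q.2 < q.1} := by
    intro q hq
    rcases lt_or_gt_of_ne hq.1 with h | h
    exacts [Or.inl ⟨hq, h⟩, Or.inr ⟨hq, h⟩]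
  refine (Set.encard_le_encard hsub).trans ((Set.encard_union_le _ _).trans (add_le_add ?_ ?_))
  · refine Set.encard_le_encard_of_injOn (f := f) (fun q hq => hmem q hq.1) ?_
    rintro ⟨a, b⟩ ⟨_, hab⟩ ⟨c, d⟩ ⟨_, hcd⟩ heq
    simp only [hf, Sym2.eq_iff] at heq hab hcd
    rw [Prod.mk.injEq]; omega
  · refine Set.encard_le_encard_of_injOn (f := f) (fun q hq => hmem q hq.1) ?_
    rintro ⟨a, b⟩ ⟨_, hab⟩ ⟨c, d⟩ ⟨_, hcd⟩ heq
    simp only [hf, Sym2.eq_iff] at heq hab hcd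
    rw [Prod.mk.injEq]; omega

/-- Outside the window the kernel is zero, and a nonnegative mark never lies below zero. -/
theorem lt_box_clip_iff (hnn : ∀ i, 0 ≤ (p i ω).1 ∧ 0 ≤ (p i ω).2) (hζ : ∀ e, 0 ≤ ζ e ω) (ν : ℝ)
    (i j : ℕ) : ζ s(i, j) ω < box ν (clip W) (p i ω) (p j ω) ↔
      ((p i ω).1 ∈ Set.Icc 0 ν ∧ (p j ω).1 ∈ Set.Icc 0 ν) ∧
        ζ s(i, j) ω < W (p i ω).2 (p j ω).2 := by
  unfold box
  split_ifs with h
  · rw [clip_of_nonneg (hnn i).2 (hnn j).2]; tauto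
  · have := hζ s(i, j)
    constructor
    · intro h'; linarith
    · intro h'; exact absurd h'.1 h

theorem pairSum_eq_encard (hnn : ∀ i, 0 ≤ (p i ω).1 ∧ 0 ≤ (p i ω).2) (hζ : ∀ e, 0 ≤ ζ e ω)
    (ν : ℝ) : pairSum (box ν (clip W)) p ζ ω = ((indexPairs W p ζ ω ν).encard : ℝ≥0∞) := by
  classical
  unfold pairSum deg
  rw [← ENNReal.tsum_prod (f := fun i j => adj (box ν (clip W)) p ζ ω i j), indexPairs,
    ← tsum_ite_one]
  refine tsum_congr fun q => ?_
  unfold adj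
  exact if_congr (and_congr_right fun _ => lt_box_clip_iff hnn hζ ν _ _) rfl rfl

theorem loopSum_eq_encard (hnn : ∀ i, 0 ≤ (p i ω).1 ∧ 0 ≤ (p i ω).2) (hζ : ∀ e, 0 ≤ ζ e ω)
    (ν : ℝ) : loopSum (boxLoop ν fun s => clip W s s) p ζ ω = ((indexLoops W p ζ ω ν).encard : ℝ≥0∞) := by
  classical
  unfold loopSum
  rw [indexLoops, ← tsum_ite_one]
  refine tsum_congr fun i => if_congr ?_ rfl rfl
  unfold boxLoop
  split_ifs with h
  · simp [h, clip_of_nonneg (W := W) (hnn i).2 (hnn i).2]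
  · simp [h, hζ]

open Classical in
-- Only an inequality, since a vertex whose sole edge is a self edge has degree zero here.
theorem tsum_nonisolated_le (hnn : ∀ i, 0 ≤ (p i ω).1 ∧ 0 ≤ (p i ω).2) (hζ : ∀ e, 0 ≤ ζ e ω)
    (ν : ℝ) : ∑' i, (if deg (box ν (clip W)) p ζ ω i ≠ 0 then (1 : ℝ≥0∞) else 0) ≤
      ((indexVertices W p ζ ω ν).encard : ℝ≥0∞) := by
  rw [tsum_ite_one]
  refine ENat.toENNReal_le.2 (Set.encard_le_encard fun i hi => ?_)
  rw [Set.mem_ofPred_eq, deg, ne_eq, ENNReal.tsum_eq_zero, not_forall] at hi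
  obtain ⟨j, hj⟩ := hi
  unfold adj at hj
  have hij : i ≠ j ∧ ζ s(i, j) ω < box ν (clip W) (p i ω) (p j ω) := by
    by_contra h; exact hj (if_neg h)
  exact ⟨s(i, j), ⟨i, j, rfl, (lt_box_clip_iff hnn hζ ν i j).1 hij.2⟩, Sym2.mem_mk_left _ _⟩

end Graph

/-! ### Deterministic interpolation between powers of two -/

theorem exists_two_pow_near {k₀ : ℕ} {ν : ℝ} (h : (2 : ℝ) ^ k₀ ≤ ν) :
    ∃ k, k₀ ≤ k ∧ (2 : ℝ) ^ k ≤ ν ∧ ν ≤ 2 ^ (k + 1) := by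
  obtain ⟨k, h1, h2⟩ := exists_nat_pow_near ((one_le_pow₀ one_le_two).trans h) one_lt_two
  refine ⟨k, ?_, h1, h2.le⟩
  exact Nat.lt_succ_iff.1 ((pow_lt_pow_iff_right₀ (one_lt_two (α := ℝ))).1 (h.trans_lt h2))

/-- For `2ᵏ ≤ ν ≤ 2ᵏ⁺¹`, edges are bounded above at `k + 1`, at the price of a factor four, and
vertices below at `k`. -/
theorem tendsto_sqrt_div_of_dyadic {e v : ℝ → ℕ} (he : Monotone e) (hv : Monotone v) {C : ℝ}
    (hC : ∀ᶠ k : ℕ in atTop, (e (2 ^ k) : ℝ) ≤ C * 4 ^ k)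
    (hK : ∀ K : ℕ, ∀ᶠ k : ℕ in atTop, (K : ℝ) * 2 ^ k ≤ v (2 ^ k)) :
    Tendsto v atTop atTop ∧ Tendsto (fun ν => √(e ν : ℝ) / (v ν : ℝ)) atTop (𝓝 0) := by
  have hkey : ∀ K : ℕ, ∀ᶠ ν : ℝ in atTop, ∃ k : ℕ, (e ν : ℝ) ≤ C * 4 * 4 ^ k ∧
      (K : ℝ) * 2 ^ k ≤ v ν := by
    intro K
    obtain ⟨k₀, hk₀⟩ := eventually_atTop.1 (hC.and (hK K))
    filter_upwards [eventually_ge_atTop ((2 : ℝ) ^ k₀)] with ν hν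
    obtain ⟨k, hk, h1, h2⟩ := exists_two_pow_near hν
    refine ⟨k, ?_, ?_⟩
    · have h3 : (e ν : ℝ) ≤ e (2 ^ (k + 1)) := by exact_mod_cast he h2
      have h4 := (hk₀ (k + 1) (by omega)).1
      rw [pow_succ (4 : ℝ)] at h4
      linarith
    · have h3 : (v (2 ^ k) : ℝ) ≤ v ν := by exact_mod_cast hv h1
      exact (hk₀ k hk).2.trans h3
  constructor
  · refine tendsto_atTop.2 fun K => ?_
    filter_upwards [hkey K] with ν ⟨k, _, h⟩
    have h1 : (K : ℝ) ≤ K * 2 ^ k := le_mul_of_one_le_right (by positivity) (one_le_pow₀ one_le_two)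
    exact_mod_cast h1.trans h
  · rw [Metric.tendsto_atTop']
    intro ε hε
    -- Then `√e ≤ D 2ᵏ` and `v ≥ K 2ᵏ`, so any `K > D / ε` suffices; the maximum covers a possibly
    -- negative `C`.
    set D := √(max C 0 * 4) with hD
    obtain ⟨K, hK'⟩ := exists_nat_gt (D / ε)
    have hD0 : 0 ≤ D := Real.sqrt_nonneg _
    have hK0 : (0 : ℝ) < K := lt_of_le_of_lt (by positivity) hK'
    obtain ⟨N, hN⟩ := eventually_atTop.1 (hkey K)
    refine ⟨N, fun ν hν => ?_⟩
    obtain ⟨k, h1, h2⟩ := hN ν hν.le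
    have h2k : (0 : ℝ) < 2 ^ k := by positivity
    have hvpos : (0 : ℝ) < v ν := lt_of_lt_of_le (by positivity) h2
    have hs : √(e ν : ℝ) ≤ D * 2 ^ k := by
      have h5 : (e ν : ℝ) ≤ max C 0 * 4 * (2 ^ k) ^ 2 := by
        have h6 : (4 : ℝ) ^ k = (2 ^ k) ^ 2 := by rw [← pow_mul, mul_comm, pow_mul]; norm_num
        rw [← h6]
        refine h1.trans ?_
        gcongr
        exact le_max_left _ _
      calc _ ≤ √(max C 0 * 4 * (2 ^ k) ^ 2) := Real.sqrt_le_sqrt h5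
        _ = _ := by rw [Real.sqrt_mul (by positivity), Real.sqrt_sq h2k.le]
    rw [Real.dist_eq, sub_zero, abs_of_nonneg (by positivity), div_lt_iff₀ hvpos]
    rw [div_lt_iff₀ hε] at hK'
    calc _ ≤ D * 2 ^ k := hs
      _ < K * ε * 2 ^ k := by gcongr
      _ = ε * (K * 2 ^ k) := by ring
      _ ≤ _ := by gcongr

/-- The interpolation runs the other way: edges are bounded below at `k` and vertices above at `k +
1`. Divergence of `v` comes from `v ≥ √e ≥ √c 2ᵏ`. -/
theorem dense_of_dyadic {e v : ℝ → ℕ} (he : Monotone e) (hv : Monotone v)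
    (hev : ∀ ν, e ν ≤ v ν ^ 2) {c C : ℝ} (hc0 : 0 < c) (hC0 : 0 < C)
    (hc : ∀ᶠ k : ℕ in atTop, c * 4 ^ k ≤ (e (2 ^ k) : ℝ))
    (hC : ∀ᶠ k : ℕ in atTop, (v (2 ^ k) : ℝ) ≤ C * 2 ^ k) :
    Tendsto v atTop atTop ∧
      ∃ c' : ℝ, 0 < c' ∧ ∀ᶠ ν in atTop, c' * (v ν : ℝ) ^ 2 ≤ (e ν : ℝ) := by
  have hpow : ∀ k : ℕ, (4 : ℝ) ^ k = (2 ^ k) ^ 2 := fun k => by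
    rw [← pow_mul, mul_comm, pow_mul]; norm_num
  have hkey : ∀ N : ℕ, ∀ᶠ ν : ℝ in atTop, ∃ k : ℕ, N ≤ k ∧ c * (2 ^ k) ^ 2 ≤ (e ν : ℝ) ∧
      (v ν : ℝ) ≤ C * 2 * 2 ^ k := by
    intro N
    obtain ⟨k₀, hk₀⟩ := eventually_atTop.1 (hc.and hC)
    filter_upwards [eventually_ge_atTop ((2 : ℝ) ^ (max k₀ N))] with ν hν
    obtain ⟨k, hk, h1, h2⟩ := exists_two_pow_near hν
    refine ⟨k, (le_max_right _ _).trans hk, ?_, ?_⟩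
    · have h3 : (e (2 ^ k) : ℝ) ≤ e ν := by exact_mod_cast he h1
      rw [← hpow]
      exact (hk₀ k ((le_max_left _ _).trans hk)).1.trans h3
    · have h3 : (v ν : ℝ) ≤ v (2 ^ (k + 1)) := by exact_mod_cast hv h2
      have h4 := (hk₀ (k + 1) (((le_max_left _ _).trans hk).trans (Nat.le_succ k))).2
      calc (v ν : ℝ) ≤ C * 2 ^ (k + 1) := h3.trans h4
        _ = _ := by ring
  constructor
  · refine tendsto_atTop.2 fun K => ?_
    obtain ⟨N, hN⟩ := (((tendsto_pow_atTop_atTop_of_one_lt (one_lt_two (α := ℝ))).const_mul_atTop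
      (Real.sqrt_pos.2 hc0)).eventually_ge_atTop (K : ℝ)).exists_forall_of_atTop
    filter_upwards [hkey N] with ν ⟨k, hk, h1, _⟩
    have h2 : (e ν : ℝ) ≤ (v ν : ℝ) ^ 2 := by exact_mod_cast hev ν
    have h3 : (√c * 2 ^ k) ^ 2 ≤ (v ν : ℝ) ^ 2 := by
      rw [mul_pow, Real.sq_sqrt hc0.le]; exact h1.trans h2
    have h4 := (pow_le_pow_iff_left₀ (by positivity) (by positivity) two_ne_zero).1 h3
    exact_mod_cast (hN k hk).trans h4
  · refine ⟨c / (C * 2) ^ 2, by positivity, ?_⟩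
    filter_upwards [hkey 0] with ν ⟨k, _, h1, h2⟩
    rw [div_mul_eq_mul_div, div_le_iff₀ (by positivity)]
    calc c * (v ν : ℝ) ^ 2 ≤ c * (C * 2 * 2 ^ k) ^ 2 := by gcongr
      _ = c * (2 ^ k) ^ 2 * (C * 2) ^ 2 := by ring
      _ ≤ _ := by gcongr

end KEG

namespace KEG

/-! ### Sparse and dense graphexes -/

section Main

variable {Ω : Type*} [MeasurableSpace Ω] {P : Measure Ω} [IsProbabilityMeasure P]
  {p : ℕ → Ω → ℝ × ℝ} {ζ : Sym2 ℕ → Ω → ℝ} {W : ℝ → ℝ → ℝ}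

theorem ae_halfLine_nonneg : ∀ᵐ s ∂halfLine, 0 ≤ s :=
  ae_restrict_of_forall_mem measurableSet_Ici fun _ hs => hs

theorem IsGraphex.measurable_diag (hW : IsGraphex W) : Measurable fun s => clip W s s :=
  hW.isLatentKernel_clip.measurable.comp (f := fun s : ℝ => (s, s)) (by fun_prop)

theorem IsGraphex.lintegral_diag_ne_top (hW : IsGraphex W) :
    ∫⁻ s, ENNReal.ofReal (clip W s s) ∂halfLine ≠ ∞ := by
  refine ne_of_eq_of_ne (lintegral_congr_ae ?_) hW.diagonal.ne
  filter_upwards [ae_halfLine_nonneg] with s hs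
  rw [clip_of_nonneg hs hs]

theorem IsKEGSource.ae_pos (hG : IsKEGSource P p ζ) :
    ∀ᵐ ω ∂P, (∀ i, 0 ≤ (p i ω).1 ∧ 0 ≤ (p i ω).2) ∧ ∀ e, 0 ≤ ζ e ω := by
  filter_upwards [hG.poisson.ae_nonneg, hG.ae_mark_mem] with ω h1 h2
  exact ⟨h1, fun e => (h2 e).1⟩

theorem IsKEGSource.ae_loops_le (hG : IsKEGSource P p ζ) (hW : IsGraphex W) :
    ∀ᵐ ω ∂P, ∀ᶠ k : ℕ in atTop, ((indexLoops W p ζ ω (2 ^ k)).encard : ℝ≥0∞) ≤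
      (∫⁻ s, ENNReal.ofReal (clip W s s) ∂halfLine + 1) * 2 ^ k := by
  filter_upwards [hG.ae_loopSum_bounds hW.measurable_diag
    (fun s => hW.isLatentKernel_clip.le_one s s) hW.lintegral_diag_ne_top, hG.ae_pos]
    with ω h1 h2
  filter_upwards [h1 1 one_ne_zero] with k hk
  rw [← loopSum_eq_encard h2.1 h2.2]
  refine hk.1.trans (le_of_eq ?_)
  ring

/-- Finite means give almost sure finiteness for the countably many windows `2 ^ k`; monotonicity
then covers all real `ν` on a single event. -/
theorem IsKEGSource.ae_indexEdges_finite (hG : IsKEGSource P p ζ) (hW : IsGraphex W)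
    (hfin : ∫⁻ z, ENNReal.ofReal (W z.1 z.2) ∂quadrant ≠ ∞) :
    ∀ᵐ ω ∂P, ∀ ν, (indexEdges W p ζ ω ν).Finite := by
  have hw := hW.isLatentKernel_clip
  rw [← hW.lintegral_marginal_clip] at hfin
  have h1 : ∀ᵐ ω ∂P, ∀ k : ℕ, pairSum (box (2 ^ k) (clip W)) p ζ ω < ∞ := by
    rw [ae_all_iff]
    intro k
    refine ae_lt_top (hG.measurable_pairSum (hw.isKernel_box _)) ?_
    rw [hG.lintegral_pairSum (hw.isKernel_box _), hw.lintegral_kernelDegree_box]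
    exact ENNReal.mul_ne_top (ENNReal.pow_ne_top ENNReal.ofReal_ne_top) hfin
  have h2 : ∀ᵐ ω ∂P, ∀ k : ℕ, loopSum (boxLoop (2 ^ k) fun s => clip W s s) p ζ ω < ∞ := by
    rw [ae_all_iff]
    intro k
    refine ae_lt_top (hG.measurable_loopSum (measurable_boxLoop hW.measurable_diag _)) ?_
    rw [hG.lintegral_loopSum (measurable_boxLoop hW.measurable_diag _)
      (boxLoop_le_one (fun s => hw.le_one s s) _), lintegral_boxLoop hW.measurable_diag]
    exact ENNReal.mul_ne_top ENNReal.ofReal_ne_top hW.lintegral_diag_ne_top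
  filter_upwards [h1, h2, hG.ae_pos] with ω h1 h2 h3 ν
  obtain ⟨k, hk⟩ := pow_unbounded_of_one_lt ν (one_lt_two (α := ℝ))
  refine Set.Finite.subset (Set.encard_lt_top_iff.1 ?_) (indexEdges_mono hk.le)
  refine (encard_indexEdges_le _).trans_lt ?_
  have h4 := h1 k
  have h5 := h2 k
  rw [pairSum_eq_encard h3.1 h3.2, ENat.toENNReal_lt_top] at h4
  rw [loopSum_eq_encard h3.1 h3.2, ENat.toENNReal_lt_top] at h5
  exact WithTop.add_lt_top.2 ⟨h4, h5⟩

theorem IsKEGSource.ae_indexEdges_le (hG : IsKEGSource P p ζ) (hW : IsGraphex W)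
    (hfin : ∫⁻ z, ENNReal.ofReal (W z.1 z.2) ∂quadrant ≠ ∞) :
    ∀ᵐ ω ∂P, ∀ᶠ k : ℕ in atTop, ((indexEdges W p ζ ω (2 ^ k)).encard : ℝ≥0∞) ≤
      (∫⁻ z, ENNReal.ofReal (W z.1 z.2) ∂quadrant + 1 +
        (∫⁻ s, ENNReal.ofReal (clip W s s) ∂halfLine + 1)) * 4 ^ k := by
  have hw := hW.isLatentKernel_clip
  rw [← hW.lintegral_marginal_clip] at hfin ⊢
  filter_upwards [hG.ae_pairSum_bounds hw hfin, hG.ae_loops_le hW, hG.ae_pos] with ω h1 h2 h3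
  filter_upwards [h1.1, h2] with k hk1 hk2
  rw [pairSum_eq_encard h3.1 h3.2] at hk1
  calc _ ≤ (((indexPairs W p ζ ω (2 ^ k)).encard + (indexLoops W p ζ ω (2 ^ k)).encard : ℕ∞) :
        ℝ≥0∞) := ENat.toENNReal_le.2 (encard_indexEdges_le _)
    _ ≤ _ := by
        rw [ENat.toENNReal_add, add_mul _ _ ((4 : ℝ≥0∞) ^ k)]
        refine add_le_add hk1 (hk2.trans (mul_le_mul_right ?_ _))
        exact pow_le_pow_left₀ zero_le (by norm_num) _

theorem toReal_ncard_le {α : Type*} {s : Set α} (hs : s.Finite) {C : ℝ≥0∞} (hC : C ≠ ∞) {b : ℕ}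
    {k : ℕ} (h : (s.encard : ℝ≥0∞) ≤ C * (b : ℝ≥0∞) ^ k) : (s.ncard : ℝ) ≤ C.toReal * (b : ℝ) ^ k := by
  rw [← hs.cast_ncard_eq, ENat.toENNReal_coe] at h
  have := ENNReal.toReal_mono
    (ENNReal.mul_ne_top hC (ENNReal.pow_ne_top (ENNReal.natCast_ne_top b))) h
  simpa using this

theorem le_toReal_ncard {α : Type*} {s : Set α} (hs : s.Finite) {c : ℝ≥0∞} {b : ℕ}
    {k : ℕ} (h : c * (b : ℝ≥0∞) ^ k ≤ (s.encard : ℝ≥0∞)) : c.toReal * (b : ℝ) ^ k ≤ (s.ncard : ℝ) := by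
  rw [← hs.cast_ncard_eq, ENat.toENNReal_coe] at h
  have := ENNReal.toReal_mono (ENNReal.natCast_ne_top _) h
  simpa using this

theorem hasGrowingTruncations_of_index {ω : Ω} (hinj : Function.Injective fun i => (p i ω).1)
    (hfin : ∀ ν, (indexEdges W p ζ ω ν).Finite)
    (hv : Tendsto (fun ν => (indexVertices W p ζ ω ν).ncard) atTop atTop) :
    HasGrowingTruncations (edgeSet W p ζ ω) := by
  refine ⟨fun ν => ?_, ?_⟩
  · rw [truncation_edgeSet]
    exact (hfin ν).image _
  · rwa [funext fun ν => numVertices_eq (W := W) (ζ := ζ) hinj ν]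

/-- A graphex whose marginal is positive only on a set of finite measure has finite-measure
support. -/
theorem IsGraphex.hasFiniteMeasureSupport (hW : IsGraphex W)
    (h : halfLine {s | marginal (clip W) s ≠ 0} ≠ ∞) : HasFiniteMeasureSupport W := by
  have hw := hW.isLatentKernel_clip
  have hS : MeasurableSet {s | marginal (clip W) s ≠ 0} :=
    hw.measurable_marginal (measurableSet_singleton 0).compl
  refine ⟨_, hS, h.lt_top, ?_⟩
  -- By Fubini, rows of zero marginal vanish almost everywhere; symmetry transfers this to columns.
  have h1 : ∀ᵐ z ∂quadrant, marginal (clip W) z.1 = 0 → clip W z.1 z.2 = 0 := by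
    have hm : MeasurableSet {z : ℝ × ℝ | marginal (clip W) z.1 = 0 → clip W z.1 z.2 = 0} := by
      have : {z : ℝ × ℝ | marginal (clip W) z.1 = 0 → clip W z.1 z.2 = 0} =
          {z | marginal (clip W) z.1 = 0}ᶜ ∪ {z | clip W z.1 z.2 = 0} := by
        ext z; simp [imp_iff_not_or]
      rw [this]
      exact ((hw.measurable_marginal.comp measurable_fst) (measurableSet_singleton 0)).compl.union
        (hw.measurable (measurableSet_singleton 0))
    rw [quadrant, Measure.ae_prod_iff_ae_ae hm]
    refine Eventually.of_forall fun x => ?_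
    by_cases hx : marginal (clip W) x = 0
    · have hmx : Measurable fun y => ENNReal.ofReal (clip W x y) :=
        hw.measurable_ofReal.comp measurable_prodMk_left
      rw [marginal, lintegral_eq_zero_iff hmx] at hx
      filter_upwards [hx] with y hy _
      exact le_antisymm (ENNReal.ofReal_eq_zero.1 hy) (hw.nonneg _ _)
    · exact Eventually.of_forall fun y hxy => absurd hxy hx
  have h2 : ∀ᵐ z ∂quadrant, marginal (clip W) z.2 = 0 → clip W z.1 z.2 = 0 := by
    have hsw : MeasurePreserving Prod.swap quadrant quadrant := Measure.measurePreserving_swap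
    filter_upwards [hsw.quasiMeasurePreserving.ae h1] with z hz h0
    rw [hw.symm]
    exact hz h0
  filter_upwards [h1, h2, ae_clip_eq W] with z h1 h2 h3 hz
  rw [← h3]
  by_cases hz1 : marginal (clip W) z.1 = 0
  · exact h1 hz1
  · refine h2 ?_
    by_contra hz2
    exact hz ⟨hz1, hz2⟩

theorem IsKEGSource.ae_isSparse (hG : IsKEGSource P p ζ) (hW : IsGraphex W) (hint : IsIntegrable W)
    (hS : ¬ HasFiniteMeasureSupport W) : ∀ᵐ ω ∂P, IsSparse (edgeSet W p ζ ω) := by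
  have hw := hW.isLatentKernel_clip
  have hfin : ∫⁻ z, ENNReal.ofReal (W z.1 z.2) ∂quadrant ≠ ∞ := hint.lintegral_lt_top.ne
  have hfin' : ∫⁻ s, marginal (clip W) s ∂halfLine ≠ ∞ := by
    rwa [hW.lintegral_marginal_clip]
  have hinf : halfLine {s | marginal (clip W) s ≠ 0} = ∞ := by
    by_contra h
    exact hS (hW.hasFiniteMeasureSupport h)
  filter_upwards [hG.ae_indexEdges_finite hW hfin, hG.ae_indexEdges_le hW hfin,
    hG.ae_nonisolated_superlinear hw hfin' hinf, hG.ae_pos, hG.poisson.ae_label_injective]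
    with ω h1 h2 h3 h4 hinj
  have hC : ∫⁻ z, ENNReal.ofReal (W z.1 z.2) ∂quadrant + 1 +
      (∫⁻ s, ENNReal.ofReal (clip W s s) ∂halfLine + 1) ≠ ∞ := by
    simp [hfin, hW.lintegral_diag_ne_top]
  obtain ⟨hv, hlim⟩ := tendsto_sqrt_div_of_dyadic
    (e := fun ν => (indexEdges W p ζ ω ν).ncard) (v := fun ν => (indexVertices W p ζ ω ν).ncard)
    (fun a b hab => Set.ncard_le_ncard (indexEdges_mono hab) (h1 b))
    (fun a b hab => Set.ncard_le_ncard (indexVertices_mono hab) (indexVertices_finite (h1 b)))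
    (h2.mono fun k hk => by exact_mod_cast toReal_ncard_le (b := 4) (h1 _) hC (by exact_mod_cast hk))
    (fun K => (h3 K).mono fun k hk => by
      have := le_toReal_ncard (b := 2) (c := K) (indexVertices_finite (h1 (2 ^ k)))
        (by exact_mod_cast hk.trans (tsum_nonisolated_le h4.1 h4.2 _))
      simpa using this)
  refine ⟨hasGrowingTruncations_of_index hinj h1 hv, ?_⟩
  simpa only [numEdges_eq hinj, numVertices_eq hinj] using hlim

/-- `W ≤ 1` bounds the integral by `|S|²`, so the moment estimates for integrable kernels apply. -/
theorem HasFiniteMeasureSupport.lintegral_ne_top (hW : IsGraphex W)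
    (hS : HasFiniteMeasureSupport W) : ∫⁻ z, ENNReal.ofReal (W z.1 z.2) ∂quadrant ≠ ∞ := by
  obtain ⟨S, hSm, hSfin, hae⟩ := hS
  refine ne_top_of_le_ne_top (ENNReal.mul_ne_top hSfin.ne hSfin.ne)
    (b := halfLine S * halfLine S) ?_
  rw [← quadrant_prod, ← lintegral_indicator_one (hSm.prod hSm)]
  refine lintegral_mono_ae ?_
  filter_upwards [hae, ae_quadrant_nonneg] with z hz h0
  by_cases hzS : z ∈ S ×ˢ S
  · rw [Set.indicator_of_mem hzS]
    simpa using hW.le_one _ _ h0.1 h0.2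
  · simp [hz hzS]

open Classical in
/-- Almost surely all proper edges join points with latent values in the support. -/
theorem IsKEGSource.ae_edges_mem_support (hG : IsKEGSource P p ζ) (hW : IsGraphex W) {S : Set ℝ}
    (hSm : MeasurableSet S) (hae : ∀ᵐ z ∂quadrant, z ∉ S ×ˢ S → W z.1 z.2 = 0) :
    ∀ᵐ ω ∂P, ∀ i j, i ≠ j → ζ s(i, j) ω < W (p i ω).2 (p j ω).2 →
      (p i ω).2 ∈ S ∧ (p j ω).2 ∈ S := by
  have hw := hW.isLatentKernel_clip
  -- The part of the kernel off `S × S` has zero integral, so its expected edge count is zero. Self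
  -- edges escape this argument because the diagonal is null in the quadrant.
  set u : ℝ → ℝ → ℝ := fun x y => if x ∈ S ∧ y ∈ S then 0 else clip W x y with hu
  have hul : IsLatentKernel u :=
    { measurable := Measurable.ite ((hSm.preimage measurable_fst).inter
        (hSm.preimage measurable_snd)) measurable_const hw.measurable
      symm := fun x y => by
        simp only [hu]
        rw [hw.symm]
        exact if_congr and_comm rfl rfl
      nonneg := fun x y => by
        simp only [hu]; split_ifs; exacts [le_rfl, hw.nonneg _ _]
      le_one := fun x y => by
        simp only [hu]; split_ifs; exacts [zero_le_one, hw.le_one _ _] }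
  have h0 : ∫⁻ s, marginal u s ∂halfLine = 0 := by
    rw [hul.lintegral_marginal, lintegral_eq_zero_iff hul.measurable_ofReal]
    filter_upwards [hae, ae_clip_eq W] with z hz hc
    by_cases hzS : z.1 ∈ S ∧ z.2 ∈ S
    · simp [hu, hzS]
    · simp only [hu, if_neg hzS]
      rw [hc, hz hzS]
      simp
  have h1 : ∀ᵐ ω ∂P, ∀ k : ℕ, pairSum (box (2 ^ k) u) p ζ ω = 0 := by
    rw [ae_all_iff]
    intro k
    refine (lintegral_eq_zero_iff (hG.measurable_pairSum (hul.isKernel_box _))).1 ?_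
    rw [hG.lintegral_pairSum (hul.isKernel_box _), hul.lintegral_kernelDegree_box, h0, mul_zero]
  filter_upwards [h1, hG.ae_pos] with ω h1 h2 i j hij hlt
  by_contra hS
  obtain ⟨k, hk⟩ := pow_unbounded_of_one_lt (max (p i ω).1 (p j ω).1) (one_lt_two (α := ℝ))
  have h3 := ENNReal.tsum_eq_zero.1 (ENNReal.tsum_eq_zero.1 (h1 k) i) j
  rw [adj_of_ne hij] at h3
  have h4 : ζ s(i, j) ω < box (2 ^ k) u (p i ω) (p j ω) := by
    rw [box, if_pos ⟨⟨(h2.1 i).1, (le_max_left _ _).trans hk.le⟩,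
      ⟨(h2.1 j).1, (le_max_right _ _).trans hk.le⟩⟩]
    simp only [hu, if_neg hS]
    rwa [clip_of_nonneg (h2.1 i).2 (h2.1 j).2]
  rw [if_pos h4] at h3
  exact one_ne_zero h3

/-- Vertices are points of the window over `S`, or points with a self edge, whose latent value may
lie outside `S`; both kinds are linear in `ν`, against quadratically many edges. -/
theorem IsKEGSource.ae_isDense (hG : IsKEGSource P p ζ) (hW : IsGraphex W)
    (hS : HasFiniteMeasureSupport W) (h0 : ¬ IsAEZero W) :
    ∀ᵐ ω ∂P, IsDense (edgeSet W p ζ ω) := by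
  classical
  have hw := hW.isLatentKernel_clip
  have hfin := hS.lintegral_ne_top hW
  have hfin' : ∫⁻ s, marginal (clip W) s ∂halfLine ≠ ∞ := by
    rwa [hW.lintegral_marginal_clip]
  have hne : ∫⁻ s, marginal (clip W) s ∂halfLine ≠ 0 := by
    intro hz
    rw [hw.lintegral_marginal, lintegral_eq_zero_iff hw.measurable_ofReal] at hz
    apply h0
    filter_upwards [hz, ae_clip_eq W] with z hz hc
    rw [← hc]
    exact le_antisymm (ENNReal.ofReal_eq_zero.1 hz) (hw.nonneg _ _)
  obtain ⟨S, hSm, hSfin, hae⟩ := hS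
  filter_upwards [hG.ae_indexEdges_finite hW hfin, hG.ae_pairSum_bounds hw hfin',
    hG.ae_loops_le hW, hG.ae_window_count hSm hSfin.ne, hG.ae_edges_mem_support hW hSm hae,
    hG.ae_pos, hG.poisson.ae_label_injective] with ω h1 h2 h3 h4 h5 h6 hinj
  obtain ⟨c, hc0, hc⟩ := h2.2 hne
  set D := ∫⁻ s, ENNReal.ofReal (clip W s s) ∂halfLine with hD
  have hC : halfLine S + 1 + (D + 1) ≠ ∞ := by
    simp [hSfin.ne, hD, hW.lintegral_diag_ne_top]
  have hedge : ∀ᶠ k : ℕ in atTop, c / 2 * 4 ^ k ≤ ((indexEdges W p ζ ω (2 ^ k)).encard : ℝ≥0∞) := by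
    filter_upwards [hc] with k hk
    rw [pairSum_eq_encard h6.1 h6.2] at hk
    have h7 := hk.trans (ENat.toENNReal_le.2 (encard_indexPairs_le _))
    rw [ENat.toENNReal_add, ← two_mul] at h7
    rw [show c / 2 * 4 ^ k = c * 4 ^ k / 2 by simp only [div_eq_mul_inv]; ring]
    exact ENNReal.div_le_of_le_mul' h7
  have hvert : ∀ᶠ k : ℕ in atTop, ((indexVertices W p ζ ω (2 ^ k)).encard : ℝ≥0∞) ≤
      (halfLine S + 1 + (D + 1)) * 2 ^ k := by
    filter_upwards [h3, h4 1 one_ne_zero] with k hk3 hk4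
    have hsub : indexVertices W p ζ ω (2 ^ k) ⊆
        {i | (p i ω).1 ∈ Set.Icc (0 : ℝ) (2 ^ k) ∧ (p i ω).2 ∈ S} ∪
          indexLoops W p ζ ω (2 ^ k) := by
      rintro i ⟨_, ⟨a, b, rfl, ⟨ha, hb⟩, hab⟩, hi⟩
      by_cases hne : a = b
      · subst hne
        rw [Sym2.mem_iff, or_self] at hi
        subst hi
        exact Or.inr ⟨ha, hab⟩
      · have hs := h5 a b hne hab
        rcases Sym2.mem_iff.1 hi with rfl | rfl
        exacts [Or.inl ⟨ha, hs.1⟩, Or.inl ⟨hb, hs.2⟩]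
    have h8 := ENat.toENNReal_le.2 ((Set.encard_le_encard hsub).trans (Set.encard_union_le _ _))
    rw [ENat.toENNReal_add, ← tsum_ite_one] at h8
    refine h8.trans ((add_le_add hk4.1 hk3).trans (le_of_eq ?_))
    ring
  -- An infinite constant would force an infinite edge set; finiteness is needed to pass to real
  -- numbers.
  have hcc : c / 2 ≠ ∞ := by
    intro htop
    obtain ⟨k, hk⟩ := hedge.exists
    rw [htop, ENNReal.top_mul (pow_ne_zero _ (by simp)), top_le_iff, ENat.toENNReal_eq_top,
      Set.encard_eq_top_iff] at hk
    exact hk (h1 _)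
  obtain ⟨hv, c', hc', hlim⟩ := dense_of_dyadic
    (e := fun ν => (indexEdges W p ζ ω ν).ncard) (v := fun ν => (indexVertices W p ζ ω ν).ncard)
    (fun a b hab => Set.ncard_le_ncard (indexEdges_mono hab) (h1 b))
    (fun a b hab => Set.ncard_le_ncard (indexVertices_mono hab) (indexVertices_finite (h1 b)))
    (fun ν => ncard_indexEdges_le (h1 ν))
    (c := (c / 2).toReal) (C := (halfLine S + 1 + (D + 1)).toReal)
    (ENNReal.toReal_pos (by simp [hc0]) hcc) (ENNReal.toReal_pos (by simp) hC)
    (hedge.mono fun k hk => by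
      exact_mod_cast le_toReal_ncard (b := 4) (h1 (2 ^ k)) (by exact_mod_cast hk))
    (hvert.mono fun k hk => by
      exact_mod_cast toReal_ncard_le (b := 2) (indexVertices_finite (h1 (2 ^ k))) hC
        (by exact_mod_cast hk))
  refine ⟨hasGrowingTruncations_of_index hinj h1 hv, c', hc', ?_⟩
  simpa only [numEdges_eq hinj, numVertices_eq hinj] using hlim

theorem IsCompactlySupported.hasFiniteMeasureSupport (h : IsCompactlySupported W) :
    HasFiniteMeasureSupport W := by
  obtain ⟨c, hc⟩ := h
  refine ⟨Set.Icc 0 c, measurableSet_Icc, by rw [halfLine_Icc]; exact ENNReal.ofReal_lt_top, ?_⟩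
  filter_upwards [ae_quadrant_nonneg] with z h0 hz
  by_contra hne
  have := hc _ _ h0.1 h0.2 hne
  exact hz ⟨⟨h0.1, this.1⟩, ⟨h0.2, this.2⟩⟩

end Main

end KEG

theorem mainTheorem6 {Ω : Type*} [MeasurableSpace Ω] (P : Measure Ω) [IsProbabilityMeasure P]
    (p : ℕ → Ω → ℝ × ℝ) (ζ : Sym2 ℕ → Ω → ℝ) (hG : KEG.IsKEGSource P p ζ)
    (W : ℝ → ℝ → ℝ) (hW : KEG.IsGraphex W) :
    (KEG.IsCompactlySupported W → ¬ KEG.IsAEZero W →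
      ∀ᵐ ω ∂P, KEG.IsDense (KEG.edgeSet W p ζ ω)) ∧
    (KEG.HasFiniteMeasureSupport W → ¬ KEG.IsAEZero W →
      ∀ᵐ ω ∂P, KEG.IsDense (KEG.edgeSet W p ζ ω)) ∧
    (KEG.IsIntegrable W → ¬ KEG.HasFiniteMeasureSupport W →
      ∀ᵐ ω ∂P, KEG.IsSparse (KEG.edgeSet W p ζ ω)) :=
  ⟨fun hc h0 => hG.ae_isDense hW hc.hasFiniteMeasureSupport h0,
    fun hS h0 => hG.ae_isDense hW hS h0,
    fun hint hS => hG.ae_isSparse hW hint hS⟩
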